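/- Let $K\subset\mathbb C$ be a subfield. Let $\mathcal R_K$ be the class of power series $F(z)=\sum_{n\ge 0}A_nz^n$ with positive radius of convergence whose principal branch has in $\mathbb C$ only isolated singularities, all of them integrable and with $K$-recurrent monodromy. Precisely, $F\in\mathcal R_K$ if there is a locally finite set $S\subset\mathbb C\setminus\{0\}$ such that: 1. $F$ extends holomorphically to the star $\mathbb C\setminus\bigcup_{\alpha\in S}\{t\alpha : t\ge 1\}$ (the principal branch). 2. For every $p\in\mathbb C\setminus(S\cup\{0\})$ and each of the two sides of the ray from $0$ through $p$, the principal branch, taken on that side near $p$, extends holomorphically to a neighbourhood of $p$. 3. For every $\alpha\in S$ and each of the two sides of the ray from $0$ through $\alpha$, the principal branch, taken on that side near $\alpha$, continues analytically along all paths in some punctured disc centred at $\alpha$. The multivalued local germ so obtained, again denoted $F$, satisfies the following two conditions, where $\Sigma_\alpha F$ denotes its analytic continuation along one positive turn around $\alpha$: (a) (integrable singularity) $(z-\alpha)F(z)\to 0$ as $z\to\alpha$ with $\arg(z-\alpha)$ bounded (for every bound); (b) ($K$-recurrent monodromy) there are $d\ge 1$ and $a_0,\dots,a_{d-1}\in K$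 such that, for all $m\ge 0$, $$\Sigma_\alpha^{m+d}F=\sum_{k=0}^{d-1}a_k\,\Sigma_\alpha^{m+k}F .$$ Then $\mathcal R_K$ is closed under the Hadamard product: if $F=\sum A_nz^n$ and $G=\sum B_nz^n$ belong to $\mathcal R_K$, then so does $F\odot G=\sum_{n\ge 0}A_nB_nz^n$. -/

import Mathlib

open Filter Topology

/-- The Hadamard (coefficientwise) product of two power series. -/
noncomputable def hadamardProduct (f g : PowerSeries ℂ) : PowerSeries ℂ :=
  PowerSeries.mk fun n => PowerSeries.coeff n f * PowerSeries.coeff n g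

/-- The principal star with respect to `S`: the plane with the closed radial cuts
`{t * α | 1 ≤ t}`, `α ∈ S`, removed. -/
def principalStar (S : Set ℂ) : Set ℂ :=
  {z | ∀ t : ℝ, 0 ≤ t → t ≤ 1 → (t : ℂ) * z ∉ S}

/-- `F` is the principal branch, on the star with respect to `S`, of the holomorphic germ at `0`
given by the power series `f` (in particular `f` converges near `0`).
The values of `F` outside the star are irrelevant. -/
structure IsPrincipalBranch (f : PowerSeries ℂ) (S : Set ℂ) (F : ℂ → ℂ) : Prop where
  hasSum_near_zero : ∀ᶠ z in 𝓝 (0 : ℂ), HasSum (fun n : ℕ => PowerSeries.coeff n f * z ^ n) (F z)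
  analyticOnNhd : AnalyticOnNhd ℂ F (principalStar S)

/-- The two sides of the ray through `p`. -/
inductive RaySide
  | left
  | right

/-- The open half plane of points lying on the given side of the line through `0` and `p`. -/
def RaySide.region (p : ℂ) : RaySide → Set ℂ
  | .left => {z | 0 < (z / p).im}
  | .right => {z | (z / p).im < 0}

/-- For `z = p + p * exp w`, the range of `w.im` that is used to anchor a branch at `p`:
these `z` are the points of the half plane `RaySide.region p` with the same side. -/
def RaySide.angles : RaySide → Set ℝ
  | .left => Set.Ioo 0 Real.pi
  | .right => Set.Ioo (-Real.pi) 0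

/-- The function `F`, restricted to the given side of the ray through `p`, extends holomorphically
to a neighbourhood of `p`. -/
def ExtendsAcross (F : ℂ → ℂ) (p : ℂ) (s : RaySide) : Prop :=
  ∃ g : ℂ → ℂ, AnalyticAt ℂ g p ∧ ∀ᶠ z in 𝓝 p, z ∈ s.region p → g z = F z

/-- `F`, restricted to the given side of the ray through `p ≠ 0`, continues analytically along
every path in the punctured disc `0 < ‖z - p‖ < ‖p‖ * exp c`. The continuation is recorded as a
holomorphic function `Φ` on the universal covering `{w | w.re < c}` of that punctured disc,
with covering map `w ↦ z = p + p * exp w`. -/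
structure IsLocalContinuation (F : ℂ → ℂ) (p : ℂ) (s : RaySide) (c : ℝ) (Φ : ℂ → ℂ) : Prop where
  differentiableOn : DifferentiableOn ℂ Φ {w | w.re < c}
  eq_on_side : ∀ w : ℂ, w.re < c → w.im ∈ s.angles → Φ w = F (p + p * Complex.exp w)

/-- The monodromy operator `Σ`: analytic continuation along one positive turn around the
singularity, in the logarithmic coordinate `w`. -/
noncomputable def monodromy (Φ : ℂ → ℂ) : ℂ → ℂ :=
  fun w => Φ (w + 2 * Real.pi * Complex.I)

/-- Integrability of the singularity `p`: `(z - p) F(z) → 0` in the Stolz sense, that is, as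
`z → p` with `arg (z - p)` bounded, where `z - p = p * exp w`. -/
def IsIntegrableAt (p : ℂ) (Φ : ℂ → ℂ) : Prop :=
  ∀ M : ℝ, Tendsto (fun w : ℂ => p * Complex.exp w * Φ w)
    (comap Complex.re atBot ⊓ 𝓟 {w : ℂ | |w.im| ≤ M}) (𝓝 0)

/-- The iterated monodromies satisfy a linear recurrence of some order `d ≥ 1` with constant
coefficients in `K`. -/
def IsRecurrentOver (K : Subfield ℂ) (c : ℝ) (Φ : ℂ → ℂ) : Prop :=
  ∃ d : ℕ, 1 ≤ d ∧ ∃ a : ℕ → ℂ, (∀ k < d, a k ∈ K) ∧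
    ∀ m : ℕ, ∀ w : ℂ, w.re < c →
      monodromy^[m + d] Φ w = ∑ k ∈ Finset.range d, a k * monodromy^[m + k] Φ w

/-- The `K`-recurrent monodromy class with integrable singularities: germs at `0` whose principal
branch has, in the whole plane, only isolated singularities (contained in a locally finite set
`S ⊆ ℂ \ {0}`), all of them integrable and with `K`-recurrent monodromy.
A point of the plane may lie behind a singularity on the same ray; the principal branch then
reaches it from the two sides of the cut, and both are taken into account. -/
def KRecurrentIntegrableClass (K : Subfield ℂ) : Set (PowerSeries ℂ) :=
  {f | ∃ (S : Set ℂ) (F : ℂ → ℂ),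
    (0 : ℂ) ∉ S ∧
    (∀ R : ℝ, (S ∩ Metric.closedBall 0 R).Finite) ∧
    IsPrincipalBranch f S F ∧
    (∀ p : ℂ, p ≠ 0 → p ∉ S → ∀ s : RaySide, ExtendsAcross F p s) ∧
    (∀ p ∈ S, ∀ s : RaySide, ∃ (c : ℝ) (Φ : ℂ → ℂ),
      IsLocalContinuation F p s c Φ ∧ IsIntegrableAt p Φ ∧ IsRecurrentOver K c Φ)}

/-! ### Holomorphic parameter integrals and integrals along segments -/

/-! For small `z`, the product `F ⊙ G` is Hadamard's integral `(1/2πi) ∮ F(u) G(z/u) du/u`. With `u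
= exp (x + d)` and `z = exp (ξ + 2d)` it becomes the symmetric convolution `conv`, the integral of
`F (exp (x + d)) * G (exp (ξ + d - x))` over a vertical segment of length `2π`
(`conv_full_turn_eq`). Decreasing `d.re` moves both arguments radially towards the origin, so radial
continuation up to `exp ξ` is continuation in `d` from far left to a half strip around `0`
(`ConvContinues`, `logContinuation`).

The contour in `x` has to separate the logarithmic cuts of `F`, which run to the right, from the
reflected cuts of `G`, which run to the left. If `ξ` lies in the star of the product set `S * T`, at
each height there is an abscissa lying on neither kind of cut, and the contour can pass there
(`exists_convContinues_level_star`). In general, let `d` stay on one side of the real axis. The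
contour may then run along the whole critical horizontal line, because `d.im` pushes both arguments
off their cuts, and towards the same side (`exists_convContinues_level_side`). As `d → 0` the
horizontal integral can be singular only through an `x` at which both factors are singular, and then
`exp ξ` is a product `α * β` (`GermIf.conv_horizontal`). Where at most one factor is singular, the
segment is moved off the singular point (`LocGerm.conv_regGerm`).

At such a pinch, recurrence is handled through finite-dimensional spaces: `K`-recurrent monodromy
means that a germ lies in a finite-dimensional `K`-space of integrable germs stable under monodromy
(`exists_localSpace_of_isRecurrentOver`, and Cayley–Hamilton in `LocalSpace.isRecurrentOver`). For
two such spaces `V` and `W`, the half convolution from `0` to `b` is cut at a point proportional to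
`exp ζ`, where `d = exp ζ`. The inner part turns with `ζ`. The outer part acquires an integral over
a full circle after one turn, and this circle integral is itself periodic in `ζ`. The three families
of integrals are bilinear in `(v, w)`, hence span a finite-dimensional monodromy-stable space, and
estimates show that its elements are integrable (`LocGerm.conv_half`). The return from `d` to `z` is
the change of coordinate `d = log (z / p) / 2`, whose derivative is positive after scaling by `p`,
so it preserves sides and monodromy (`LocGerm.comp`). -/

theorem differentiableOn_intervalIntegral_param {U : Set ℂ} (hU : IsOpen U) {k : ℂ → ℝ → ℂ}
    (hc : ContinuousOn (fun x : ℂ × ℝ => k x.1 x.2) (U ×ˢ Set.Icc 0 1))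
    (hd : ∀ t ∈ Set.Icc (0 : ℝ) 1, DifferentiableOn ℂ (fun z => k z t) U) :
    DifferentiableOn ℂ (fun z => ∫ t in (0 : ℝ)..1, k z t) U := by
  intro z₀ hz₀
  obtain ⟨r, hr, hrU⟩ := Metric.nhds_basis_closedBall.mem_iff.1 (hU.mem_nhds hz₀)
  have hK : IsCompact (Metric.closedBall z₀ r ×ˢ Set.Icc (0 : ℝ) 1) :=
    (isCompact_closedBall z₀ r).prod isCompact_Icc
  obtain ⟨C, hC⟩ := hK.exists_bound_of_continuousOn
    (hc.mono (Set.prod_mono hrU subset_rfl))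
  have hct : ∀ z ∈ U, ContinuousOn (k z) (Set.Icc 0 1) := fun z hz =>
    hc.comp (f := fun t : ℝ => (z, t)) (by fun_prop) (fun t ht => ⟨hz, ht⟩)
  have hu : Set.uIcc (0 : ℝ) 1 = Set.Icc 0 1 := Set.uIcc_of_le zero_le_one
  have hsub : Set.uIoc (0 : ℝ) 1 ⊆ Set.Icc 0 1 := by
    rw [Set.uIoc_of_le zero_le_one]; exact Set.Ioc_subset_Icc_self
  have hmeas : ∀ z ∈ U, MeasureTheory.AEStronglyMeasurable (k z)
      (MeasureTheory.volume.restrict (Set.uIoc (0 : ℝ) 1)) := fun z hz =>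
    ((hct z hz).mono hsub).aestronglyMeasurable measurableSet_uIoc
  have hder : ∀ z ∈ Metric.ball z₀ (r / 2), ∀ t ∈ Set.Icc (0 : ℝ) 1,
      HasDerivAt (fun z => k z t) (deriv (fun z => k z t) z) z := fun z hz t ht =>
    ((hd t ht).differentiableAt (hU.mem_nhds (hrU (Metric.ball_subset_closedBall
      (Metric.ball_subset_ball (by linarith) hz))))).hasDerivAt
  have h0 : z₀ ∈ Metric.ball z₀ (r / 2) := Metric.mem_ball_self (by linarith)
  have := intervalIntegral.hasDerivAt_integral_of_dominated_loc_of_deriv_le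
    (μ := MeasureTheory.volume) (a := 0) (b := 1) (F := k)
    (F' := fun z t => deriv (fun z => k z t) z) (x₀ := z₀) (s := Metric.ball z₀ (r / 2))
    (bound := fun _ => C / (r / 2)) (Metric.ball_mem_nhds _ (by linarith))
    (by filter_upwards [hU.mem_nhds hz₀] with z hz using hmeas z hz)
    ((hct z₀ hz₀).intervalIntegrable_of_Icc zero_le_one)
    ?_ ?_ (by simp) ?_
  · exact this.2.differentiableAt.differentiableWithinAt
  -- The `t`-measurability of the derivative comes from writing it as the limit of the slopes along
  -- this sequence.
  · have hlim : Tendsto (fun n : ℕ => z₀ + ((r / (n + 2) : ℝ) : ℂ)) atTop (𝓝[≠] z₀) := by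
      refine tendsto_nhdsWithin_iff.2 ⟨?_, Eventually.of_forall fun n => ?_⟩
      · have h1 : Tendsto (fun n : ℕ => r / ((n : ℝ) + 2)) atTop (𝓝 0) :=
          tendsto_const_nhds.div_atTop
            (tendsto_atTop_add_const_right _ _ tendsto_natCast_atTop_atTop)
        have := (Complex.continuous_ofReal.tendsto 0).comp h1
        simpa using (tendsto_const_nhds (x := z₀)).add this
      · have : (r / (n + 2) : ℝ) ≠ 0 := by positivity
        simp only [Set.mem_compl_iff, Set.mem_singleton_iff, add_eq_left]
        exact_mod_cast this
    refine aestronglyMeasurable_of_tendsto_ae atTop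
      (f := fun (n : ℕ) t => slope (fun z => k z t) z₀ (z₀ + ((r / (n + 2) : ℝ) : ℂ))) ?_ ?_
    · intro n
      simp only [slope, vsub_eq_sub]
      refine MeasureTheory.AEStronglyMeasurable.const_smul (𝕜 := ℂ)
        ((hmeas _ (hrU ?_)).sub (hmeas _ hz₀)) _
      simp only [Metric.mem_closedBall, dist_self_add_left, Complex.norm_real, Real.norm_eq_abs]
      rw [abs_of_pos (by positivity)]
      exact div_le_self hr.le (by linarith [n.cast_nonneg (α := ℝ)])
    · filter_upwards [MeasureTheory.ae_restrict_mem measurableSet_uIoc] with t ht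
      exact (hasDerivAt_iff_tendsto_slope.1 (hder z₀ h0 t (hsub ht))).comp hlim
  -- Cauchy's estimate on circles of radius `r / 2` dominates the derivative uniformly.
  · refine Eventually.of_forall fun t ht z hz => ?_
    have hcb : Metric.closedBall z (r / 2) ⊆ Metric.closedBall z₀ r :=
      Metric.closedBall_subset_closedBall' (by have := Metric.mem_ball.1 hz; linarith)
    refine Complex.norm_deriv_le_of_forall_mem_sphere_norm_le (by linarith) ?_ fun w hw => ?_
    · exact ((hd t (hsub ht)).mono (hcb.trans hrU)).diffContOnCl_ball subset_rfl
    · exact hC (w, t) ⟨hcb (Metric.sphere_subset_closedBall hw), hsub ht⟩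
  · exact Eventually.of_forall fun t ht z hz => hder z hz t (hsub ht)

/-- The integral of `f` along the segment from `a` to `b`. -/
noncomputable def segInt (f : ℂ → ℂ) (a b : ℂ) : ℂ :=
  (b - a) * ∫ t in (0 : ℝ)..1, f (a + t * (b - a))

theorem mem_segment_param {a b : ℂ} {t : ℝ} (ht : t ∈ Set.Icc (0 : ℝ) 1) :
    a + t * (b - a) ∈ segment ℝ a b := by
  rw [segment_eq_image']
  exact ⟨t, ht, by simp⟩

theorem exists_of_mem_segment {a b x : ℂ} (h : x ∈ segment ℝ a b) :
    ∃ t ∈ Set.Icc (0 : ℝ) 1, x = a + t * (b - a) := by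
  rw [segment_eq_image'] at h
  obtain ⟨t, ht, rfl⟩ := h
  exact ⟨t, ht, by simp⟩

theorem segInt_congr {f g : ℂ → ℂ} {a b : ℂ} (h : ∀ x ∈ segment ℝ a b, f x = g x) :
    segInt f a b = segInt g a b := by
  unfold segInt
  congr 1
  refine intervalIntegral.integral_congr fun t ht => h _ (mem_segment_param ?_)
  rwa [Set.uIcc_of_le zero_le_one] at ht

theorem segInt_eq_sub {f g : ℂ → ℂ} {a b : ℂ} {U : Set ℂ} (hU : Convex ℝ U) (ha : a ∈ U)
    (hb : b ∈ U) (hf : ContinuousOn f U) (hg : ∀ x ∈ U, HasDerivWithinAt g (f x) U x) :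
    segInt f a b = g b - g a := by
  have hm : ∀ t ∈ Set.uIcc (0 : ℝ) 1, a + t * (b - a) ∈ U := fun t ht =>
    hU.segment_subset ha hb (mem_segment_param (by rwa [Set.uIcc_of_le zero_le_one] at ht))
  have hline : ∀ t : ℝ, HasDerivAt (fun t : ℝ => a + t * (b - a)) (b - a) t := fun t => by
    simpa using ((Complex.ofRealCLM.hasDerivAt (x := t)).mul_const (b - a)).const_add a
  have h1 : ∫ t in (0 : ℝ)..1, f (a + t * (b - a)) * (b - a) =
      g (a + (1 : ℝ) * (b - a)) - g (a + (0 : ℝ) * (b - a)) := by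
    refine intervalIntegral.integral_eq_sub_of_hasDeriv_right_of_le
      (f := fun t : ℝ => g (a + t * (b - a))) zero_le_one ?_ ?_ ?_
    · have hgc : ContinuousOn g U := fun x hx => (hg x hx).continuousWithinAt
      exact hgc.comp (f := fun t : ℝ => a + t * (b - a)) (by fun_prop)
        (fun t ht => hm t (by rwa [Set.uIcc_of_le zero_le_one]))
    · intro t ht
      have hT : t ∈ Set.uIcc (0 : ℝ) 1 := by
        rw [Set.uIcc_of_le zero_le_one]; exact ⟨ht.1.le, ht.2.le⟩
      have := (hg _ (hm t hT)).scomp (h := fun t : ℝ => a + t * (b - a)) (s := Set.Icc 0 1) t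
        (hline t).hasDerivWithinAt
        (fun s hs => hm s (by rwa [Set.uIcc_of_le zero_le_one]))
      have h2 : HasDerivAt (fun t : ℝ => g (a + t * (b - a))) ((b - a) • f (a + t * (b - a))) t :=
        this.hasDerivAt (Icc_mem_nhds ht.1 ht.2)
      simpa [mul_comm] using h2.hasDerivWithinAt
    · refine ContinuousOn.intervalIntegrable ?_
      exact (hf.comp (f := fun t : ℝ => a + t * (b - a)) (by fun_prop) hm).mul continuousOn_const
  rw [segInt, mul_comm, ← intervalIntegral.integral_mul_const, h1]
  simp

/-- Cauchy's theorem for a triangle, through a primitive on a convex set. All later deformations of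
contours are chains of such triangles. -/
theorem segInt_add_of_convex {f : ℂ → ℂ} {U : Set ℂ} (hU : Convex ℝ U)
    (hf : DifferentiableOn ℂ f U) {a b c : ℂ} (ha : a ∈ U) (hb : b ∈ U) (hc : c ∈ U) :
    segInt f a b + segInt f b c = segInt f a c := by
  obtain ⟨g, hg⟩ := hU.exists_forall_hasDerivWithinAt hf
  rw [segInt_eq_sub hU ha hb hf.continuousOn hg, segInt_eq_sub hU hb hc hf.continuousOn hg,
    segInt_eq_sub hU ha hc hf.continuousOn hg]
  ring

theorem segInt_neg (f : ℂ → ℂ) (a b : ℂ) : segInt (fun x => f (-x)) a b = - segInt f (-a) (-b) := by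
  have : ∀ t : ℝ, -(a + (t : ℂ) * (b - a)) = -a + t * (-b - -a) := fun t => by ring
  simp only [segInt, this]
  ring

theorem segInt_symm (f : ℂ → ℂ) (a b : ℂ) : segInt f a b = - segInt f b a := by
  have h := intervalIntegral.integral_comp_sub_left (a := 0) (b := 1)
    (fun t : ℝ => f (a + t * (b - a))) 1
  have h2 : ∀ t : ℝ, a + ((1 - t : ℝ) : ℂ) * (b - a) = b + t * (a - b) := fun t => by
    push_cast; ring
  simp only [h2, sub_self, sub_zero] at h
  simp only [segInt, h]
  ring

theorem segInt_comp_add (f : ℂ → ℂ) (a b s : ℂ) :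
    segInt (fun x => f (x + s)) a b = segInt f (a + s) (b + s) := by
  have : ∀ t : ℝ, a + (t : ℂ) * (b - a) + s = a + s + t * (b + s - (a + s)) := fun t => by ring
  simp only [segInt, this, add_sub_add_right_eq_sub]

/-- The additive convolution integral along the segment from `a` to `b`, with the parameter
entering symmetrically in both factors. -/
noncomputable def conv (u v : ℂ → ℂ) (a b d : ℂ) : ℂ :=
  segInt (fun x => u (x + d) * v (d - x)) a b

/-- The substitution `x ↦ -x` exchanges the two factors; every statement about one factor thus
yields its mirror image. -/
theorem conv_swap (u v : ℂ → ℂ) (a b d : ℂ) : conv u v a b d = conv v u (-b) (-a) d := by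
  rw [conv, segInt_symm, conv, ← neg_eq_iff_eq_neg.2 (segInt_neg _ b a)]
  congr 2
  ext x
  rw [mul_comm]
  congr 2 <;> ring

theorem conv_congr {u v u' v' : ℂ → ℂ} {a b d : ℂ}
    (hu : ∀ x ∈ segment ℝ a b, u (x + d) = u' (x + d))
    (hv : ∀ x ∈ segment ℝ a b, v (d - x) = v' (d - x)) : conv u v a b d = conv u' v' a b d :=
  segInt_congr fun x hx => by rw [hu x hx, hv x hx]

theorem conv_differentiableOn {u v : ℂ → ℂ} {a b : ℂ} {U : Set ℂ} (hU : IsOpen U)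
    (hu : ∀ d ∈ U, ∀ x ∈ segment ℝ a b, AnalyticAt ℂ u (x + d))
    (hv : ∀ d ∈ U, ∀ x ∈ segment ℝ a b, AnalyticAt ℂ v (d - x)) :
    DifferentiableOn ℂ (conv u v a b) U := by
  refine (differentiableOn_const _).mul (differentiableOn_intervalIntegral_param hU ?_ ?_)
  · rintro ⟨d, t⟩ ⟨hd, ht⟩
    refine ContinuousAt.continuousWithinAt (ContinuousAt.mul ?_ ?_)
    · exact ContinuousAt.comp (f := fun x : ℂ × ℝ => a + x.2 * (b - a) + x.1)
        (hu d hd _ (mem_segment_param ht)).continuousAt (by fun_prop)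
    · exact ContinuousAt.comp (f := fun x : ℂ × ℝ => x.1 - (a + x.2 * (b - a)))
        (hv d hd _ (mem_segment_param ht)).continuousAt (by fun_prop)
  · intro t ht d hd
    refine DifferentiableAt.differentiableWithinAt (DifferentiableAt.mul ?_ ?_)
    · exact DifferentiableAt.comp (f := fun z : ℂ => a + t * (b - a) + z) d
        (hu d hd _ (mem_segment_param ht)).differentiableAt (by fun_prop)
    · exact DifferentiableAt.comp (f := fun z : ℂ => z - (a + t * (b - a))) d
        (hv d hd _ (mem_segment_param ht)).differentiableAt (by fun_prop)

theorem exists_analyticAt_thickening {u : ℂ → ℂ} {a b : ℂ}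
    (hu : ∀ x ∈ segment ℝ a b, AnalyticAt ℂ u x) :
    ∃ ε > 0, ∀ x ∈ segment ℝ a b, ∀ d : ℂ, ‖d‖ < ε → AnalyticAt ℂ u (x + d) := by
  have hK : IsCompact (segment ℝ a b) := by
    rw [segment_eq_image']
    exact isCompact_Icc.image (by fun_prop)
  obtain ⟨ε, hε, h⟩ := hK.exists_thickening_subset_open (isOpen_analyticAt ℂ u) hu
  exact ⟨ε, hε, fun x hx d hd => h (Metric.mem_thickening_iff.2 ⟨x, hx, by simpa using hd⟩)⟩

theorem conv_analyticAt_zero {u v : ℂ → ℂ} {a b : ℂ}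
    (hu : ∀ x ∈ segment ℝ a b, AnalyticAt ℂ u x)
    (hv : ∀ x ∈ segment ℝ a b, AnalyticAt ℂ v (-x)) : AnalyticAt ℂ (conv u v a b) 0 := by
  obtain ⟨ε₁, h₁, hu'⟩ := exists_analyticAt_thickening hu
  have hv0 : ∀ x ∈ segment ℝ (-a) (-b), AnalyticAt ℂ v x := fun x hx => by
    obtain ⟨t, ht, rfl⟩ := exists_of_mem_segment hx
    have := hv _ (mem_segment_param ht)
    convert this using 1
    ring
  obtain ⟨ε₂, h₂, hv'⟩ := exists_analyticAt_thickening hv0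
  have hD : DifferentiableOn ℂ (conv u v a b) (Metric.ball 0 (min ε₁ ε₂)) := by
    refine conv_differentiableOn Metric.isOpen_ball (fun d hd x hx => ?_) (fun d hd x hx => ?_)
    · exact hu' x hx d (lt_of_lt_of_le (by simpa using hd) (min_le_left _ _))
    · rw [sub_eq_neg_add]
      refine hv' (-x) ?_ d (lt_of_lt_of_le (by simpa using hd) (min_le_right _ _))
      obtain ⟨t, ht, rfl⟩ := exists_of_mem_segment hx
      convert mem_segment_param (a := -a) (b := -b) ht using 1
      ring
  exact hD.analyticAt (Metric.ball_mem_nhds 0 (lt_min h₁ h₂))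

theorem conv_add_of_convex {u v : ℂ → ℂ} {U : Set ℂ} (hU : Convex ℝ U) {a b c d : ℂ}
    (hu : ∀ x ∈ U, AnalyticAt ℂ u (x + d)) (hv : ∀ x ∈ U, AnalyticAt ℂ v (d - x))
    (ha : a ∈ U) (hb : b ∈ U) (hc : c ∈ U) :
    conv u v a b d + conv u v b c d = conv u v a c d := by
  refine segInt_add_of_convex hU (fun x hx => ?_) ha hb hc
  refine DifferentiableAt.differentiableWithinAt (DifferentiableAt.mul ?_ ?_)
  · exact DifferentiableAt.comp (f := fun z : ℂ => z + d) x (hu x hx).differentiableAt (by fun_prop)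
  · exact DifferentiableAt.comp (f := fun z : ℂ => d - z) x (hv x hx).differentiableAt (by fun_prop)

/-- A property of intervals that is additive and holds for all short intervals (with end points
outside a discrete set) holds for all intervals. -/
theorem interval_property_of_local {P : ℝ → ℝ → Prop} {Q : Set ℝ} {A B : ℝ} (hAB : A < B)
    (hA : A ∉ Q) (hB : B ∉ Q)
    (hloc : ∀ x ∈ Set.Icc A B, ∃ ε > 0, (∀ t, t ∈ Q → |t - x| < ε → t = x) ∧
      ∀ a b, x - ε < a → a < b → b < x + ε → a ∉ Q → b ∉ Q → P a b)
    (hadd : ∀ a b c, A ≤ a → a < b → b < c → c ≤ B → P a b → P b c → P a c) : P A B := by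
  choose! ε hε hQ hP using hloc
  obtain ⟨δ, hδ, hL⟩ := lebesgue_number_lemma_of_metric (s := Set.Icc A B) (ι := Set.Icc A B)
    (c := fun x => Metric.ball (x : ℝ) (ε x)) isCompact_Icc (fun _ => Metric.isOpen_ball)
    (fun x hx => Set.mem_iUnion.2 ⟨⟨x, hx⟩, Metric.mem_ball_self (hε x hx)⟩)
  have key : ∀ n : ℕ, ∀ a b, A ≤ a → a < b → b ≤ B → a ∉ Q → b ∉ Q → b - a < n * (δ / 3) + δ →
      P a b := by
    intro n
    induction n with
    | zero =>
      intro a b h1 h2 h3 ha hb hlt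
      obtain ⟨⟨x, hx⟩, hsub⟩ := hL a ⟨h1, h2.le.trans h3⟩
      have ha' := hsub (Metric.mem_ball_self hδ)
      have hb' : b ∈ Metric.ball a δ := by
        rw [Metric.mem_ball, Real.dist_eq, abs_of_pos (by linarith)]
        simpa using hlt
      have hb'' := hsub hb'
      simp only [Metric.mem_ball, Real.dist_eq, abs_lt] at ha' hb''
      exact hP x hx a b (by linarith) h2 (by linarith) ha hb
    | succ n ih =>
      intro a b h1 h2 h3 ha hb hlt
      by_cases hs : b - a < δ
      · exact ih a b h1 h2 h3 ha hb (by have : (0:ℝ) ≤ n * (δ/3) := by positivity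
                                        linarith)
      obtain ⟨⟨x, hx⟩, hsub⟩ := hL a ⟨h1, h2.le.trans h3⟩
      have hmem : ∀ s, 0 ≤ s → s < δ → |a + s - x| < ε x := fun s h0 hs => by
        have := hsub (show a + s ∈ Metric.ball a δ by
          rw [Metric.mem_ball, Real.dist_eq]; simpa [abs_of_nonneg h0] using hs)
        simpa [Real.dist_eq] using this
      -- One ball around `x` contains at most one point of `Q`, so of the two candidates `a + δ / 3`
      -- and `a + δ / 2` one is a legitimate cutting point.
      obtain ⟨s, hs1, hs2, hs3⟩ : ∃ s, δ / 3 ≤ s ∧ s < δ ∧ a + s ∉ Q := by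
        by_contra! hcon
        have e1 := hQ x hx _ (hcon (δ / 3) le_rfl (by linarith)) (hmem _ (by linarith) (by linarith))
        have e2 := hQ x hx _ (hcon (δ / 2) (by linarith) (by linarith))
          (hmem _ (by linarith) (by linarith))
        linarith
      refine hadd a (a + s) b h1 (by linarith) (by linarith) h3
        (ih a (a + s) h1 (by linarith) (by linarith) ha hs3 ?_)
        (ih (a + s) b (by linarith) (by linarith) h3 hs3 hb ?_)
      · have : (0:ℝ) ≤ n * (δ/3) := by positivity
        linarith
      · push_cast at hlt
        linarith
  obtain ⟨n, hn⟩ := exists_nat_gt ((B - A) / (δ / 3))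
  refine key n A B le_rfl hAB le_rfl hA hB ?_
  rw [div_lt_iff₀ (by positivity)] at hn
  linarith

/-! ### Finite-dimensional monodromy spaces and local germs -/

/-- The filter of points `w` with `w.re → -∞` and `|w.im| ≤ M`. -/
def sectorFilter (M : ℝ) : Filter ℂ := comap Complex.re atBot ⊓ 𝓟 {w : ℂ | |w.im| ≤ M}

theorem eventually_sectorFilter {M : ℝ} {p : ℂ → Prop} :
    (∀ᶠ w in sectorFilter M, p w) ↔ ∃ N : ℝ, ∀ w : ℂ, w.re < N → |w.im| ≤ M → p w := by
  rw [sectorFilter, eventually_inf_principal, eventually_comap]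
  constructor
  · intro h
    obtain ⟨N, hN⟩ := eventually_atBot.1 h
    exact ⟨N, fun w h1 h2 => hN w.re h1.le w rfl h2⟩
  · rintro ⟨N, hN⟩
    filter_upwards [Iio_mem_atBot N] with x hx w hw hM
    exact hN w (by rw [hw]; exact hx) hM

/-- `exp w * v w → 0` as `w.re → -∞` with `w.im` bounded. -/
def SectorSmall (v : ℂ → ℂ) : Prop :=
  ∀ M : ℝ, Tendsto (fun w => Complex.exp w * v w) (sectorFilter M) (𝓝 0)

theorem tendsto_exp_sectorFilter (M : ℝ) : Tendsto Complex.exp (sectorFilter M) (𝓝 0) :=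
  Complex.tendsto_exp_comap_re_atBot.mono_left inf_le_left

theorem tendsto_sectorFilter {T : ℂ → ℂ} {C M : ℝ}
    (h : ∀ᶠ w in sectorFilter M, ‖T w - w‖ ≤ C) :
    Tendsto T (sectorFilter M) (sectorFilter (M + C)) := by
  obtain ⟨N, hN⟩ := eventually_sectorFilter.1 h
  intro s hs
  obtain ⟨N', hN'⟩ := eventually_sectorFilter.1 (show ∀ᶠ w in sectorFilter (M + C), w ∈ s from hs)
  refine eventually_sectorFilter.2 ⟨min N (N' - C), fun w h1 h2 => hN' _ ?_ ?_⟩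
  · have := (Complex.abs_re_le_norm _).trans (hN w (lt_of_lt_of_le h1 (min_le_left _ _)) h2)
    have h3 := lt_of_lt_of_le h1 (min_le_right _ _)
    rw [Complex.sub_re, abs_le] at this
    linarith
  · have := (Complex.abs_im_le_norm _).trans (hN w (lt_of_lt_of_le h1 (min_le_left _ _)) h2)
    rw [Complex.sub_im, abs_le] at this
    rw [abs_le] at h2 ⊢
    constructor <;> linarith

theorem SectorSmall.add {v w : ℂ → ℂ} (hv : SectorSmall v) (hw : SectorSmall w) :
    SectorSmall (v + w) := fun M => by
  simpa [mul_add] using (hv M).add (hw M)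

theorem SectorSmall.const_mul {v : ℂ → ℂ} (hv : SectorSmall v) (a : ℂ) :
    SectorSmall (fun w => a * v w) := fun M => by
  simpa [mul_left_comm] using (hv M).const_mul a

/-- A displacement bounded by `C` widens the sector by `C` and changes the modulus of the
exponential weight by a factor at most `exp C`. -/
theorem SectorSmall.comp {v T : ℂ → ℂ} (hv : SectorSmall v) {c C : ℝ}
    (hT : ∀ w : ℂ, w.re < c → ‖T w - w‖ ≤ C) : SectorSmall (fun w => v (T w)) := fun M => by
  have hT' : ∀ᶠ w in sectorFilter M, ‖T w - w‖ ≤ C :=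
    eventually_sectorFilter.2 ⟨c, fun w hw _ => hT w hw⟩
  have h1 := (hv (M + C)).comp (tendsto_sectorFilter hT')
  rw [tendsto_zero_iff_norm_tendsto_zero] at h1 ⊢
  have h2 := h1.const_mul (Real.exp C)
  rw [mul_zero] at h2
  refine squeeze_zero' (Eventually.of_forall fun _ => norm_nonneg _) ?_ h2
  filter_upwards [hT'] with w hw
  simp only [Function.comp, norm_mul, Complex.norm_exp]
  rw [← mul_assoc, ← Real.exp_add]
  gcongr
  have := (abs_le.1 ((Complex.abs_re_le_norm _).trans hw)).1
  rw [Complex.sub_re] at this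
  linarith

/-- A finite-dimensional `K`-space of holomorphic functions on `{w | w.re < c}`, all integrable at
`-∞`, and stable under the monodromy operator (up to values outside the half plane). -/
structure LocalSpace (K : Subfield ℂ) (c : ℝ) (V : Submodule K (ℂ → ℂ)) : Prop where
  fg : V.FG
  diff : ∀ v ∈ V, DifferentiableOn ℂ v {w | w.re < c}
  small : ∀ v ∈ V, SectorSmall v
  stable : ∀ v ∈ V, ∃ v' ∈ V, ∀ w : ℂ, w.re < c → v (w + 2 * Real.pi * Complex.I) = v' w

theorem isOpen_re_lt (c : ℝ) : IsOpen {w : ℂ | w.re < c} :=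
  isOpen_lt Complex.continuous_re continuous_const

theorem LocalSpace.mono {K : Subfield ℂ} {c c' : ℝ} {V : Submodule K (ℂ → ℂ)}
    (h : LocalSpace K c V) (hc : c' ≤ c) : LocalSpace K c' V where
  fg := h.fg
  diff v hv := (h.diff v hv).mono fun _ hw => lt_of_lt_of_le hw hc
  small := h.small
  stable v hv := by
    obtain ⟨v', h1, h2⟩ := h.stable v hv
    exact ⟨v', h1, fun w hw => h2 w (lt_of_lt_of_le hw hc)⟩

theorem LocalSpace.sup {K : Subfield ℂ} {c : ℝ} {V W : Submodule K (ℂ → ℂ)}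
    (hV : LocalSpace K c V) (hW : LocalSpace K c W) : LocalSpace K c (V ⊔ W) where
  fg := hV.fg.sup hW.fg
  diff v hv := by
    obtain ⟨x, hx, y, hy, rfl⟩ := Submodule.mem_sup.1 hv
    exact (hV.diff x hx).add (hW.diff y hy)
  small v hv := by
    obtain ⟨x, hx, y, hy, rfl⟩ := Submodule.mem_sup.1 hv
    exact (hV.small x hx).add (hW.small y hy)
  stable v hv := by
    obtain ⟨x, hx, y, hy, rfl⟩ := Submodule.mem_sup.1 hv
    obtain ⟨x', hx', h1⟩ := hV.stable x hx
    obtain ⟨y', hy', h2⟩ := hW.stable y hy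
    exact ⟨x' + y', Submodule.add_mem_sup hx' hy', fun w hw => by
      simp [h1 w hw, h2 w hw]⟩

theorem LocalSpace.of_span {K : Subfield ℂ} {c : ℝ} {s : Set (ℂ → ℂ)}
    (hfg : (Submodule.span K s).FG) (hdiff : ∀ v ∈ s, DifferentiableOn ℂ v {w | w.re < c})
    (hsmall : ∀ v ∈ s, SectorSmall v)
    (hstab : ∀ v ∈ s, ∃ v' ∈ Submodule.span K s, ∀ w : ℂ, w.re < c →
      v (w + 2 * Real.pi * Complex.I) = v' w) : LocalSpace K c (Submodule.span K s) where
  fg := hfg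
  diff v hv := by
    induction hv using Submodule.span_induction with
    | mem x hx => exact hdiff x hx
    | zero => exact differentiableOn_const (0 : ℂ)
    | add x y _ _ hx hy => exact hx.add hy
    | smul a x _ hx => exact hx.const_smul (a : ℂ)
  small v hv := by
    induction hv using Submodule.span_induction with
    | mem x hx => exact hsmall x hx
    | zero => intro M; simpa using tendsto_const_nhds
    | add x y _ _ hx hy => exact hx.add hy
    | smul a x _ hx => exact hx.const_mul (a : ℂ)
  stable v hv := by
    induction hv using Submodule.span_induction with
    | mem x hx => exact hstab x hx
    | zero => exact ⟨0, Submodule.zero_mem _, fun w _ => rfl⟩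
    | add x y _ _ hx hy =>
      obtain ⟨x', hx', h1⟩ := hx
      obtain ⟨y', hy', h2⟩ := hy
      exact ⟨x' + y', Submodule.add_mem _ hx' hy', fun w hw => by simp [h1 w hw, h2 w hw]⟩
    | smul a x _ hx =>
      obtain ⟨x', hx', h1⟩ := hx
      exact ⟨a • x', Submodule.smul_mem _ a hx', fun w hw => by simp [h1 w hw]⟩

theorem LocalSpace.map_const_mul {K : Subfield ℂ} {c : ℝ} {V : Submodule K (ℂ → ℂ)}
    (hV : LocalSpace K c V) (a : ℂ) :
    LocalSpace K c (V.map (LinearMap.mulLeft K (fun _ : ℂ => a))) where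
  fg := hV.fg.map _
  diff v hv := by
    obtain ⟨x, hx, rfl⟩ := Submodule.mem_map.1 hv
    exact (hV.diff x hx).const_mul a
  small v hv := by
    obtain ⟨x, hx, rfl⟩ := Submodule.mem_map.1 hv
    exact (hV.small x hx).const_mul a
  stable v hv := by
    obtain ⟨x, hx, rfl⟩ := Submodule.mem_map.1 hv
    obtain ⟨x', hx', h⟩ := hV.stable x hx
    exact ⟨_, Submodule.mem_map_of_mem hx', fun w hw => by simp [h w hw]⟩

/-- Precomposition with `w ↦ w + κ (exp w)`. -/
theorem LocalSpace.map_comp {K : Subfield ℂ} {c c' C : ℝ} {V : Submodule K (ℂ → ℂ)}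
    (hV : LocalSpace K c V) {κ : ℂ → ℂ}
    (hκ : ∀ w : ℂ, w.re < c' → DifferentiableAt ℂ κ (Complex.exp w))
    (hC : ∀ w : ℂ, w.re < c' → ‖κ (Complex.exp w)‖ ≤ C)
    (hc : ∀ w : ℂ, w.re < c' → (w + κ (Complex.exp w)).re < c) :
    LocalSpace K c' (V.map (LinearMap.funLeft K ℂ fun w => w + κ (Complex.exp w))) where
  fg := hV.fg.map _
  diff v hv := by
    obtain ⟨x, hx, rfl⟩ := Submodule.mem_map.1 hv
    intro w hw
    have h1 : DifferentiableAt ℂ x (w + κ (Complex.exp w)) :=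
      (hV.diff x hx).differentiableAt ((isOpen_re_lt c).mem_nhds (hc w hw))
    have h2 : DifferentiableAt ℂ (fun w => w + κ (Complex.exp w)) w :=
      differentiableAt_id.add ((hκ w hw).comp w Complex.differentiableAt_exp)
    exact (h1.comp w h2).differentiableWithinAt
  small v hv := by
    obtain ⟨x, hx, rfl⟩ := Submodule.mem_map.1 hv
    exact (hV.small x hx).comp (c := c') (C := C) fun w hw => by simpa using hC w hw
  stable v hv := by
    obtain ⟨x, hx, rfl⟩ := Submodule.mem_map.1 hv
    obtain ⟨x', hx', h⟩ := hV.stable x hx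
    refine ⟨_, Submodule.mem_map_of_mem hx', fun w hw => ?_⟩
    simp only [LinearMap.funLeft_apply]
    rw [← h _ (hc w hw), show Complex.exp (w + 2 * Real.pi * Complex.I) = Complex.exp w from
      Complex.exp_periodic w]
    ring_nf

/-! ### One-sided germs and changes of local coordinate -/

/-- `A`, restricted to the side `σ * im x > 0` of `0`, continues along all paths in a punctured
disc around `0`, with integrable singularity and `K`-recurrent monodromy. -/
def LocGerm (K : Subfield ℂ) (σ : ℝ) (A : ℂ → ℂ) : Prop :=
  ∃ (c : ℝ) (V : Submodule K (ℂ → ℂ)) (φ : ℂ → ℂ), LocalSpace K c V ∧ φ ∈ V ∧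
    ∀ w : ℂ, w.re < c → 0 < σ * w.im → σ * w.im < Real.pi → φ w = A (Complex.exp w)

/-- `A`, restricted to the side `σ * im x > 0` of `0`, extends analytically to `0`. -/
def RegGerm (σ : ℝ) (A : ℂ → ℂ) : Prop :=
  ∃ g : ℂ → ℂ, AnalyticAt ℂ g 0 ∧ ∀ᶠ x in 𝓝 (0 : ℂ), 0 < σ * x.im → A x = g x

theorem RegGerm.add {σ : ℝ} {A B : ℂ → ℂ} (hA : RegGerm σ A) (hB : RegGerm σ B) :
    RegGerm σ (fun x => A x + B x) := by
  obtain ⟨g, hg, h1⟩ := hA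
  obtain ⟨k, hk, h2⟩ := hB
  exact ⟨_, hg.add hk, by
    filter_upwards [h1, h2] with x h1 h2 hx
    simp [h1 hx, h2 hx]⟩

theorem RegGerm.congr {σ : ℝ} {A B : ℂ → ℂ} (hA : RegGerm σ A)
    (h : ∀ᶠ x in 𝓝 (0 : ℂ), 0 < σ * x.im → B x = A x) : RegGerm σ B := by
  obtain ⟨g, hg, h1⟩ := hA
  exact ⟨g, hg, by filter_upwards [h1, h] with x h1 h hx; rw [h hx, h1 hx]⟩

theorem RegGerm.const_mul {σ : ℝ} {A : ℂ → ℂ} (hA : RegGerm σ A) (a : ℂ) :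
    RegGerm σ (fun x => a * A x) := by
  obtain ⟨g, hg, h1⟩ := hA
  exact ⟨fun x => a * g x, analyticAt_const.mul hg, by
    filter_upwards [h1] with x h1 hx
    simp [h1 hx]⟩

theorem exists_re_lt_of_eventually {p : ℂ → Prop} (h : ∀ᶠ x in 𝓝 (0 : ℂ), p x) :
    ∃ c : ℝ, ∀ w : ℂ, w.re < c → p (Complex.exp w) := by
  obtain ⟨r, hr, h⟩ := Metric.eventually_nhds_iff.1 h
  refine ⟨Real.log r, fun w hw => h ?_⟩
  rw [dist_zero_right, Complex.norm_exp]
  exact (Real.lt_log_iff_exp_lt hr).1 hw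

theorem side_exp {σ : ℝ} (hσ : σ = 1 ∨ σ = -1) {w : ℂ} (h1 : 0 < σ * w.im)
    (h2 : σ * w.im < Real.pi) : 0 < σ * (Complex.exp w).im := by
  rw [Complex.exp_im]
  rcases hσ with rfl | rfl
  · simp only [one_mul] at *
    exact mul_pos (Real.exp_pos _) (Real.sin_pos_of_pos_of_lt_pi h1 h2)
  · have := Real.sin_pos_of_pos_of_lt_pi h1 h2
    rw [neg_one_mul, Real.sin_neg] at this
    have h3 := mul_pos (Real.exp_pos w.re) this
    linarith

theorem side_log {σ : ℝ} (hσ : σ = 1 ∨ σ = -1) {x : ℂ} (h : 0 < σ * x.im) :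
    0 < σ * (Complex.log x).im ∧ σ * (Complex.log x).im < Real.pi := by
  rw [Complex.log_im]
  rcases hσ with rfl | rfl
  · simp only [one_mul] at *
    have h0 : 0 ≤ x.arg := Complex.arg_nonneg_iff.2 h.le
    refine ⟨lt_of_le_of_ne h0 fun h1 => ?_, lt_of_le_of_ne (Complex.arg_le_pi x) fun h1 => ?_⟩
    · exact h.ne' (Complex.arg_eq_zero_iff.1 h1.symm).2
    · exact h.ne' (Complex.arg_eq_pi_iff.1 h1).2
  · have h0 : x.arg < 0 := Complex.arg_neg_iff.2 (by linarith)
    have := Complex.neg_pi_lt_arg x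
    constructor <;> linarith

theorem ne_zero_of_side {σ : ℝ} {x : ℂ} (h : 0 < σ * x.im) : x ≠ 0 := by
  rintro rfl; simp at h

theorem LocGerm.congr {K : Subfield ℂ} {σ : ℝ} (hσ : σ = 1 ∨ σ = -1) {A B : ℂ → ℂ}
    (hA : LocGerm K σ A) (h : ∀ᶠ x in 𝓝 (0 : ℂ), 0 < σ * x.im → B x = A x) : LocGerm K σ B := by
  obtain ⟨c, V, φ, hV, hφ, h1⟩ := hA
  obtain ⟨c', hc'⟩ := exists_re_lt_of_eventually h
  refine ⟨min c c', V, φ, hV.mono (min_le_left _ _), hφ, fun w hw h2 h3 => ?_⟩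
  rw [h1 w (lt_of_lt_of_le hw (min_le_left _ _)) h2 h3,
    hc' w (lt_of_lt_of_le hw (min_le_right _ _)) (side_exp hσ h2 h3)]

theorem LocGerm.add {K : Subfield ℂ} {σ : ℝ} {A B : ℂ → ℂ}
    (hA : LocGerm K σ A) (hB : LocGerm K σ B) : LocGerm K σ (fun x => A x + B x) := by
  obtain ⟨c, V, φ, hV, hφ, h1⟩ := hA
  obtain ⟨c', V', φ', hV', hφ', h1'⟩ := hB
  exact ⟨min c c', V ⊔ V', φ + φ', (hV.mono (min_le_left _ _)).sup (hV'.mono (min_le_right _ _)),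
    Submodule.add_mem_sup hφ hφ', fun w hw h2 h3 => by
      simp [h1 w (lt_of_lt_of_le hw (min_le_left _ _)) h2 h3,
        h1' w (lt_of_lt_of_le hw (min_le_right _ _)) h2 h3]⟩

theorem LocGerm.const_mul {K : Subfield ℂ} {σ : ℝ} {A : ℂ → ℂ} (hA : LocGerm K σ A) (a : ℂ) :
    LocGerm K σ (fun x => a * A x) := by
  obtain ⟨c, V, φ, hV, hφ, h1⟩ := hA
  exact ⟨c, _, _, hV.map_const_mul a, Submodule.mem_map_of_mem hφ, fun w hw h2 h3 => by
    simp [h1 w hw h2 h3]⟩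

/-- In the logarithmic coordinate a regular germ is `2πi`-periodic, so it spans a monodromy-stable
space by itself. -/
theorem RegGerm.locGerm {σ : ℝ} (hσ : σ = 1 ∨ σ = -1) {A : ℂ → ℂ} (hA : RegGerm σ A)
    (K : Subfield ℂ) : LocGerm K σ A := by
  obtain ⟨g, hg, h1⟩ := hA
  obtain ⟨c, hc⟩ := exists_re_lt_of_eventually (h1.and hg.eventually_analyticAt)
  refine ⟨c, _, fun w => g (Complex.exp w), LocalSpace.of_span (K := K)
    (s := {fun w => g (Complex.exp w)}) (Submodule.fg_span (Set.finite_singleton _)) ?_ ?_ ?_,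
    Submodule.subset_span rfl, fun w hw h2 h3 => ((hc w hw).1 (side_exp hσ h2 h3)).symm⟩
  · rintro v rfl w hw
    exact ((hc w hw).2.differentiableAt.comp w
      Complex.differentiableAt_exp).differentiableWithinAt
  · rintro v rfl M
    have h2 : Tendsto (fun w => g (Complex.exp w)) (sectorFilter M) (𝓝 (g 0)) :=
      hg.continuousAt.tendsto.comp (tendsto_exp_sectorFilter M)
    simpa using (tendsto_exp_sectorFilter M).mul h2
  · rintro v rfl
    refine ⟨_, Submodule.subset_span rfl, fun w _ => ?_⟩
    simp only
    rw [show Complex.exp (w + 2 * Real.pi * Complex.I) = Complex.exp w from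
      Complex.exp_periodic w]

/-- A change of the local coordinate of the form `x ↦ x * exp (κ x)`. -/
theorem LocGerm.comp {K : Subfield ℂ} {σ : ℝ} (hσ : σ = 1 ∨ σ = -1) {A B κ : ℂ → ℂ}
    (hA : LocGerm K σ A) (hκ : AnalyticAt ℂ κ 0) (hκ0 : (κ 0).im = 0)
    (h : ∀ᶠ x in 𝓝 (0 : ℂ), 0 < σ * x.im →
      0 < σ * (x * Complex.exp (κ x)).im ∧ B x = A (x * Complex.exp (κ x))) : LocGerm K σ B := by
  obtain ⟨c, V, φ, hV, hφ, h1⟩ := hA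
  have hsm : ∀ᶠ x in 𝓝 (0 : ℂ), ‖κ x - κ 0‖ < 1 := by
    have := hκ.continuousAt.tendsto.sub_const (κ 0)
    rw [sub_self] at this
    simpa using this.norm.eventually (gt_mem_nhds (by simp : ‖(0:ℂ)‖ < 1))
  obtain ⟨c', hc'⟩ := exists_re_lt_of_eventually (h.and (hκ.eventually_analyticAt.and hsm))
  have hre : ∀ w : ℂ, w.re < min c' (c - ‖κ 0‖ - 1) → (w + κ (Complex.exp w)).re < c := by
    intro w hw
    have h2 := (hc' w (lt_of_lt_of_le hw (min_le_left _ _))).2.2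
    have h3 := lt_of_lt_of_le hw (min_le_right _ _)
    have h4 := (Complex.re_le_norm _).trans_lt h2
    have h5 := Complex.re_le_norm (κ 0)
    simp only [Complex.sub_re, Complex.add_re] at *
    linarith
  refine ⟨min c' (c - ‖κ 0‖ - 1), _, _, hV.map_comp (C := ‖κ 0‖ + 1)
    (fun w hw => (hc' w (lt_of_lt_of_le hw (min_le_left _ _))).2.1.differentiableAt)
    (fun w hw => ?_) hre, Submodule.mem_map_of_mem hφ, fun w hw h2 h3 => ?_⟩
  · have h2 := (hc' w (lt_of_lt_of_le hw (min_le_left _ _))).2.2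
    have := norm_add_le (κ (Complex.exp w) - κ 0) (κ 0)
    rw [sub_add_cancel] at this
    linarith
  · obtain ⟨h4, h5, h6⟩ := hc' w (lt_of_lt_of_le hw (min_le_left _ _))
    obtain ⟨h7, h8⟩ := h4 (side_exp hσ h2 h3)
    rw [← Complex.exp_add] at h7 h8
    rw [h8, LinearMap.funLeft_apply]
    have h9 : |(κ (Complex.exp w)).im| < 1 := by
      have := (Complex.abs_im_le_norm _).trans_lt h6
      rwa [Complex.sub_im, hκ0, sub_zero] at this
    rw [abs_lt] at h9
    have hpi := Real.pi_gt_three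
    -- Since `κ 0` is real, the new angle lies in `(-1, π + 1)`. There a positive sine forces it
    -- into `(0, π)`, so the lifted point stays on the sheet where `φ` is anchored to `A`.
    have key : 0 < σ * (w + κ (Complex.exp w)).im ∧ σ * (w + κ (Complex.exp w)).im < Real.pi := by
      rw [Complex.exp_im] at h7
      set y := (w + κ (Complex.exp w)).im with hy
      rw [Complex.add_im] at hy
      have h10 : 0 < σ * Real.sin y := by
        have : 0 < Real.exp (w + κ (Complex.exp w)).re * (σ * Real.sin y) := by linarith
        exact (mul_pos_iff_of_pos_left (Real.exp_pos _)).1 this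
      have h11 : 0 < Real.sin (σ * y) := by
        rcases hσ with rfl | rfl
        · simpa using h10
        · simpa using h10
      have hb : -1 < σ * y ∧ σ * y < Real.pi + 1 := by
        rcases hσ with rfl | rfl <;> constructor <;> linarith
      constructor
      · by_contra hcon
        exact absurd h11 (not_lt.2 (Real.sin_nonpos_of_nonpos_of_neg_pi_le (not_lt.1 hcon)
          (by linarith)))
      · by_contra hcon
        have := Real.sin_nonneg_of_nonneg_of_le_pi (x := σ * y - Real.pi)
          (by linarith) (by linarith)
        rw [Real.sin_sub_pi] at this
        linarith
    exact h1 _ (hre w hw) key.1 key.2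

/-! ### Recurrences versus finite-dimensional monodromy spaces -/

theorem monodromy_iterate (Φ : ℂ → ℂ) (k : ℕ) (w : ℂ) :
    monodromy^[k] Φ w = Φ (w + k * (2 * Real.pi * Complex.I)) := by
  induction k generalizing w with
  | zero => simp
  | succ k ih =>
    rw [Function.iterate_succ_apply', monodromy, ih]
    congr 1
    push_cast
    ring

theorem re_add_mul_two_pi_I (w : ℂ) (k : ℕ) : (w + k * (2 * Real.pi * Complex.I)).re = w.re := by
  simp

/-- The first `d` iterated monodromies generate the space. Only the last of them leaves the list
under one more turn, and the recurrence at `m = 0` brings it back. -/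
theorem exists_localSpace_of_isRecurrentOver {K : Subfield ℂ} {c : ℝ} {Φ : ℂ → ℂ}
    (hd : DifferentiableOn ℂ Φ {w | w.re < c}) (hs : SectorSmall Φ)
    (hr : IsRecurrentOver K c Φ) : ∃ V, LocalSpace K c V ∧ Φ ∈ V := by
  obtain ⟨d, hd1, a, ha, h⟩ := hr
  have hmem : ∀ k < d, monodromy^[k] Φ ∈
      Submodule.span K ((fun k => monodromy^[k] Φ) '' Set.Iio d) := fun k hk =>
    Submodule.subset_span ⟨k, hk, rfl⟩
  refine ⟨_, LocalSpace.of_span (K := K) (s := (fun k => monodromy^[k] Φ) '' Set.Iio d)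
    (Submodule.fg_span ((Set.finite_Iio d).image _)) ?_ ?_ ?_, hmem 0 hd1⟩
  · rintro v ⟨k, hk, rfl⟩ w hw
    simp only [funext (monodromy_iterate Φ k)]
    refine DifferentiableAt.differentiableWithinAt (DifferentiableAt.comp
      (f := fun w => w + k * (2 * Real.pi * Complex.I)) w ?_ (by fun_prop))
    exact hd.differentiableAt ((isOpen_re_lt c).mem_nhds (by
      rw [Set.mem_ofPred_eq, re_add_mul_two_pi_I]; exact hw))
  · rintro v ⟨k, hk, rfl⟩
    simp only [funext (monodromy_iterate Φ k)]
    exact hs.comp (c := c) (C := ‖(k : ℂ) * (2 * Real.pi * Complex.I)‖) fun w hw => by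
      rw [add_sub_cancel_left]
  · rintro v ⟨k, hk, rfl⟩
    have hsucc : ∀ w, (monodromy^[k] Φ) (w + 2 * Real.pi * Complex.I) = monodromy^[k + 1] Φ w :=
      fun w => by rw [Function.iterate_succ_apply']; rfl
    by_cases hk' : k + 1 < d
    · exact ⟨_, hmem _ hk', fun w _ => hsucc w⟩
    · refine ⟨∑ j ∈ (Finset.range d).attach, (⟨a j, ha j (Finset.mem_range.1 j.2)⟩ : K) •
        monodromy^[j.1] Φ, Submodule.sum_mem _ fun j _ => Submodule.smul_mem _ _
          (hmem _ (Finset.mem_range.1 j.2)), fun w hw => ?_⟩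
      have hkd : k + 1 = 0 + d := by have := Set.mem_Iio.1 hk; omega
      refine (hsucc w).trans ?_
      rw [hkd, h 0 w hw, Finset.sum_apply,
        ← Finset.sum_attach (Finset.range d) (fun j => a j * monodromy^[0 + j] Φ w)]
      refine Finset.sum_congr rfl fun j _ => ?_
      rw [zero_add]
      rfl

/-- The monodromy operator as a linear map. -/
noncomputable def monodromyLinear (K : Subfield ℂ) : (ℂ → ℂ) →ₗ[K] (ℂ → ℂ) :=
  LinearMap.funLeft K ℂ fun w => w + 2 * Real.pi * Complex.I

/-- Cayley–Hamilton for the monodromy acting on the space; the coefficients of the characteristic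
polynomial lie in `K`. -/
theorem LocalSpace.isRecurrentOver {K : Subfield ℂ} {c : ℝ} {V : Submodule K (ℂ → ℂ)}
    (hV : LocalSpace K c V) {φ : ℂ → ℂ} (hφ : φ ∈ V) : IsRecurrentOver K c φ := by
  classical
  -- Stability holds only on the half plane. Truncating there, which commutes with the shift by
  -- `2πi`, turns it into a genuine invariant subspace.
  let T : (ℂ → ℂ) →ₗ[K] (ℂ → ℂ) :=
    LinearMap.mulLeft K (Set.indicator {w : ℂ | w.re < c} (fun _ => (1 : ℂ)))
  have hT : ∀ v w, T v w = if w.re < c then v w else 0 := fun v w => by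
    simp [T, Set.indicator_apply]
  have hre : ∀ w : ℂ, (w + 2 * Real.pi * Complex.I).re = w.re := fun w => by simp
  let W := V.map T
  have hW : ∀ x ∈ W, monodromyLinear K x ∈ W := by
    rintro _ ⟨v, hv, rfl⟩
    obtain ⟨v', hv', h⟩ := hV.stable v hv
    refine ⟨v', hv', funext fun w => ?_⟩
    rw [hT, monodromyLinear, LinearMap.funLeft_apply, hT, hre]
    split_ifs with hw
    · exact (h w hw).symm
    · rfl
  have : Module.Finite K W := Module.Finite.iff_fg.2 (hV.fg.map T)
  let L : W →ₗ[K] W := (monodromyLinear K).restrict hW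
  -- The factor `X` guarantees degree at least `1`, even if the truncated space is zero.
  let q : Polynomial K := Polynomial.X * L.charpoly
  have hqm : q.Monic := Polynomial.monic_X.mul L.charpoly_monic
  have hq0 : Polynomial.aeval L q = 0 := by
    rw [map_mul, LinearMap.aeval_self_charpoly, mul_zero]
  have hqd : 1 ≤ q.natDegree := by
    rw [Polynomial.natDegree_mul Polynomial.X_ne_zero L.charpoly_monic.ne_zero,
      Polynomial.natDegree_X]
    omega
  have hLk : ∀ (k : ℕ) (w : ℂ), w.re < c →
      ((L ^ k) ⟨T φ, Submodule.mem_map_of_mem hφ⟩ : W).1 w = monodromy^[k] φ w := by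
    intro k
    induction k with
    | zero => intro w hw; simp [hT, hw]
    | succ k ih =>
      intro w hw
      rw [pow_succ', Module.End.mul_apply, Function.iterate_succ_apply', monodromy]
      rw [← ih (w + 2 * Real.pi * Complex.I) (by rwa [hre])]
      rfl
  refine ⟨q.natDegree, hqd, fun k => -(q.coeff k : ℂ), fun k _ => K.neg_mem (q.coeff k).2,
    fun m w hw => ?_⟩
  have h1 : (Polynomial.aeval L q * L ^ m) ⟨T φ, Submodule.mem_map_of_mem hφ⟩ = 0 := by
    rw [hq0, zero_mul, LinearMap.zero_apply]
  rw [Polynomial.aeval_eq_sum_range, Finset.sum_mul, Finset.sum_range_succ,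
    hqm.coeff_natDegree, one_smul, ← pow_add] at h1
  have h2 := congrFun (congrArg Subtype.val h1) w
  simp only [LinearMap.add_apply, LinearMap.sum_apply, Submodule.coe_add, Submodule.coe_sum,
    Pi.add_apply, Finset.sum_apply, ZeroMemClass.coe_zero, Pi.zero_apply, smul_mul_assoc,
    ← pow_add, LinearMap.smul_apply, Submodule.coe_smul, Pi.smul_apply, hLk _ w hw] at h2
  rw [add_comm m, eq_neg_of_add_eq_zero_right h2, ← Finset.sum_neg_distrib]
  refine Finset.sum_congr rfl fun k _ => ?_
  rw [add_comm m, neg_mul]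
  rfl

/-! ### Convolutions of local germs: one regular factor -/

theorem im_eq_zero_of_mem_segment_ofReal {a b : ℝ} {x : ℂ} (h : x ∈ segment ℝ (a : ℂ) b) :
    x.im = 0 := by
  obtain ⟨t, _, rfl⟩ := exists_of_mem_segment h
  simp

theorem norm_lt_of_mem_segment {a b x : ℂ} {ε : ℝ} (ha : ‖a‖ < ε) (hb : ‖b‖ < ε)
    (h : x ∈ segment ℝ a b) : ‖x‖ < ε := by
  have := (convex_ball (0 : ℂ) ε).segment_subset (by simpa using ha) (by simpa using hb) h
  simpa using this

theorem RegGerm.conv_regGerm {σ : ℝ} {A B : ℂ → ℂ} (hA : RegGerm σ A) (hB : RegGerm σ B) :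
    ∃ ε > 0, ∀ a b : ℝ, |a| < ε → |b| < ε → RegGerm σ (conv A B a b) := by
  obtain ⟨g, hg, h1⟩ := hA
  obtain ⟨k, hk, h2⟩ := hB
  obtain ⟨ε, hε, h⟩ := Metric.eventually_nhds_iff.1
    ((h1.and h2).and (hg.eventually_analyticAt.and hk.eventually_analyticAt))
  simp only [dist_zero_right] at h
  refine ⟨ε / 2, by positivity, fun a b ha hb => ⟨conv g k a b, ?_, ?_⟩⟩
  · have hx : ∀ x ∈ segment ℝ (a : ℂ) b, ‖x‖ < ε := fun x hx =>
      (norm_lt_of_mem_segment (by simpa using ha) (by simpa using hb) hx).trans (by linarith)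
    exact conv_analyticAt_zero (fun x hx' => (h (hx x hx')).2.1)
      (fun x hx' => (h (by rw [norm_neg]; exact hx x hx')).2.2)
  · refine Metric.eventually_nhds_iff.2 ⟨ε / 2, by positivity, fun d hd hs => ?_⟩
    rw [dist_zero_right] at hd
    have hx : ∀ x ∈ segment ℝ (a : ℂ) b, ‖x‖ < ε / 2 := fun x hx =>
      norm_lt_of_mem_segment (by simpa using ha) (by simpa using hb) hx
    refine conv_congr (fun x hx' => (h ?_).1.1 ?_) (fun x hx' => (h ?_).1.2 ?_)
    · linarith [norm_add_le x d, hx x hx']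
    · simpa [im_eq_zero_of_mem_segment_ofReal hx'] using hs
    · linarith [norm_sub_le d x, hx x hx']
    · simpa [im_eq_zero_of_mem_segment_ofReal hx'] using hs

/-- Single valued extension of a local germ to the disc slit along the opposite imaginary half
axis. -/
theorem exists_slit_extension {σ c : ℝ} (hσ : σ = 1 ∨ σ = -1) {A φ : ℂ → ℂ}
    (hφ : DifferentiableOn ℂ φ {w | w.re < c})
    (h : ∀ w : ℂ, w.re < c → 0 < σ * w.im → σ * w.im < Real.pi → φ w = A (Complex.exp w)) :
    ∃ E : ℂ → ℂ, (∀ x : ℂ, ‖x‖ < Real.exp c → 0 < σ * x.im ∨ x.re ≠ 0 → AnalyticAt ℂ E x) ∧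
      ∀ x : ℂ, ‖x‖ < Real.exp c → 0 < σ * x.im → A x = E x := by
  let T : ℂ → ℂ := fun x => Complex.log (-(σ * Complex.I) * x) + σ * Complex.I * (Real.pi / 2)
  have hσ2 : (σ : ℂ) * σ = 1 := by
    rcases hσ with rfl | rfl <;> simp
  have hnσ : ‖(σ : ℂ)‖ = 1 := by rcases hσ with rfl | rfl <;> simp
  have hre : ∀ x : ℂ, x ≠ 0 → ‖x‖ < Real.exp c → (T x).re < c := fun x h0 hx => by
    have : (T x).re = Real.log ‖x‖ := by
      have : |σ| = 1 := by rcases hσ with rfl | rfl <;> simp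
      simp [T, Complex.log_re, this]
    rw [this]
    exact (Real.log_lt_iff_lt_exp (norm_pos_iff.2 h0)).2 hx
  have hexp : ∀ x : ℂ, x ≠ 0 → Complex.exp (T x) = x := fun x h0 => by
    have h1 : Complex.exp (σ * Complex.I * (Real.pi / 2)) = σ * Complex.I := by
      rcases hσ with rfl | rfl
      · rw [Complex.ofReal_one, one_mul, mul_comm Complex.I, Complex.exp_mul_I]
        simp
      · rw [show (((-1 : ℝ) : ℂ) * Complex.I * (Real.pi / 2)) = -(Real.pi / 2) * Complex.I by
          push_cast; ring, Complex.exp_mul_I, Complex.cos_neg, Complex.sin_neg]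
        simp
    have h2 : -((σ : ℂ) * Complex.I) * x ≠ 0 := by
      refine mul_ne_zero (neg_ne_zero.2 (mul_ne_zero ?_ Complex.I_ne_zero)) h0
      rw [← norm_ne_zero_iff, hnσ]; exact one_ne_zero
    rw [Complex.exp_add, Complex.exp_log h2, h1]
    linear_combination (-x * Complex.I ^ 2) * hσ2 - x * Complex.I_sq
  refine ⟨fun x => φ (T x), fun x hx hs => ?_, fun x hx hs => ?_⟩
  · have h0 : x ≠ 0 := by
      rintro rfl; simp at hs
    have hslit : -((σ : ℂ) * Complex.I) * x ∈ Complex.slitPlane := by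
      rw [Complex.mem_slitPlane_iff]
      rcases hs with hs | hs
      · left; simpa using hs
      · right
        have : σ ≠ 0 := by rcases hσ with rfl | rfl <;> norm_num
        simpa [this] using hs
    have h1 : AnalyticAt ℂ φ (T x) :=
      hφ.analyticAt ((isOpen_re_lt c).mem_nhds (hre x h0 hx))
    refine AnalyticAt.fun_comp h1 (AnalyticAt.add ?_ analyticAt_const)
    exact (analyticAt_const.mul analyticAt_id).clog hslit
  · have h0 := ne_zero_of_side hs
    have harg : |(-((σ : ℂ) * Complex.I) * x).arg| < Real.pi / 2 :=
      Complex.abs_arg_lt_pi_div_two_iff.2 (Or.inl (by simpa using hs))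
    have him : (T x).im = (-((σ : ℂ) * Complex.I) * x).arg + σ * (Real.pi / 2) := by
      simp [T, Complex.log_im]
    rw [abs_lt] at harg
    show A x = φ (T x)
    rw [h (T x) (hre x h0 hx), hexp x h0]
    · rw [him]; rcases hσ with rfl | rfl <;> linarith
    · rw [him]; rcases hσ with rfl | rfl <;> linarith

/-- With only one singular factor there is no pinch: the segment from `a` to `b` is replaced by the
broken line through a point `q` on the side `σ`. That line avoids the singularity of the first
factor, while the second factor is analytic around it, so the integral is analytic at `d = 0`. -/
theorem LocGerm.conv_regGerm {K : Subfield ℂ} {σ : ℝ} (hσ : σ = 1 ∨ σ = -1) {A B : ℂ → ℂ}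
    (hA : LocGerm K σ A) (hB : RegGerm σ B) :
    ∃ ε > 0, ∀ a b : ℝ, a ≠ 0 → b ≠ 0 → |a| < ε → |b| < ε → RegGerm σ (conv A B a b) := by
  obtain ⟨c, V, φ, hV, hφ, h1⟩ := hA
  obtain ⟨E, hE, hAE⟩ := exists_slit_extension hσ (hV.diff φ hφ) h1
  obtain ⟨k, hk, h2⟩ := hB
  obtain ⟨ε', hε', h⟩ := Metric.eventually_nhds_iff.1 (h2.and hk.eventually_analyticAt)
  simp only [dist_zero_right] at h
  obtain ⟨ε, hε, hεc, hεε⟩ : ∃ ε > 0, 2 * ε ≤ Real.exp c ∧ 2 * ε ≤ ε' :=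
    ⟨min (Real.exp c) ε' / 2, by positivity, by linarith [min_le_left (Real.exp c) ε'],
      by linarith [min_le_right (Real.exp c) ε']⟩
  have hσ2 : σ * σ = 1 := by rcases hσ with rfl | rfl <;> norm_num
  refine ⟨ε, hε, fun a b ha0 hb0 ha hb => ?_⟩
  let q : ℂ := ((σ * (ε / 2) : ℝ) : ℂ) * Complex.I
  have hqre : q.re = 0 := by simp [q]
  have hqim : σ * q.im = ε / 2 := by simp [q, ← mul_assoc, hσ2]
  have hqn : ‖q‖ < ε := by
    simp only [q, norm_mul, Complex.norm_I, mul_one, Complex.norm_real, Real.norm_eq_abs]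
    have h3 : |σ| = 1 := by rcases hσ with rfl | rfl <;> simp
    rw [h3, abs_of_pos (by positivity)]
    linarith
  have han : ‖(a : ℂ)‖ < ε := by simpa using ha
  have hbn : ‖(b : ℂ)‖ < ε := by simpa using hb
  have hkA : ∀ x y z : ℂ, ‖x‖ < ε → ‖y‖ < ε → z ∈ segment ℝ x y → AnalyticAt ℂ k (-z) :=
    fun x y z hx hy hz => (h (by
      rw [norm_neg]; linarith [norm_lt_of_mem_segment hx hy hz])).2
  have hEA : ∀ (s : ℝ) (z : ℂ), s ≠ 0 → |s| < ε → z ∈ segment ℝ (s : ℂ) q → AnalyticAt ℂ E z := by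
    intro s z hs0 hs hz
    refine hE z ?_ ?_
    · have := norm_lt_of_mem_segment (by simpa using hs) hqn hz
      linarith
    · obtain ⟨t, ht, rfl⟩ := exists_of_mem_segment hz
      have hre : ((s : ℂ) + t * (q - s)).re = s * (1 - t) := by simp [hqre]; ring
      have him : σ * ((s : ℂ) + t * (q - s)).im = t * (ε / 2) := by
        rw [← hqim]; simp; ring
      rw [hre, him]
      by_cases ht0 : t = 0
      · right; simpa [ht0] using hs0
      · left
        have : 0 < t := lt_of_le_of_ne ht.1 (Ne.symm ht0)
        positivity
  have han1 : AnalyticAt ℂ (conv E k a q) 0 :=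
    conv_analyticAt_zero (fun x hx => hEA a x ha0 ha hx) (fun x hx => hkA _ _ x han hqn hx)
  have han2 : AnalyticAt ℂ (conv E k q b) 0 := by
    refine conv_analyticAt_zero (fun x hx => hEA b x hb0 hb ?_) (fun x hx => hkA _ _ x hqn hbn hx)
    rwa [segment_symm]
  refine ⟨_, han1.add han2, Metric.eventually_nhds_iff.2 ⟨ε, hε, fun d hd hs => ?_⟩⟩
  rw [dist_zero_right] at hd
  have hx : ∀ x ∈ segment ℝ (a : ℂ) b, ‖x‖ < ε := fun x hx => norm_lt_of_mem_segment han hbn hx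
  have e1 : conv A B a b d = conv E k a b d := by
    refine conv_congr (fun x hx' => hAE _ ?_ ?_) (fun x hx' => (h ?_).1 ?_)
    · linarith [norm_add_le x d, hx x hx']
    · simpa [im_eq_zero_of_mem_segment_ofReal hx'] using hs
    · linarith [norm_sub_le d x, hx x hx']
    · simpa [im_eq_zero_of_mem_segment_ofReal hx'] using hs
  rw [e1, Pi.add_apply]
  -- For fixed `d`, both paths lie in this half disc, where `x + d` is still on the side `σ`.
  have hconv : Convex ℝ ({x : ℂ | -(σ * d.im) < σ * x.im} ∩ Metric.ball 0 ε) := by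
    refine Convex.inter ?_ (convex_ball _ _)
    exact convex_halfSpace_gt (IsLinearMap.mk (by simp [mul_add]) (by simp [mul_left_comm])) _
  refine (conv_add_of_convex hconv (fun x hx => ?_) (fun x hx => ?_) ?_ ?_ ?_).symm
  · have h3 : ‖x‖ < ε := by simpa using hx.2
    refine hE _ (by linarith [norm_add_le x d]) (Or.inl ?_)
    have := hx.1
    simp only [Set.mem_ofPred_eq] at this
    rw [Complex.add_im, mul_add]
    linarith
  · have h3 : ‖x‖ < ε := by simpa using hx.2
    exact (h (by linarith [norm_sub_le d x])).2
  · exact ⟨by simpa using hs, by simpa using ha⟩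
  · exact ⟨by rw [Set.mem_ofPred_eq, hqim]; linarith, by simpa using hqn⟩
  · exact ⟨by simpa using hs, by simpa using hb⟩

theorem RegGerm.conv_locGerm {K : Subfield ℂ} {σ : ℝ} (hσ : σ = 1 ∨ σ = -1) {A B : ℂ → ℂ}
    (hA : RegGerm σ A) (hB : LocGerm K σ B) :
    ∃ ε > 0, ∀ a b : ℝ, a ≠ 0 → b ≠ 0 → |a| < ε → |b| < ε → RegGerm σ (conv A B a b) := by
  obtain ⟨ε, hε, h⟩ := hB.conv_regGerm hσ hA
  refine ⟨ε, hε, fun a b ha hb ha' hb' => ?_⟩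
  have := h (-b) (-a) (neg_ne_zero.2 hb) (neg_ne_zero.2 ha) (by simpa) (by simpa)
  have e : conv A B a b = conv B A ((-b : ℝ) : ℂ) ((-a : ℝ) : ℂ) :=
    funext fun d => by rw [conv_swap]; push_cast; rfl
  rwa [e]

/-- Away from the pinch, the convolution of two local germs is regular. -/
theorem LocGerm.conv_of_same_sign {K : Subfield ℂ} {σ : ℝ} (hσ : σ = 1 ∨ σ = -1) {A B : ℂ → ℂ}
    (hA : LocGerm K σ A) (hB : LocGerm K σ B) :
    ∃ ε > 0, ∀ a b : ℝ, 0 < a * b → |a| < ε → |b| < ε → RegGerm σ (conv A B a b) := by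
  obtain ⟨c, V, φ, hV, hφ, h1⟩ := hA
  obtain ⟨E, hE, hAE⟩ := exists_slit_extension hσ (hV.diff φ hφ) h1
  obtain ⟨c', V', φ', hV', hφ', h1'⟩ := hB
  obtain ⟨E', hE', hBE⟩ := exists_slit_extension hσ (hV'.diff φ' hφ') h1'
  obtain ⟨ε, hε, hεc, hεc'⟩ : ∃ ε > 0, 2 * ε ≤ Real.exp c ∧ 2 * ε ≤ Real.exp c' :=
    ⟨min (Real.exp c) (Real.exp c') / 2, by positivity,
      by linarith [min_le_left (Real.exp c) (Real.exp c')],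
      by linarith [min_le_right (Real.exp c) (Real.exp c')]⟩
  refine ⟨ε, hε, fun a b hab ha hb => ?_⟩
  have hx : ∀ x ∈ segment ℝ (a : ℂ) b, ‖x‖ < ε := fun x hx =>
    norm_lt_of_mem_segment (by simpa using ha) (by simpa using hb) hx
  have hx0 : ∀ x ∈ segment ℝ (a : ℂ) b, x.re ≠ 0 := by
    intro x hx
    obtain ⟨t, ht, rfl⟩ := exists_of_mem_segment hx
    have : ((a : ℂ) + t * (b - a)).re = (1 - t) * a + t * b := by simp; ring
    rw [this]
    intro h0
    have h4 := ht.1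
    have h5 := ht.2
    -- Multiplying by `a` expresses `0` as a convex combination of the positive numbers `a * a` and
    -- `a * b`.
    have h6 : 0 = (1 - t) * (a * a) + t * (a * b) := by linear_combination -a * h0
    have h7 : 0 < a * a := mul_self_pos.2 (by rintro rfl; simp at hab)
    rcases eq_or_lt_of_le h4 with h8 | h8
    · rw [← h8] at h6; linarith
    · have := mul_pos h8 hab
      have := mul_nonneg (sub_nonneg.2 h5) h7.le
      linarith
  refine ⟨_, conv_analyticAt_zero (u := E) (v := E') (a := a) (b := b)
    (fun x hx' => hE x (by linarith [hx x hx']) (Or.inr (hx0 x hx')))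
    (fun x hx' => hE' (-x) (by rw [norm_neg]; linarith [hx x hx'])
      (Or.inr (by simpa using hx0 x hx'))),
    Metric.eventually_nhds_iff.2 ⟨ε, hε, fun d hd hs => ?_⟩⟩
  rw [dist_zero_right] at hd
  refine conv_congr (fun x hx' => hAE _ ?_ ?_) (fun x hx' => hBE _ ?_ ?_)
  · linarith [norm_add_le x d, hx x hx']
  · simpa [im_eq_zero_of_mem_segment_ofReal hx'] using hs
  · linarith [norm_sub_le d x, hx x hx']
  · simpa [im_eq_zero_of_mem_segment_ofReal hx'] using hs

/-! ### Bilinear parameter integrals -/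

/-- Finitely generated spans of the values of a bilinear operation. -/
theorem fg_span_of_bilinear {K : Subfield ℂ} {V W : Submodule K (ℂ → ℂ)} (hV : V.FG) (hW : W.FG)
    (op : (ℂ → ℂ) → (ℂ → ℂ) → ℂ → ℂ)
    (h1 : ∀ v ∈ V, ∀ v' ∈ V, ∀ w ∈ W, op (v + v') w = op v w + op v' w)
    (h2 : ∀ a : K, ∀ v ∈ V, ∀ w ∈ W, op (a • v) w = a • op v w)
    (h3 : ∀ v ∈ V, ∀ w ∈ W, ∀ w' ∈ W, op v (w + w') = op v w + op v w')
    (h4 : ∀ a : K, ∀ v ∈ V, ∀ w ∈ W, op v (a • w) = a • op v w) :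
    (Submodule.span K {f | ∃ v ∈ V, ∃ w ∈ W, f = op v w}).FG := by
  let B : V →ₗ[K] W →ₗ[K] (ℂ → ℂ) := LinearMap.mk₂ K (fun v w => op v w)
    (fun v v' w => h1 v v.2 v' v'.2 w w.2) (fun a v w => h2 a v v.2 w w.2)
    (fun v w w' => h3 v v.2 w w.2 w' w'.2) (fun a v w => h4 a v v.2 w w.2)
  have hV' : (⊤ : Submodule K V).FG := (Submodule.fg_top V).2 hV
  have hW' : (⊤ : Submodule K W).FG := (Submodule.fg_top W).2 hW
  have := hV'.map₂ B hW'
  rw [Submodule.map₂_eq_span_image2] at this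
  have he : {f | ∃ v ∈ V, ∃ w ∈ W, f = op v w} = Set.image2 (fun v w => B v w)
      ((⊤ : Submodule K V) : Set V) ((⊤ : Submodule K W) : Set W) := by
    ext f
    constructor
    · rintro ⟨v, hv, w, hw, rfl⟩
      exact ⟨⟨v, hv⟩, trivial, ⟨w, hw⟩, trivial, rfl⟩
    · rintro ⟨v, -, w, -, rfl⟩
      exact ⟨v, v.2, w, w.2, rfl⟩
  rwa [he]

/-- A holomorphic family of paths in `{w | w.re < c}` with parameter in `{ζ | ζ.re < c'}`. -/
def HolPath (c c' : ℝ) (p : ℂ → ℂ → ℂ) : Prop :=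
  ∀ ζ : ℂ, ζ.re < c' → ∀ t ∈ Set.Icc (0 : ℝ) 1,
    DifferentiableAt ℂ (fun x : ℂ × ℂ => p x.1 x.2) (ζ, (t : ℂ)) ∧ (p ζ t).re < c

open scoped Classical in
/-- A bilinear integral, truncated to the half plane `{ζ | ζ.re < c'}`. -/
noncomputable def bilinInt (c' : ℝ) (p q m : ℂ → ℂ → ℂ) (v w : ℂ → ℂ) (ζ : ℂ) : ℂ :=
  if ζ.re < c' then ∫ t in (0 : ℝ)..1, v (p ζ t) * w (q ζ t) * m ζ t else 0

theorem continuousAt_of_family {p : ℂ → ℂ → ℂ} {ζ : ℂ} {t : ℝ}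
    (h : DifferentiableAt ℂ (fun x : ℂ × ℂ => p x.1 x.2) (ζ, (t : ℂ))) :
    ContinuousAt (fun x : ℂ × ℝ => p x.1 x.2) (ζ, t) :=
  ContinuousAt.comp (f := fun x : ℂ × ℝ => (x.1, (x.2 : ℂ)))
    (g := fun x : ℂ × ℂ => p x.1 x.2) h.continuousAt (by fun_prop)

theorem differentiableAt_of_family {p : ℂ → ℂ → ℂ} {ζ : ℂ} {t : ℝ}
    (h : DifferentiableAt ℂ (fun x : ℂ × ℂ => p x.1 x.2) (ζ, (t : ℂ))) :
    DifferentiableAt ℂ (fun z => p z t) ζ :=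
  DifferentiableAt.comp (f := fun z : ℂ => (z, (t : ℂ))) ζ h (by fun_prop)

theorem continuousAt_of_holPath {c c' : ℝ} {p : ℂ → ℂ → ℂ} (hp : HolPath c c' p) {v : ℂ → ℂ}
    (hv : DifferentiableOn ℂ v {w | w.re < c}) {ζ : ℂ} (hζ : ζ.re < c') {t : ℝ}
    (ht : t ∈ Set.Icc (0 : ℝ) 1) :
    ContinuousAt (fun x : ℂ × ℝ => v (p x.1 x.2)) (ζ, t) := by
  obtain ⟨h1, h2⟩ := hp ζ hζ t ht
  exact ContinuousAt.comp (f := fun x : ℂ × ℝ => p x.1 x.2)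
    (hv.differentiableAt ((isOpen_re_lt c).mem_nhds h2)).continuousAt (continuousAt_of_family h1)

theorem differentiableAt_of_holPath {c c' : ℝ} {p : ℂ → ℂ → ℂ} (hp : HolPath c c' p) {v : ℂ → ℂ}
    (hv : DifferentiableOn ℂ v {w | w.re < c}) {ζ : ℂ} (hζ : ζ.re < c') {t : ℝ}
    (ht : t ∈ Set.Icc (0 : ℝ) 1) : DifferentiableAt ℂ (fun z => v (p z t)) ζ := by
  obtain ⟨h1, h2⟩ := hp ζ hζ t ht
  exact DifferentiableAt.comp (f := fun z : ℂ => p z t) ζ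
    (hv.differentiableAt ((isOpen_re_lt c).mem_nhds h2)) (differentiableAt_of_family h1)

section
variable {c c' : ℝ} {p q m : ℂ → ℂ → ℂ} (hp : HolPath c c' p) (hq : HolPath c c' q)
  (hm : ∀ ζ : ℂ, ζ.re < c' → ∀ t ∈ Set.Icc (0 : ℝ) 1,
    DifferentiableAt ℂ (fun x : ℂ × ℂ => m x.1 x.2) (ζ, (t : ℂ)))
include hp hq hm

theorem bilinInt_differentiableOn {v w : ℂ → ℂ} (hv : DifferentiableOn ℂ v {w | w.re < c})
    (hw : DifferentiableOn ℂ w {w | w.re < c}) :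
    DifferentiableOn ℂ (bilinInt c' p q m v w) {w | w.re < c'} := by
  refine (differentiableOn_intervalIntegral_param
    (k := fun ζ t => v (p ζ t) * w (q ζ t) * m ζ t) (isOpen_re_lt c') ?_ ?_).congr
    fun ζ hζ => if_pos hζ
  · rintro ⟨ζ, t⟩ ⟨hζ, ht⟩
    exact (((continuousAt_of_holPath hp hv hζ ht).mul (continuousAt_of_holPath hq hw hζ ht)).mul
      (continuousAt_of_family (hm ζ hζ t ht))).continuousWithinAt
  · intro t ht ζ hζ
    exact (((differentiableAt_of_holPath hp hv hζ ht).mul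
      (differentiableAt_of_holPath hq hw hζ ht)).mul
      (differentiableAt_of_family (hm ζ hζ t ht))).differentiableWithinAt

theorem bilinInt_intervalIntegrable {v w : ℂ → ℂ} (hv : DifferentiableOn ℂ v {w | w.re < c})
    (hw : DifferentiableOn ℂ w {w | w.re < c}) {ζ : ℂ} (hζ : ζ.re < c') :
    IntervalIntegrable (fun t : ℝ => v (p ζ t) * w (q ζ t) * m ζ t) MeasureTheory.volume 0 1 := by
  refine ContinuousOn.intervalIntegrable fun t ht => ?_
  rw [Set.uIcc_of_le zero_le_one] at ht
  refine ContinuousAt.continuousWithinAt ?_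
  exact ContinuousAt.comp (f := fun t : ℝ => (ζ, t))
    (g := fun x : ℂ × ℝ => v (p x.1 x.2) * w (q x.1 x.2) * m x.1 x.2)
    (((continuousAt_of_holPath hp hv hζ ht).mul (continuousAt_of_holPath hq hw hζ ht)).mul
      (continuousAt_of_family (hm ζ hζ t ht))) (by fun_prop)

theorem bilinInt_add_left {v v' w : ℂ → ℂ} (hv : DifferentiableOn ℂ v {w | w.re < c})
    (hv' : DifferentiableOn ℂ v' {w | w.re < c}) (hw : DifferentiableOn ℂ w {w | w.re < c}) :
    bilinInt c' p q m (v + v') w = bilinInt c' p q m v w + bilinInt c' p q m v' w := by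
  funext ζ
  simp only [bilinInt, Pi.add_apply]
  split_ifs with hζ
  · rw [← intervalIntegral.integral_add (bilinInt_intervalIntegrable hp hq hm hv hw hζ)
      (bilinInt_intervalIntegrable hp hq hm hv' hw hζ)]
    simp only [add_mul]
  · simp

theorem bilinInt_add_right {v w w' : ℂ → ℂ} (hv : DifferentiableOn ℂ v {w | w.re < c})
    (hw : DifferentiableOn ℂ w {w | w.re < c}) (hw' : DifferentiableOn ℂ w' {w | w.re < c}) :
    bilinInt c' p q m v (w + w') = bilinInt c' p q m v w + bilinInt c' p q m v w' := by
  funext ζ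
  simp only [bilinInt, Pi.add_apply]
  split_ifs with hζ
  · rw [← intervalIntegral.integral_add (bilinInt_intervalIntegrable hp hq hm hv hw hζ)
      (bilinInt_intervalIntegrable hp hq hm hv hw' hζ)]
    simp only [add_mul, mul_add]
  · simp
end

theorem bilinInt_smul_left {K : Subfield ℂ} (c' : ℝ) (p q m : ℂ → ℂ → ℂ) (v w : ℂ → ℂ) (a : K) :
    bilinInt c' p q m (a • v) w = a • bilinInt c' p q m v w := by
  funext ζ
  simp only [bilinInt, Pi.smul_apply, Subfield.smul_def, smul_eq_mul]
  split_ifs with hζ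
  · rw [← intervalIntegral.integral_const_mul]
    simp only [mul_assoc]
  · simp

theorem bilinInt_smul_right {K : Subfield ℂ} (c' : ℝ) (p q m : ℂ → ℂ → ℂ) (v w : ℂ → ℂ) (a : K) :
    bilinInt c' p q m v (a • w) = a • bilinInt c' p q m v w := by
  funext ζ
  simp only [bilinInt, Pi.smul_apply, Subfield.smul_def, smul_eq_mul]
  split_ifs with hζ
  · rw [← intervalIntegral.integral_const_mul]
    congr 1
    funext t
    ring
  · simp

/-- Far to the left the limit gives the bound `1`; the rest of the region is a compact rectangle
inside the domain. -/
theorem SectorSmall.exists_bound {v : ℂ → ℂ} {c c'' : ℝ} (hs : SectorSmall v)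
    (hd : DifferentiableOn ℂ v {w | w.re < c}) (hc : c'' < c) (M : ℝ) :
    ∃ C, 0 ≤ C ∧ ∀ w : ℂ, w.re ≤ c'' → |w.im| ≤ M → ‖Complex.exp w * v w‖ ≤ C := by
  obtain ⟨N, hN⟩ := eventually_sectorFilter.1
    ((hs M).norm.eventually (gt_mem_nhds (by simp : ‖(0 : ℂ)‖ < 1)))
  have hK : IsCompact (Set.Icc N c'' ×ℂ Set.Icc (-M) M) := isCompact_Icc.reProdIm isCompact_Icc
  obtain ⟨C, hC⟩ := hK.exists_bound_of_continuousOn (f := fun w => Complex.exp w * v w) (by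
    refine Complex.continuous_exp.continuousOn.mul (hd.continuousOn.mono fun w hw => ?_)
    exact lt_of_le_of_lt hw.1.2 hc)
  refine ⟨max C 1, by positivity, fun w h1 h2 => ?_⟩
  by_cases hw : w.re < N
  · exact (hN w hw h2).le.trans (le_max_right _ _)
  · exact (hC w ⟨⟨not_lt.1 hw, h1⟩, abs_le.1 h2⟩).trans (le_max_left _ _)

/-! ### The path coordinates near a pinch -/

theorem one_add_mem_slitPlane {x : ℂ} (hx : ‖x‖ < 1) : 1 + x ∈ Complex.slitPlane := by
  rw [Complex.mem_slitPlane_iff]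
  left
  have := Complex.abs_re_le_norm x
  rw [abs_le] at this
  simp only [Complex.add_re, Complex.one_re]
  linarith

theorem re_log_one_add_lt {x : ℂ} (hx : ‖x‖ < 1) : (Complex.log (1 + x)).re < 1 := by
  have h0 := Complex.slitPlane_ne_zero (one_add_mem_slitPlane hx)
  rw [Complex.log_re]
  have h1 := Real.log_le_sub_one_of_pos (norm_pos_iff.2 h0)
  have h2 := norm_add_le 1 x
  rw [norm_one] at h2
  linarith

theorem abs_im_log_le (x : ℂ) : |(Complex.log x).im| ≤ 4 := by
  rw [Complex.log_im]
  exact (Complex.abs_arg_le_pi x).trans Real.pi_lt_four.le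

/-- First coordinate on the outer part of the path. -/
noncomputable def outerCoord₁ (ζ W : ℂ) : ℂ := W + Complex.log (1 + Complex.exp (ζ - W))

/-- Second coordinate on the outer part of the path. -/
noncomputable def outerCoord₂ (σ : ℝ) (ζ W : ℂ) : ℂ :=
  W + σ * Real.pi * Complex.I + Complex.log (1 + -Complex.exp (ζ - W))

theorem norm_exp_sub_lt {ζ W : ℂ} (h : ζ.re < W.re) : ‖Complex.exp (ζ - W)‖ < 1 := by
  rw [Complex.norm_exp, Real.exp_lt_one_iff, Complex.sub_re]
  linarith

theorem differentiableAt_outerCoord₁ {x : ℂ × ℂ} (h : x.1.re < x.2.re) :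
    DifferentiableAt ℂ (fun x : ℂ × ℂ => outerCoord₁ x.1 x.2) x := by
  have h1 : DifferentiableAt ℂ (fun x : ℂ × ℂ => 1 + Complex.exp (x.1 - x.2)) x := by fun_prop
  have h2 := h1.clog (one_add_mem_slitPlane (norm_exp_sub_lt h))
  exact differentiableAt_snd.add h2

theorem differentiableAt_outerCoord₂ (σ : ℝ) {x : ℂ × ℂ} (h : x.1.re < x.2.re) :
    DifferentiableAt ℂ (fun x : ℂ × ℂ => outerCoord₂ σ x.1 x.2) x := by
  have h1 : DifferentiableAt ℂ (fun x : ℂ × ℂ => 1 + -Complex.exp (x.1 - x.2)) x := by fun_prop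
  have h2 := h1.clog (one_add_mem_slitPlane (by rw [norm_neg]; exact norm_exp_sub_lt h))
  exact (differentiableAt_snd.add_const _).add h2

theorem re_outerCoord₁_lt {ζ W : ℂ} (h : ζ.re < W.re) : (outerCoord₁ ζ W).re < W.re + 1 := by
  have := re_log_one_add_lt (norm_exp_sub_lt h)
  simp only [outerCoord₁, Complex.add_re]
  linarith

theorem re_outerCoord₂_lt {σ : ℝ} {ζ W : ℂ} (h : ζ.re < W.re) :
    (outerCoord₂ σ ζ W).re < W.re + 1 := by
  have := re_log_one_add_lt (x := -Complex.exp (ζ - W)) (by rw [norm_neg]; exact norm_exp_sub_lt h)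
  have h2 : ((σ : ℂ) * Real.pi * Complex.I).re = 0 := by simp
  simp only [outerCoord₂, Complex.add_re, h2]
  linarith

theorem exp_outerCoord₁ {ζ W : ℂ} (h : ζ.re < W.re) :
    Complex.exp (outerCoord₁ ζ W) = Complex.exp W * (1 + Complex.exp (ζ - W)) := by
  rw [outerCoord₁, Complex.exp_add,
    Complex.exp_log (Complex.slitPlane_ne_zero (one_add_mem_slitPlane (norm_exp_sub_lt h)))]

theorem exp_side_pi {σ : ℝ} (hσ : σ = 1 ∨ σ = -1) :
    Complex.exp (σ * Real.pi * Complex.I) = -1 := by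
  rcases hσ with rfl | rfl
  · simp
  · rw [show (((-1 : ℝ) : ℂ) * Real.pi * Complex.I) = -(Real.pi * Complex.I) by push_cast; ring,
      Complex.exp_neg, Complex.exp_pi_mul_I]
    norm_num

theorem exp_outerCoord₂ {σ : ℝ} (hσ : σ = 1 ∨ σ = -1) {ζ W : ℂ} (h : ζ.re < W.re) :
    Complex.exp (outerCoord₂ σ ζ W) = -(Complex.exp W * (1 + -Complex.exp (ζ - W))) := by
  rw [outerCoord₂, Complex.exp_add, Complex.exp_add, exp_side_pi hσ,
    Complex.exp_log (Complex.slitPlane_ne_zero (one_add_mem_slitPlane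
      (by rw [norm_neg]; exact norm_exp_sub_lt h)))]
  ring

theorem abs_im_outerCoord₁_le (ζ W : ℂ) : |(outerCoord₁ ζ W).im| ≤ |W.im| + 4 := by
  rw [outerCoord₁, Complex.add_im]
  exact (abs_add_le _ _).trans (by gcongr; exact abs_im_log_le _)

theorem abs_im_outerCoord₂_le {σ : ℝ} (hσ : σ = 1 ∨ σ = -1) (ζ W : ℂ) :
    |(outerCoord₂ σ ζ W).im| ≤ |W.im| + 8 := by
  have h2 : ((σ : ℂ) * Real.pi * Complex.I).im = σ * Real.pi := by simp
  have h3 : |σ * Real.pi| ≤ 4 := by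
    have := Real.pi_lt_four
    have := Real.pi_pos
    rw [abs_le]
    rcases hσ with rfl | rfl <;> constructor <;> linarith
  rw [outerCoord₂, Complex.add_im, Complex.add_im, h2]
  have := abs_add_le (W.im + σ * Real.pi) (Complex.log (1 + -Complex.exp (ζ - W))).im
  have := abs_add_le W.im (σ * Real.pi)
  have := abs_im_log_le (1 + -Complex.exp (ζ - W))
  linarith

/-- The coordinates depend on `ζ` only through `exp (ζ - W)`, so on a fixed outer contour the
integrand is unchanged when `ζ` makes a turn. -/
theorem outerCoord₁_shift (ζ W : ℂ) : outerCoord₁ (ζ + 2 * Real.pi * Complex.I) W =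
    outerCoord₁ ζ W := by
  rw [outerCoord₁, outerCoord₁, show ζ + 2 * Real.pi * Complex.I - W =
    ζ - W + 2 * Real.pi * Complex.I by ring, Complex.exp_periodic (ζ - W)]

theorem outerCoord₂_shift (σ : ℝ) (ζ W : ℂ) : outerCoord₂ σ (ζ + 2 * Real.pi * Complex.I) W =
    outerCoord₂ σ ζ W := by
  rw [outerCoord₂, outerCoord₂, show ζ + 2 * Real.pi * Complex.I - W =
    ζ - W + 2 * Real.pi * Complex.I by ring, Complex.exp_periodic (ζ - W)]

/-- A turn of `W`, by contrast, is a turn of both arguments, and acts on the integrand through the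
monodromies of `v` and `w`. -/
theorem outerCoord₁_shift_right (ζ W : ℂ) : outerCoord₁ ζ (W + 2 * Real.pi * Complex.I) =
    outerCoord₁ ζ W + 2 * Real.pi * Complex.I := by
  rw [outerCoord₁, outerCoord₁, show ζ - (W + 2 * Real.pi * Complex.I) =
    ζ - W - 2 * Real.pi * Complex.I by ring, Complex.exp_periodic.sub_eq (ζ - W)]
  ring

theorem outerCoord₂_shift_right (σ : ℝ) (ζ W : ℂ) :
    outerCoord₂ σ ζ (W + 2 * Real.pi * Complex.I) =
    outerCoord₂ σ ζ W + 2 * Real.pi * Complex.I := by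
  rw [outerCoord₂, outerCoord₂, show ζ - (W + 2 * Real.pi * Complex.I) =
    ζ - W - 2 * Real.pi * Complex.I by ring, Complex.exp_periodic.sub_eq (ζ - W)]
  ring

/-! ### The space spanned by the pinch integrals -/

/-- Starting point of the outer path, relative to `ζ`. -/
noncomputable def pinchOffset (σ : ℝ) : ℂ := Real.log 2 - σ * (Real.pi / 2) * Complex.I

/-- The integration variable is `exp W`. The starting value `exp (ζ + pinchOffset σ)` equals `-2 * σ
* I * exp ζ`, the point at which the inner path ends. -/
noncomputable def outerPath (σ b : ℝ) (ζ t : ℂ) : ℂ :=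
  ζ + pinchOffset σ + t * (Real.log b - (ζ + pinchOffset σ))

/-- Starts one turn above `log b` and ends at `log b`, matching the displacement of the outer path
after a turn of `ζ`. -/
noncomputable def circlePath (b : ℝ) (t : ℂ) : ℂ :=
  Real.log b + 2 * Real.pi * Complex.I +
    t * (Real.log b - (Real.log b + 2 * Real.pi * Complex.I))

/-- The inner part of the pinch integral. -/
noncomputable def pinchInner (σ c' : ℝ) : (ℂ → ℂ) → (ℂ → ℂ) → ℂ → ℂ :=
  bilinInt c' (fun ζ t => ζ + Complex.log (1 + -(2 * σ * Complex.I * t)))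
    (fun ζ t => ζ + Complex.log (1 + 2 * σ * Complex.I * t))
    (fun ζ _ => -(2 * σ * Complex.I) * Complex.exp ζ)

/-- The outer part of the pinch integral. -/
noncomputable def pinchOuter (σ b c' : ℝ) : (ℂ → ℂ) → (ℂ → ℂ) → ℂ → ℂ :=
  bilinInt c' (fun ζ t => outerCoord₁ ζ (outerPath σ b ζ t))
    (fun ζ t => outerCoord₂ σ ζ (outerPath σ b ζ t))
    (fun ζ t => Complex.exp (outerPath σ b ζ t) * (Real.log b - (ζ + pinchOffset σ)))

/-- The integral of the outer kernel along a full circle. -/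
noncomputable def pinchCircle (σ b c' : ℝ) : (ℂ → ℂ) → (ℂ → ℂ) → ℂ → ℂ :=
  bilinInt c' (fun ζ t => outerCoord₁ ζ (circlePath b t))
    (fun ζ t => outerCoord₂ σ ζ (circlePath b t))
    (fun _ t => Complex.exp (circlePath b t) *
      (Real.log b - (Real.log b + 2 * Real.pi * Complex.I)))

/-- The integrand of the outer and circle integrals. -/
noncomputable def pinchKernel (σ : ℝ) (v w : ℂ → ℂ) (ζ W : ℂ) : ℂ :=
  v (outerCoord₁ ζ W) * w (outerCoord₂ σ ζ W) * Complex.exp W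

theorem log_two_lt_one : Real.log 2 < 1 := by
  linarith [Real.log_two_lt_d9]

theorem pinchOffset_re (σ : ℝ) : (pinchOffset σ).re = Real.log 2 := by
  have : ((σ : ℂ) * (Real.pi / 2) * Complex.I).re = 0 := by
    rw [show ((σ : ℂ) * (Real.pi / 2) * Complex.I) = ((σ * (Real.pi / 2) : ℝ) : ℂ) * Complex.I by
      push_cast; ring, Complex.re_ofReal_mul, Complex.I_re, mul_zero]
  rw [pinchOffset, Complex.sub_re, this, Complex.ofReal_re, sub_zero]

theorem pinchOffset_im (σ : ℝ) : (pinchOffset σ).im = -(σ * (Real.pi / 2)) := by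
  have : ((σ : ℂ) * (Real.pi / 2) * Complex.I).im = σ * (Real.pi / 2) := by
    rw [show ((σ : ℂ) * (Real.pi / 2) * Complex.I) = ((σ * (Real.pi / 2) : ℝ) : ℂ) * Complex.I by
      push_cast; ring, Complex.im_ofReal_mul, Complex.I_im, mul_one]
  rw [pinchOffset, Complex.sub_im, this, Complex.ofReal_im, zero_sub]

theorem outerPath_re (σ b : ℝ) (ζ : ℂ) (t : ℝ) : (outerPath σ b ζ t).re =
    ζ.re + Real.log 2 + t * (Real.log b - (ζ.re + Real.log 2)) := by
  rw [outerPath, Complex.add_re, Complex.re_ofReal_mul, Complex.sub_re, Complex.add_re,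
    pinchOffset_re, Complex.ofReal_re]

theorem circlePath_re (b t : ℝ) : (circlePath b t).re = Real.log b := by
  rw [circlePath, Complex.add_re, Complex.re_ofReal_mul]
  simp

theorem circlePath_im (b t : ℝ) : (circlePath b t).im = (1 - t) * (2 * Real.pi) := by
  rw [circlePath, Complex.add_im, Complex.im_ofReal_mul]
  simp
  ring

theorem side_path_mem_slitPlane (σ t : ℝ) :
    1 + 2 * σ * Complex.I * t ∈ Complex.slitPlane ∧
      1 + -(2 * σ * Complex.I * t) ∈ Complex.slitPlane := by
  constructor <;> rw [Complex.mem_slitPlane_iff] <;> left <;> simp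

theorem norm_side_path_le {σ : ℝ} (hσ : σ = 1 ∨ σ = -1) {t : ℝ} (ht : t ∈ Set.Icc (0 : ℝ) 1) :
    ‖2 * (σ : ℂ) * Complex.I * t‖ ≤ 2 := by
  have : |σ| = 1 := by rcases hσ with rfl | rfl <;> simp
  simp only [norm_mul, Complex.norm_I, Complex.norm_real, Real.norm_eq_abs, this, abs_of_nonneg ht.1,
    Complex.norm_ofNat]
  linarith [ht.2]

theorem re_log_one_add_le {x : ℂ} (hx : ‖x‖ ≤ 2) (h0 : 1 + x ∈ Complex.slitPlane) :
    (Complex.log (1 + x)).re ≤ 2 := by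
  rw [Complex.log_re]
  have h1 := Real.log_le_sub_one_of_pos (norm_pos_iff.2 (Complex.slitPlane_ne_zero h0))
  have h2 := norm_add_le 1 x
  rw [norm_one] at h2
  linarith

theorem holPath_inner {σ c c' : ℝ} (hσ : σ = 1 ∨ σ = -1) (hc : c' + 2 ≤ c) :
    HolPath c c' (fun ζ t => ζ + Complex.log (1 + 2 * σ * Complex.I * t)) ∧
    HolPath c c' (fun ζ t => ζ + Complex.log (1 + -(2 * σ * Complex.I * t))) := by
  constructor
  · intro ζ hζ t ht
    refine ⟨?_, ?_⟩
    · have h1 : DifferentiableAt ℂ (fun x : ℂ × ℂ => 1 + 2 * (σ : ℂ) * Complex.I * x.2) (ζ, (t : ℂ)) := by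
        fun_prop
      exact differentiableAt_fst.add (h1.clog (side_path_mem_slitPlane σ t).1)
    · have := re_log_one_add_le (norm_side_path_le hσ ht) (side_path_mem_slitPlane σ t).1
      rw [Complex.add_re]
      linarith
  · intro ζ hζ t ht
    refine ⟨?_, ?_⟩
    · have h1 : DifferentiableAt ℂ (fun x : ℂ × ℂ => 1 + -(2 * (σ : ℂ) * Complex.I * x.2))
          (ζ, (t : ℂ)) := by
        fun_prop
      exact differentiableAt_fst.add (h1.clog (side_path_mem_slitPlane σ t).2)
    · have := re_log_one_add_le (x := -(2 * σ * Complex.I * t))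
        (by rw [norm_neg]; exact norm_side_path_le hσ ht) (side_path_mem_slitPlane σ t).2
      rw [Complex.add_re]
      linarith

theorem outerPath_re_bounds {σ b : ℝ} {ζ : ℂ} (hζ : ζ.re < Real.log b - 1) {t : ℝ}
    (ht : t ∈ Set.Icc (0 : ℝ) 1) :
    ζ.re + Real.log 2 ≤ (outerPath σ b ζ t).re ∧ (outerPath σ b ζ t).re ≤ Real.log b := by
  have h2 := log_two_lt_one
  rw [outerPath_re]
  constructor
  · have := mul_nonneg ht.1 (show 0 ≤ Real.log b - (ζ.re + Real.log 2) by linarith)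
    linarith
  · have := mul_nonneg (sub_nonneg.2 ht.2) (show 0 ≤ Real.log b - (ζ.re + Real.log 2) by linarith)
    linarith

theorem log_two_pos : 0 < Real.log 2 := Real.log_pos one_lt_two

theorem holPath_outer {σ b c : ℝ} (hb : Real.log b + 2 ≤ c) :
    HolPath c (Real.log b - 1) (fun ζ t => outerCoord₁ ζ (outerPath σ b ζ t)) ∧
    HolPath c (Real.log b - 1) (fun ζ t => outerCoord₂ σ ζ (outerPath σ b ζ t)) := by
  have hW : ∀ (ζ : ℂ) (t : ℝ), DifferentiableAt ℂ (fun x : ℂ × ℂ => (x.1, outerPath σ b x.1 x.2))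
      (ζ, (t : ℂ)) := fun ζ t => by
    unfold outerPath
    fun_prop
  constructor <;> intro ζ hζ t ht <;>
    obtain ⟨h1, h2⟩ := outerPath_re_bounds (σ := σ) hζ ht <;>
    have hlt : ζ.re < (outerPath σ b ζ t).re := by linarith [log_two_pos]
  · refine ⟨DifferentiableAt.comp (f := fun x : ℂ × ℂ => (x.1, outerPath σ b x.1 x.2))
      (g := fun x : ℂ × ℂ => outerCoord₁ x.1 x.2) (ζ, (t : ℂ))
      (differentiableAt_outerCoord₁ hlt) (hW ζ t), ?_⟩
    have := re_outerCoord₁_lt hlt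
    linarith
  · refine ⟨DifferentiableAt.comp (f := fun x : ℂ × ℂ => (x.1, outerPath σ b x.1 x.2))
      (g := fun x : ℂ × ℂ => outerCoord₂ σ x.1 x.2) (ζ, (t : ℂ))
      (differentiableAt_outerCoord₂ σ hlt) (hW ζ t), ?_⟩
    have := re_outerCoord₂_lt (σ := σ) hlt
    linarith

theorem holPath_circle {σ b c : ℝ} (hb : Real.log b + 2 ≤ c) :
    HolPath c (Real.log b - 1) (fun ζ t => outerCoord₁ ζ (circlePath b t)) ∧
    HolPath c (Real.log b - 1) (fun ζ t => outerCoord₂ σ ζ (circlePath b t)) := by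
  have hW : ∀ (ζ : ℂ) (t : ℝ), DifferentiableAt ℂ (fun x : ℂ × ℂ => (x.1, circlePath b x.2))
      (ζ, (t : ℂ)) := fun ζ t => by
    unfold circlePath
    fun_prop
  constructor <;> intro ζ hζ t ht <;>
    have hre := circlePath_re b t <;>
    have hlt : ζ.re < (circlePath b t).re := by rw [hre]; linarith
  · refine ⟨DifferentiableAt.comp (f := fun x : ℂ × ℂ => (x.1, circlePath b x.2))
      (g := fun x : ℂ × ℂ => outerCoord₁ x.1 x.2) (ζ, (t : ℂ))
      (differentiableAt_outerCoord₁ hlt) (hW ζ t), ?_⟩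
    have := re_outerCoord₁_lt hlt
    linarith
  · refine ⟨DifferentiableAt.comp (f := fun x : ℂ × ℂ => (x.1, circlePath b x.2))
      (g := fun x : ℂ × ℂ => outerCoord₂ σ x.1 x.2) (ζ, (t : ℂ))
      (differentiableAt_outerCoord₂ σ hlt) (hW ζ t), ?_⟩
    have := re_outerCoord₂_lt (σ := σ) hlt
    linarith

theorem fg_span_bilinInt {K : Subfield ℂ} {c c' : ℝ} {V W : Submodule K (ℂ → ℂ)}
    (hV : LocalSpace K c V) (hW : LocalSpace K c W) {p q m : ℂ → ℂ → ℂ}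
    (hp : HolPath c c' p) (hq : HolPath c c' q)
    (hm : ∀ ζ : ℂ, ζ.re < c' → ∀ t ∈ Set.Icc (0 : ℝ) 1,
      DifferentiableAt ℂ (fun x : ℂ × ℂ => m x.1 x.2) (ζ, (t : ℂ))) :
    (Submodule.span K {f | ∃ v ∈ V, ∃ w ∈ W, f = bilinInt c' p q m v w}).FG :=
  fg_span_of_bilinear hV.fg hW.fg (bilinInt c' p q m)
    (fun v hv v' hv' w hw => bilinInt_add_left hp hq hm (hV.diff v hv) (hV.diff v' hv')
      (hW.diff w hw)) (fun _ _ _ _ _ => bilinInt_smul_left ..)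
    (fun v hv w hw w' hw' => bilinInt_add_right hp hq hm (hV.diff v hv) (hW.diff w hw)
      (hW.diff w' hw')) (fun _ _ _ _ _ => bilinInt_smul_right ..)

theorem differentiableAt_innerWeight (σ : ℝ) (y : ℂ × ℂ) :
    DifferentiableAt ℂ (fun x : ℂ × ℂ => -(2 * (σ : ℂ) * Complex.I) * Complex.exp x.1) y := by
  fun_prop

theorem differentiableAt_outerWeight (σ b : ℝ) (y : ℂ × ℂ) :
    DifferentiableAt ℂ (fun x : ℂ × ℂ => Complex.exp (outerPath σ b x.1 x.2) *
      (Real.log b - (x.1 + pinchOffset σ))) y := by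
  unfold outerPath
  fun_prop

theorem differentiableAt_circleWeight (b : ℝ) (y : ℂ × ℂ) :
    DifferentiableAt ℂ (fun x : ℂ × ℂ => Complex.exp (circlePath b x.2) *
      (Real.log b - (Real.log b + 2 * Real.pi * Complex.I))) y := by
  unfold circlePath
  fun_prop

theorem pinchOuter_eq_segInt {σ b c' : ℝ} {v w : ℂ → ℂ} {ζ : ℂ} (hζ : ζ.re < c') :
    pinchOuter σ b c' v w ζ = segInt (pinchKernel σ v w ζ) (ζ + pinchOffset σ) (Real.log b) := by
  rw [pinchOuter, bilinInt, if_pos hζ, segInt, ← intervalIntegral.integral_const_mul]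
  congr 1
  funext t
  simp only [pinchKernel, outerPath]
  ring

theorem pinchCircle_eq_segInt {σ b c' : ℝ} {v w : ℂ → ℂ} {ζ : ℂ} (hζ : ζ.re < c') :
    pinchCircle σ b c' v w ζ = segInt (pinchKernel σ v w ζ)
      (Real.log b + 2 * Real.pi * Complex.I) (Real.log b) := by
  rw [pinchCircle, bilinInt, if_pos hζ, segInt, ← intervalIntegral.integral_const_mul]
  congr 1
  funext t
  simp only [pinchKernel, circlePath]
  ring

/-- To the right of `ζ.re` both logarithms stay in the slit plane, and the coordinates gain less
than `1` in real part, which explains the bounds of the strip. -/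
theorem pinchKernel_differentiableOn {σ c : ℝ} {v w : ℂ → ℂ}
    (hv : DifferentiableOn ℂ v {w | w.re < c}) (hw : DifferentiableOn ℂ w {w | w.re < c}) (ζ : ℂ) :
    DifferentiableOn ℂ (pinchKernel σ v w ζ) {W | ζ.re < W.re ∧ W.re + 1 ≤ c} := by
  rintro W ⟨h1, h2⟩
  have hpair : DifferentiableAt ℂ (fun W : ℂ => (ζ, W)) W := by fun_prop
  have d1 : DifferentiableAt ℂ (fun W => v (outerCoord₁ ζ W)) W := by
    refine DifferentiableAt.comp (f := fun W => outerCoord₁ ζ W) W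
      (hv.differentiableAt ((isOpen_re_lt c).mem_nhds ?_))
      (DifferentiableAt.comp (f := fun W : ℂ => (ζ, W)) (g := fun x : ℂ × ℂ => outerCoord₁ x.1 x.2)
        W (differentiableAt_outerCoord₁ h1) hpair)
    have := re_outerCoord₁_lt h1
    exact lt_of_lt_of_le this h2
  have d2 : DifferentiableAt ℂ (fun W => w (outerCoord₂ σ ζ W)) W := by
    refine DifferentiableAt.comp (f := fun W => outerCoord₂ σ ζ W) W
      (hw.differentiableAt ((isOpen_re_lt c).mem_nhds ?_))
      (DifferentiableAt.comp (f := fun W : ℂ => (ζ, W))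
        (g := fun x : ℂ × ℂ => outerCoord₂ σ x.1 x.2)
        W (differentiableAt_outerCoord₂ σ h1) hpair)
    have := re_outerCoord₂_lt (σ := σ) h1
    exact lt_of_lt_of_le this h2
  exact ((d1.mul d2).mul Complex.differentiableAt_exp).differentiableWithinAt

theorem convex_re_strip (x y : ℝ) : Convex ℝ {W : ℂ | x < W.re ∧ W.re + 1 ≤ y} := by
  have h1 : Convex ℝ {W : ℂ | x < W.re} :=
    convex_halfSpace_gt (IsLinearMap.mk (by simp) (by simp)) _
  have h2 : Convex ℝ {W : ℂ | W.re ≤ y - 1} :=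
    convex_halfSpace_le (IsLinearMap.mk (by simp) (by simp)) _
  convert h1.inter h2 using 1
  ext W
  simp [le_sub_iff_add_le]

/-- The inner path is proportional to `exp ζ`, so both arguments make the same turn as `ζ` and the
monodromy acts on each factor. -/
theorem pinchInner_shift {σ c c' : ℝ} (hσ : σ = 1 ∨ σ = -1) (hc : c' + 2 ≤ c)
    {v w v' w' : ℂ → ℂ} (hv : ∀ z : ℂ, z.re < c → v (z + 2 * Real.pi * Complex.I) = v' z)
    (hw : ∀ z : ℂ, z.re < c → w (z + 2 * Real.pi * Complex.I) = w' z) {ζ : ℂ} (hζ : ζ.re < c') :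
    pinchInner σ c' v w (ζ + 2 * Real.pi * Complex.I) = pinchInner σ c' v' w' ζ := by
  obtain ⟨hq, hp⟩ := holPath_inner (c := c) hσ hc
  rw [pinchInner, bilinInt, bilinInt, if_pos hζ, if_pos (by simpa using hζ)]
  refine intervalIntegral.integral_congr fun t ht => ?_
  rw [Set.uIcc_of_le zero_le_one] at ht
  rw [← hv _ (hp ζ hζ t ht).2, ← hw _ (hq ζ hζ t ht).2, Complex.exp_periodic ζ]
  congr 3 <;> ring

/-- A turn of `ζ` keeps the integrand and lifts only the starting point by `2πi`. The path is
rerouted through `log b + 2πi`: its first piece is the old path lifted by one turn, with `v` and `w`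
replaced by their monodromies, and the remainder is the circle. -/
theorem pinchOuter_shift {σ b c : ℝ} (hb : Real.log b + 2 ≤ c) {v w v' w' : ℂ → ℂ}
    (hdv : DifferentiableOn ℂ v {w | w.re < c}) (hdw : DifferentiableOn ℂ w {w | w.re < c})
    (hv : ∀ z : ℂ, z.re < c → v (z + 2 * Real.pi * Complex.I) = v' z)
    (hw : ∀ z : ℂ, z.re < c → w (z + 2 * Real.pi * Complex.I) = w' z) {ζ : ℂ}
    (hζ : ζ.re < Real.log b - 1) :
    pinchOuter σ b (Real.log b - 1) v w (ζ + 2 * Real.pi * Complex.I) =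
      pinchOuter σ b (Real.log b - 1) v' w' ζ + pinchCircle σ b (Real.log b - 1) v w ζ := by
  rw [pinchOuter_eq_segInt hζ, pinchOuter_eq_segInt (by simpa using hζ),
    pinchCircle_eq_segInt hζ]
  have e1 : pinchKernel σ v w (ζ + 2 * Real.pi * Complex.I) = pinchKernel σ v w ζ := by
    funext W
    rw [pinchKernel, pinchKernel, outerCoord₁_shift, outerCoord₂_shift]
  have hre : (2 * (Real.pi : ℂ) * Complex.I).re = 0 := by simp
  have hκ := pinchOffset_re σ
  have hl := log_two_lt_one
  have hl' := log_two_pos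
  rw [e1, ← segInt_add_of_convex (convex_re_strip ζ.re c) (pinchKernel_differentiableOn hdv hdw ζ)
    (a := ζ + 2 * Real.pi * Complex.I + pinchOffset σ)
    (b := Real.log b + 2 * Real.pi * Complex.I) (c := Real.log b)]
  · congr 1
    rw [add_right_comm ζ, ← segInt_comp_add]
    refine segInt_congr fun W hW => ?_
    have hW' : ζ.re < W.re ∧ W.re + 1 ≤ c := by
      refine (convex_re_strip ζ.re c).segment_subset ?_ ?_ hW
      · simp only [Set.mem_ofPred_eq, Complex.add_re, hκ]
        constructor <;> linarith
      · simp only [Set.mem_ofPred_eq, Complex.ofReal_re]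
        constructor <;> linarith
    rw [pinchKernel, pinchKernel, outerCoord₁_shift_right, outerCoord₂_shift_right,
      hv _ ((re_outerCoord₁_lt hW'.1).trans_le hW'.2),
      hw _ ((re_outerCoord₂_lt hW'.1).trans_le hW'.2), Complex.exp_periodic W]
  · simp only [Set.mem_ofPred_eq, Complex.add_re, hκ, hre]
    constructor <;> linarith
  · simp only [Set.mem_ofPred_eq, Complex.add_re, Complex.ofReal_re, hre]
    constructor <;> linarith
  · simp only [Set.mem_ofPred_eq, Complex.ofReal_re]
    constructor <;> linarith

/-- Neither end point depends on `ζ`, so the circle integrals have trivial monodromy and the process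
of adding new integrals stops here. -/
theorem pinchCircle_shift {σ b c' : ℝ} (v w : ℂ → ℂ) {ζ : ℂ} (hζ : ζ.re < c') :
    pinchCircle σ b c' v w (ζ + 2 * Real.pi * Complex.I) = pinchCircle σ b c' v w ζ := by
  rw [pinchCircle_eq_segInt hζ, pinchCircle_eq_segInt (by simpa using hζ)]
  congr 1
  funext W
  rw [pinchKernel, pinchKernel, outerCoord₁_shift, outerCoord₂_shift]

/-! ### Growth of the pinch integrals -/

theorem sectorSmall_of_bound {f : ℂ → ℂ}
    (h : ∀ M : ℝ, ∀ ε > 0, ∃ N : ℝ, ∀ w : ℂ, w.re < N → |w.im| ≤ M →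
      ‖Complex.exp w * f w‖ ≤ ε) : SectorSmall f := by
  intro M
  rw [Metric.tendsto_nhds]
  intro ε hε
  obtain ⟨N, hN⟩ := h M (ε / 2) (by positivity)
  refine eventually_sectorFilter.2 ⟨N, fun w h1 h2 => ?_⟩
  rw [dist_zero_right]
  linarith [hN w h1 h2]

theorem SectorSmall.bound {f : ℂ → ℂ} (h : SectorSmall f) (M : ℝ) {ε : ℝ} (hε : 0 < ε) :
    ∃ N : ℝ, ∀ w : ℂ, w.re < N → |w.im| ≤ M → ‖Complex.exp w * f w‖ ≤ ε := by
  obtain ⟨N, hN⟩ := eventually_sectorFilter.1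
    ((h M).norm.eventually (gt_mem_nhds (by simpa using hε)))
  exact ⟨N, fun w h1 h2 => (hN w h1 h2).le⟩

/-- The weight contributes one factor `exp ζ` and smallness asks for a second one, so each factor of
the integrand receives one. The numbers `1 ± 2σIt` have modulus at least `1`, so `exp ζ` may be
replaced by the exponentials of the two arguments. -/
theorem pinchInner_small {σ c' : ℝ} (hσ : σ = 1 ∨ σ = -1) {v w : ℂ → ℂ}
    (hv : SectorSmall v) (hw : SectorSmall w) :
    SectorSmall (pinchInner σ c' v w) := by
  refine sectorSmall_of_bound fun M ε hε => ?_
  obtain ⟨N, hN⟩ := hv.bound (M + 4) (ε := ε / 2) (by positivity)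
  obtain ⟨N', hN'⟩ := hw.bound (M + 4) one_pos
  refine ⟨min c' (min N N' - 2), fun ζ h1 h2 => ?_⟩
  have hζ : ζ.re < c' := lt_of_lt_of_le h1 (min_le_left _ _)
  have h1' := lt_of_lt_of_le h1 (min_le_right _ _)
  have hNN := min_le_left N N'
  have hNN' := min_le_right N N'
  have hσ1 : |σ| = 1 := by rcases hσ with rfl | rfl <;> simp
  rw [pinchInner, bilinInt, if_pos hζ, ← intervalIntegral.integral_const_mul]
  have key : ∀ t ∈ Set.uIoc (0 : ℝ) 1, ‖Complex.exp ζ *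
      (v (ζ + Complex.log (1 + -(2 * σ * Complex.I * t))) *
        w (ζ + Complex.log (1 + 2 * σ * Complex.I * t)) *
        (-(2 * σ * Complex.I) * Complex.exp ζ))‖ ≤ ε := by
    intro t ht
    rw [Set.uIoc_of_le zero_le_one] at ht
    have ht' : t ∈ Set.Icc (0 : ℝ) 1 := ⟨ht.1.le, ht.2⟩
    obtain ⟨s1, s2⟩ := side_path_mem_slitPlane σ t
    have hx := norm_side_path_le hσ ht'
    set x : ℂ := 2 * σ * Complex.I * t
    have hre1 := re_log_one_add_le hx s1
    have hre2 := re_log_one_add_le (x := -x) (by rwa [norm_neg]) s2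
    set p := ζ + Complex.log (1 + -x) with hp
    set q := ζ + Complex.log (1 + x) with hq
    have b1 : ‖Complex.exp p * v p‖ ≤ ε / 2 := hN p (by rw [hp, Complex.add_re]; linarith) (by
      rw [hp, Complex.add_im]
      exact (abs_add_le _ _).trans (add_le_add h2 (abs_im_log_le _)))
    have b2 : ‖Complex.exp q * w q‖ ≤ 1 := hN' q (by rw [hq, Complex.add_re]; linarith) (by
      rw [hq, Complex.add_im]
      exact (abs_add_le _ _).trans (add_le_add h2 (abs_im_log_le _)))
    have n1 : ∀ y : ℂ, y.re = 0 → 1 ≤ ‖1 + y‖ := fun y hy => by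
      have := Complex.re_le_norm (1 + y)
      simpa [hy] using this
    have hxre : x.re = 0 := by simp [x]
    have e1 : Complex.exp p = Complex.exp ζ * (1 + -x) := by
      rw [hp, Complex.exp_add, Complex.exp_log (Complex.slitPlane_ne_zero s2)]
    have e2 : Complex.exp q = Complex.exp ζ * (1 + x) := by
      rw [hq, Complex.exp_add, Complex.exp_log (Complex.slitPlane_ne_zero s1)]
    have g1 : ‖Complex.exp ζ * v p‖ ≤ ε / 2 := by
      refine le_trans ?_ b1
      rw [e1, norm_mul, norm_mul, norm_mul]
      gcongr
      exact le_mul_of_one_le_right (norm_nonneg _) (n1 _ (by simp [hxre]))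
    have g2 : ‖Complex.exp ζ * w q‖ ≤ 1 := by
      refine le_trans ?_ b2
      rw [e2, norm_mul, norm_mul, norm_mul]
      gcongr
      exact le_mul_of_one_le_right (norm_nonneg _) (n1 _ hxre)
    have g3 : ‖-(2 * (σ : ℂ) * Complex.I)‖ = 2 := by
      simp [hσ1]
    calc _ = ‖-(2 * (σ : ℂ) * Complex.I)‖ * (‖Complex.exp ζ * v p‖ * ‖Complex.exp ζ * w q‖) := by
          rw [← norm_mul, ← norm_mul]; congr 1; ring
      _ ≤ 2 * (ε / 2 * 1) := by
          rw [g3]; gcongr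
      _ = ε := by ring
  simpa using intervalIntegral.norm_integral_le_of_norm_le_const key

/-- The offset `log 2` keeps `exp (ζ - W)` of modulus at most `1/2`, so both `1 ± exp (ζ - W)` have
modulus at least `1/2`; this is the constant `4`. -/
theorem norm_kernel_le {σ : ℝ} (hσ : σ = 1 ∨ σ = -1) {v w : ℂ → ℂ} {ζ W : ℂ}
    (h : ζ.re + Real.log 2 ≤ W.re) : ‖pinchKernel σ v w ζ W‖ ≤
      4 * ‖Complex.exp (outerCoord₁ ζ W) * v (outerCoord₁ ζ W)‖ *
        ‖Complex.exp (outerCoord₂ σ ζ W) * w (outerCoord₂ σ ζ W)‖ * Real.exp (-W.re) := by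
  have hlt : ζ.re < W.re := by linarith [log_two_pos]
  have hx : ‖Complex.exp (ζ - W)‖ ≤ 1 / 2 := by
    rw [Complex.norm_exp, Complex.sub_re]
    calc Real.exp (ζ.re - W.re) ≤ Real.exp (-Real.log 2) := Real.exp_le_exp.2 (by linarith)
      _ = 1 / 2 := by rw [Real.exp_neg, Real.exp_log two_pos]; norm_num
  have n1 : ∀ y : ℂ, ‖y‖ ≤ 1 / 2 → 1 / 2 ≤ ‖1 + y‖ := fun y hy => by
    have := norm_sub_le (1 + y) y
    rw [add_sub_cancel_right, norm_one] at this
    linarith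
  rw [exp_outerCoord₁ hlt, exp_outerCoord₂ hσ hlt, pinchKernel]
  set x := Complex.exp (ζ - W)
  have h1 := n1 x hx
  have h2 := n1 (-x) (by rwa [norm_neg])
  simp only [norm_mul, norm_neg, Complex.norm_exp]
  have h3 : Real.exp W.re * Real.exp (-W.re) = 1 := by rw [← Real.exp_add]; simp
  set a := ‖v (outerCoord₁ ζ W)‖
  set b := ‖w (outerCoord₂ σ ζ W)‖
  have ha : 0 ≤ a := norm_nonneg _
  have hb : 0 ≤ b := norm_nonneg _
  have h4 : (1 : ℝ) ≤ 4 * (‖1 + x‖ * ‖1 + -x‖) := by nlinarith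
  calc a * b * Real.exp W.re ≤ a * b * Real.exp W.re * (4 * (‖1 + x‖ * ‖1 + -x‖)) :=
        le_mul_of_one_le_right (by positivity) h4
    _ = 4 * (Real.exp W.re * ‖1 + x‖ * a) * (Real.exp W.re * ‖1 + -x‖ * b) *
        Real.exp (-W.re) := by
      linear_combination (-4 * a * b * Real.exp W.re * ‖1 + x‖ * ‖1 + -x‖) * h3

/-- On the circle the kernel is bounded independently of `ζ`, so the factor `exp ζ` alone gives the
limit. -/
theorem pinchCircle_small {σ b c : ℝ} (hσ : σ = 1 ∨ σ = -1) {v w : ℂ → ℂ}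
    (hb : Real.log b + 2 ≤ c) (hdv : DifferentiableOn ℂ v {w | w.re < c})
    (hdw : DifferentiableOn ℂ w {w | w.re < c}) (hv : SectorSmall v) (hw : SectorSmall w) :
    SectorSmall (pinchCircle σ b (Real.log b - 1) v w) := by
  -- The circle has imaginary parts of size at most `8` and the coordinates add at most `8`, so `20`
  -- is ample.
  obtain ⟨C, hC0, hC⟩ := hv.exists_bound hdv (c'' := Real.log b + 1) (by linarith) 20
  obtain ⟨C', hC0', hC'⟩ := hw.exists_bound hdw (c'' := Real.log b + 1) (by linarith) 20
  set B : ℝ := 4 * C * C' * Real.exp (-Real.log b) *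
    ‖(Real.log b : ℂ) - (Real.log b + 2 * Real.pi * Complex.I)‖ with hB
  have hB0 : 0 ≤ B := by positivity
  refine sectorSmall_of_bound fun M ε hε => ?_
  have hlim : Tendsto (fun x : ℝ => Real.exp x * B) atBot (𝓝 (0 * B)) :=
    Real.tendsto_exp_atBot.mul_const B
  rw [zero_mul] at hlim
  obtain ⟨N, hN⟩ := eventually_atBot.1 (hlim.eventually (gt_mem_nhds hε))
  refine ⟨min N (Real.log b - 1), fun ζ h1 h2 => ?_⟩
  have hζ : ζ.re < Real.log b - 1 := lt_of_lt_of_le h1 (min_le_right _ _)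
  have hcirc : ‖pinchCircle σ b (Real.log b - 1) v w ζ‖ ≤ B := by
    rw [pinchCircle_eq_segInt hζ, segInt, norm_mul, hB, mul_comm]
    refine mul_le_mul_of_nonneg_right ?_ (norm_nonneg _)
    have : ∀ t ∈ Set.uIoc (0 : ℝ) 1, ‖pinchKernel σ v w ζ (circlePath b t)‖ ≤
        4 * C * C' * Real.exp (-Real.log b) := by
      intro t ht
      rw [Set.uIoc_of_le zero_le_one] at ht
      have hre := circlePath_re b t
      have him := circlePath_im b t
      have hlt : ζ.re < (circlePath b t).re := by rw [hre]; linarith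
      have him' : |(circlePath b t).im| ≤ 8 := by
        rw [him, abs_le]
        have := Real.pi_lt_four
        have := Real.pi_pos
        constructor <;> nlinarith [ht.1, ht.2]
      refine (norm_kernel_le hσ (by rw [hre]; linarith [log_two_lt_one])).trans ?_
      rw [hre]
      have h3 := re_outerCoord₁_lt hlt
      have h4 := re_outerCoord₂_lt (σ := σ) hlt
      have h5 := abs_im_outerCoord₁_le ζ (circlePath b t)
      have h6 := abs_im_outerCoord₂_le hσ ζ (circlePath b t)
      gcongr
      · exact hC _ (by linarith) (by linarith)
      · exact hC' _ (by linarith) (by linarith)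
    simpa [circlePath] using intervalIntegral.norm_integral_le_of_norm_le_const this
  rw [norm_mul, Complex.norm_exp]
  calc Real.exp ζ.re * ‖pinchCircle σ b (Real.log b - 1) v w ζ‖ ≤ Real.exp ζ.re * B := by gcongr
    _ ≤ ε := (hN ζ.re (h1.le.trans (min_le_left _ _))).le

theorem integral_exp_neg_mul_le {D : ℝ} (hD : 0 < D) :
    ∫ t in (0 : ℝ)..1, Real.exp (-(t * D)) ≤ 1 / D := by
  have h : ∀ t : ℝ, HasDerivAt (fun t => -(Real.exp (-(t * D)) / D)) (Real.exp (-(t * D))) t := by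
    intro t
    have h1 : HasDerivAt (fun t : ℝ => t * -D) (-D) t := by
      simpa using (hasDerivAt_id t).mul_const (-D)
    have h2 := h1.exp.mul_const (-(1 / D))
    refine (h2.congr_deriv ?_).congr_of_eventuallyEq (Eventually.of_forall fun s => ?_)
    · rw [mul_assoc, show -D * -(1 / D) = 1 by field_simp, mul_one, mul_neg]
    · simp only
      rw [mul_neg, mul_neg, mul_one_div]
  rw [intervalIntegral.integral_eq_sub_of_hasDerivAt (fun t _ => h t)
    (by apply Continuous.intervalIntegrable; fun_prop)]
  have : 0 < Real.exp (-(1 * D)) / D := by positivity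
  simp only [zero_mul, neg_zero, Real.exp_zero]
  linarith

theorem tendsto_sub_mul_exp_atBot (A : ℝ) :
    Tendsto (fun x : ℝ => (A - x) * Real.exp x) atBot (𝓝 0) := by
  have h1 := (Real.tendsto_pow_mul_exp_neg_atTop_nhds_zero 1).comp tendsto_neg_atBot_atTop
  have h2 : Tendsto (fun x : ℝ => A * Real.exp x) atBot (𝓝 (A * 0)) :=
    Real.tendsto_exp_atBot.const_mul A
  have := h2.add h1
  simp only [mul_zero, add_zero] at this
  refine this.congr fun x => ?_
  simp only [Function.comp, pow_one, neg_neg]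
  ring

/-- The kernel bound grows like `exp (-W.re)`, whose integral over the path is of order `exp
(-ζ.re)`: the factor `exp ζ` only just compensates for it. The gain is the smallness of `v` where
`W` is far left. The remaining part of the path contributes a bounded kernel times its length, which
is linear in `ζ.re` and is beaten by `exp ζ`. -/
theorem pinchOuter_small {σ b c : ℝ} (hσ : σ = 1 ∨ σ = -1) {v w : ℂ → ℂ}
    (hb : Real.log b + 2 ≤ c) (hdv : DifferentiableOn ℂ v {w | w.re < c})
    (hdw : DifferentiableOn ℂ w {w | w.re < c}) (hv : SectorSmall v) (hw : SectorSmall w) :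
    SectorSmall (pinchOuter σ b (Real.log b - 1) v w) := by
  refine sectorSmall_of_bound fun M₀ ε hε => ?_
  set M := |M₀| with hM
  have hM0 : 0 ≤ M := abs_nonneg _
  obtain ⟨C, hC0, hC⟩ := hv.exists_bound hdv (c'' := Real.log b + 1) (by linarith) (M + 12)
  obtain ⟨C', hC0', hC'⟩ := hw.exists_bound hdw (c'' := Real.log b + 1) (by linarith) (M + 12)
  -- Chosen so that `4 * ε' * (C' + 1) * (M + 3) = ε / 2`; writing `C' + 1` avoids a vanishing
  -- denominator, and `M + 3` will bound the ratio of the path's length to its horizontal extent.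
  set ε' : ℝ := ε / (8 * (C' + 1) * (M + 3)) with hε'
  have hε'0 : 0 < ε' := by positivity
  obtain ⟨N, hN⟩ := hv.bound (M + 12) hε'0
  set B : ℝ := 4 * C * C' * Real.exp (1 - N) with hB
  have hB0 : 0 ≤ B := by positivity
  set A : ℝ := Real.log b - Real.log 2 + M + 2 with hA
  have hlim := (tendsto_sub_mul_exp_atBot A).mul_const B
  rw [zero_mul] at hlim
  obtain ⟨N', hN'⟩ := eventually_atBot.1 (hlim.eventually (gt_mem_nhds (half_pos hε)))
  refine ⟨min N' (Real.log b - 2), fun ζ h1 h2 => ?_⟩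
  have hζ : ζ.re < Real.log b - 1 := by linarith [lt_of_lt_of_le h1 (min_le_right _ _)]
  have h2' : |ζ.im| ≤ M := h2.trans (le_abs_self _)
  set D : ℝ := Real.log b - (ζ.re + Real.log 2) with hD
  have hl := log_two_lt_one
  have hD1 : 1 ≤ D := by linarith [lt_of_lt_of_le h1 (min_le_right _ _)]
  set L : ℝ := ‖(Real.log b : ℂ) - (ζ + pinchOffset σ)‖ with hL
  have hσim : |ζ.im + (pinchOffset σ).im| ≤ M + 2 := by
    have := abs_add_le ζ.im (pinchOffset σ).im
    have h3 : |(pinchOffset σ).im| ≤ 2 := by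
      have := Real.pi_lt_four
      have := Real.pi_pos
      rw [pinchOffset_im, abs_le]
      rcases hσ with rfl | rfl <;> constructor <;> linarith
    linarith
  have hLD : L ≤ D + (M + 2) := by
    refine (Complex.norm_le_abs_re_add_abs_im _).trans (add_le_add (le_of_eq ?_) ?_)
    · rw [Complex.sub_re, Complex.ofReal_re, Complex.add_re, pinchOffset_re, ← hD,
        abs_of_nonneg (by linarith)]
    · rw [Complex.sub_im, Complex.ofReal_im, Complex.add_im, zero_sub, abs_neg]
      exact hσim
  have hL0 : 0 ≤ L := norm_nonneg _
  have key : ∀ t ∈ Set.Icc (0 : ℝ) 1, ‖pinchKernel σ v w ζ (outerPath σ b ζ t)‖ * Real.exp ζ.re ≤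
      4 * ε' * C' * Real.exp (-(t * D)) + B * Real.exp ζ.re := by
    intro t ht
    set W := outerPath σ b ζ t with hW
    obtain ⟨r1, r2⟩ := outerPath_re_bounds (σ := σ) hζ ht
    have hre : W.re = ζ.re + Real.log 2 + t * D := outerPath_re σ b ζ t
    have hlt : ζ.re < W.re := by linarith [log_two_pos]
    have him : |W.im| ≤ M + 2 := by
      have : W.im = (1 - t) * (ζ.im + (pinchOffset σ).im) := by
        rw [hW, outerPath, Complex.add_im, Complex.im_ofReal_mul, Complex.sub_im, Complex.ofReal_im,
          Complex.add_im]
        ring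
      rw [this, abs_mul, abs_of_nonneg (sub_nonneg.2 ht.2)]
      exact (mul_le_of_le_one_left (abs_nonneg _) (by linarith [ht.1])).trans hσim
    have h3 := re_outerCoord₁_lt hlt
    have h4 := re_outerCoord₂_lt (σ := σ) hlt
    have h5 := abs_im_outerCoord₁_le ζ W
    have h6 := abs_im_outerCoord₂_le hσ ζ W
    have hker := norm_kernel_le (v := v) (w := w) hσ r1
    have hw1 := hC' (outerCoord₂ σ ζ W) (by linarith) (by linarith)
    -- Either the first argument is so far left that `v` contributes `ε'`, or `W.re > N - 1` and
    -- `exp (-W.re)` is bounded.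
    by_cases hcase : (outerCoord₁ ζ W).re < N
    · have hv1 := hN _ hcase (by linarith)
      have e1 : Real.exp (-W.re) * Real.exp ζ.re ≤ Real.exp (-(t * D)) := by
        rw [← Real.exp_add]
        exact Real.exp_le_exp.2 (by linarith [log_two_pos])
      have : ‖pinchKernel σ v w ζ W‖ * Real.exp ζ.re ≤ 4 * ε' * C' * Real.exp (-(t * D)) := by
        calc _ ≤ 4 * ε' * C' * Real.exp (-W.re) * Real.exp ζ.re := by
              refine mul_le_mul_of_nonneg_right (hker.trans ?_) (Real.exp_pos _).le
              gcongr
          _ = 4 * ε' * C' * (Real.exp (-W.re) * Real.exp ζ.re) := by ring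
          _ ≤ _ := by gcongr
      have : 0 ≤ B * Real.exp ζ.re := by positivity
      linarith
    · have hv1 := hC (outerCoord₁ ζ W) (by linarith) (by linarith)
      have e1 : Real.exp (-W.re) ≤ Real.exp (1 - N) := Real.exp_le_exp.2 (by linarith)
      have : ‖pinchKernel σ v w ζ W‖ * Real.exp ζ.re ≤ B * Real.exp ζ.re := by
        refine mul_le_mul_of_nonneg_right (hker.trans ?_) (Real.exp_pos _).le
        rw [hB]
        gcongr
      have : 0 ≤ 4 * ε' * C' * Real.exp (-(t * D)) := by positivity
      linarith
  rw [pinchOuter_eq_segInt hζ, segInt, norm_mul, norm_mul, Complex.norm_exp, ← hL]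
  have hint : Real.exp ζ.re *
      ‖∫ t in (0 : ℝ)..1, pinchKernel σ v w ζ (ζ + pinchOffset σ + t * (Real.log b -
        (ζ + pinchOffset σ)))‖ ≤ 4 * ε' * C' * (1 / D) + B * Real.exp ζ.re := by
    rw [← abs_of_pos (Real.exp_pos ζ.re), ← Real.norm_eq_abs, ← norm_smul,
      ← intervalIntegral.integral_smul]
    refine (intervalIntegral.norm_integral_le_of_norm_le
      (g := fun t => 4 * ε' * C' * Real.exp (-(t * D)) + B * Real.exp ζ.re) zero_le_one
      (Eventually.of_forall fun t ht => ?_) (by apply Continuous.intervalIntegrable; fun_prop)).trans ?_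
    · rw [norm_smul, Real.norm_eq_abs, abs_of_pos (Real.exp_pos ζ.re), mul_comm]
      exact key t ⟨ht.1.le, ht.2⟩
    · rw [intervalIntegral.integral_add (by apply Continuous.intervalIntegrable; fun_prop)
        (by apply Continuous.intervalIntegrable; fun_prop), intervalIntegral.integral_const_mul]
      have := integral_exp_neg_mul_le (D := D) (by linarith)
      simp only [intervalIntegral.integral_const, sub_zero, one_smul]
      rw [Real.norm_eq_abs, abs_of_pos (Real.exp_pos ζ.re)]
      gcongr
  have hLD' : L * (1 / D) ≤ M + 3 := by
    rw [mul_one_div, div_le_iff₀ (by linarith)]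
    nlinarith
  have hA' : L ≤ A - ζ.re := by rw [hA]; linarith
  have fin1 : 4 * ε' * C' * (M + 3) ≤ ε / 2 := by
    have : 4 * ε' * (C' + 1) * (M + 3) = ε / 2 := by
      rw [hε']; field_simp; norm_num
    have h7 : 4 * ε' * C' * (M + 3) ≤ 4 * ε' * (C' + 1) * (M + 3) := by gcongr; linarith
    linarith
  have fin2 : L * (B * Real.exp ζ.re) ≤ ε / 2 := by
    refine le_trans ?_ (hN' ζ.re (h1.le.trans (min_le_left _ _))).le
    calc L * (B * Real.exp ζ.re) ≤ (A - ζ.re) * (B * Real.exp ζ.re) := by gcongr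
      _ = _ := by ring
  calc _ = L * (Real.exp ζ.re * ‖∫ t in (0 : ℝ)..1, pinchKernel σ v w ζ
        (ζ + pinchOffset σ + t * (Real.log b - (ζ + pinchOffset σ)))‖) := by ring
    _ ≤ L * (4 * ε' * C' * (1 / D) + B * Real.exp ζ.re) := by gcongr
    _ = 4 * ε' * C' * (L * (1 / D)) + L * (B * Real.exp ζ.re) := by ring
    _ ≤ 4 * ε' * C' * (M + 3) + L * (B * Real.exp ζ.re) := by gcongr
    _ ≤ ε := by linarith

/-! ### The pinch -/

theorem segInt_ofReal (f : ℂ → ℂ) (a b : ℝ) : segInt f a b = ∫ x in a..b, f x := by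
  have h := intervalIntegral.smul_integral_comp_add_mul (a := 0) (b := 1)
    (fun x : ℝ => f x) (b - a) a
  simp only [mul_zero, add_zero, mul_one, add_sub_cancel] at h
  rw [← h, segInt, Complex.real_smul]
  congr 1
  · push_cast; ring
  · congr 1
    funext t
    congr 1
    push_cast
    ring

/-- Two holomorphic functions that agree on a horizontal segment agree. -/
theorem eqOn_of_eq_horizontal {f g : ℂ → ℂ} {U : Set ℂ} (hU : IsOpen U) (hU' : Convex ℝ U)
    (hf : DifferentiableOn ℂ f U) (hg : DifferentiableOn ℂ g U) {z₀ : ℂ} (hz₀ : z₀ ∈ U)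
    (h : ∀ᶠ s : ℝ in 𝓝 0, f (z₀ + s) = g (z₀ + s)) : Set.EqOn f g U := by
  refine (hf.analyticOnNhd hU).eqOn_of_preconnected_of_frequently_eq (hg.analyticOnNhd hU)
    hU'.isPreconnected hz₀ ?_
  have hl : Tendsto (fun s : ℝ => z₀ + s) (𝓝[≠] 0) (𝓝[≠] z₀) := by
    refine tendsto_nhdsWithin_iff.2 ⟨?_, ?_⟩
    · have : Continuous fun s : ℝ => z₀ + s := by fun_prop
      simpa using (this.tendsto 0).mono_left nhdsWithin_le_nhds
    · filter_upwards [self_mem_nhdsWithin] with s hs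
      simpa using hs
  have h2 : ∃ᶠ s : ℝ in 𝓝[≠] 0, f (z₀ + s) = g (z₀ + s) :=
    (h.filter_mono nhdsWithin_le_nhds).frequently
  exact hl.frequently h2

theorem analyticAt_of_side {σ c : ℝ} (hσ : σ = 1 ∨ σ = -1) {A φ : ℂ → ℂ}
    (hφ : DifferentiableOn ℂ φ {w | w.re < c})
    (h : ∀ w : ℂ, w.re < c → 0 < σ * w.im → σ * w.im < Real.pi → φ w = A (Complex.exp w))
    {x : ℂ} (hx : ‖x‖ < Real.exp c) (hs : 0 < σ * x.im) : AnalyticAt ℂ A x := by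
  obtain ⟨E, hE, hAE⟩ := exists_slit_extension hσ hφ h
  have h1 : ∀ᶠ y in 𝓝 x, ‖y‖ < Real.exp c :=
    (isOpen_lt continuous_norm continuous_const).mem_nhds hx
  have h2 : ∀ᶠ y : ℂ in 𝓝 x, 0 < σ * y.im :=
    (isOpen_lt continuous_const (by fun_prop : Continuous fun y : ℂ => σ * y.im)).mem_nhds hs
  refine (hE x hx (Or.inl hs)).congr ?_
  filter_upwards [h1, h2] with y h1 h2
  exact (hAE y h1 h2).symm

/-- On this line `d = σ * I * e` is purely imaginary, and both parts of the path lie on the real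
segment from `0` to `b`, meeting at `2 * e`. There the logarithmic coordinates have their angles in
the anchored range, so `φ` and `ψ` may be replaced by `A` and `B`. The identity theorem later
extends the equality to the whole sheet. -/
theorem conv_exp_line {σ b c : ℝ} (hσ : σ = 1 ∨ σ = -1) (hb0 : 0 < b) (hb : Real.log b + 2 ≤ c)
    {A B φ ψ : ℂ → ℂ}
    (hφ : DifferentiableOn ℂ φ {w | w.re < c}) (hψ : DifferentiableOn ℂ ψ {w | w.re < c})
    (hA : ∀ w : ℂ, w.re < c → 0 < σ * w.im → σ * w.im < Real.pi → φ w = A (Complex.exp w))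
    (hB : ∀ w : ℂ, w.re < c → 0 < σ * w.im → σ * w.im < Real.pi → ψ w = B (Complex.exp w))
    {x : ℝ} (hx : x < Real.log b - 1) :
    pinchInner σ (Real.log b - 1) φ ψ (x + σ * (Real.pi / 2) * Complex.I) +
      pinchOuter σ b (Real.log b - 1) φ ψ (x + σ * (Real.pi / 2) * Complex.I) =
    conv A B 0 b (Complex.exp (x + σ * (Real.pi / 2) * Complex.I)) := by
  obtain ⟨ζ, hζdef⟩ : ∃ ζ : ℂ, ζ = x + σ * (Real.pi / 2) * Complex.I := ⟨_, rfl⟩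
  rw [← hζdef]
  have hσσ : σ * σ = 1 := by rcases hσ with rfl | rfl <;> norm_num
  have hσC : (σ : ℂ) * σ = 1 := by exact_mod_cast hσσ
  have hmulI : (σ : ℂ) * (Real.pi / 2) * Complex.I = ((σ * (Real.pi / 2) : ℝ) : ℂ) * Complex.I := by
    push_cast; ring
  have hζre : ζ.re = x := by
    rw [hζdef, hmulI, Complex.add_re, Complex.re_ofReal_mul]; simp
  have hζim : ζ.im = σ * (Real.pi / 2) := by
    rw [hζdef, hmulI, Complex.add_im, Complex.im_ofReal_mul]; simp
  have hσim : σ * ζ.im = Real.pi / 2 := by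
    rw [hζim, ← mul_assoc, hσσ, one_mul]
  have hζ : ζ.re < Real.log b - 1 := by rw [hζre]; exact hx
  obtain ⟨e, he, hex⟩ : ∃ e : ℝ, 0 < e ∧ Real.log e = x := ⟨_, Real.exp_pos x, Real.log_exp x⟩
  have hee : Real.exp x = e := by rw [← hex, Real.exp_log he]
  have hexp : Complex.exp ζ = σ * Complex.I * e := by
    have h1 : Complex.exp (σ * (Real.pi / 2) * Complex.I) = σ * Complex.I := by
      rcases hσ with rfl | rfl
      · rw [Complex.ofReal_one, one_mul, Complex.exp_mul_I]
        simp
      · rw [show (((-1 : ℝ) : ℂ) * (Real.pi / 2)) = -(Real.pi / 2) by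
          push_cast; ring, Complex.exp_mul_I, Complex.cos_neg, Complex.sin_neg]
        simp
    rw [hζdef, Complex.exp_add, h1, ← Complex.ofReal_exp, hee]
    ring
  have hbe : 2 * e < b := by
    have : Real.log (2 * e) < Real.log b := by
      rw [Real.log_mul two_ne_zero he.ne', hex]
      linarith [log_two_lt_one]
    exact (Real.log_lt_log_iff (by positivity) hb0).1 this
  have hpi := Real.pi_pos
  -- inner part
  have hin : pinchInner σ (Real.log b - 1) φ ψ ζ = conv A B 0 ((2 * e : ℝ) : ℂ) (Complex.exp ζ) := by
    obtain ⟨hq, hp⟩ := holPath_inner (c := c) (c' := Real.log b - 1) hσ (by linarith)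
    rw [pinchInner, bilinInt, if_pos hζ, conv, segInt, ← intervalIntegral.integral_const_mul]
    refine intervalIntegral.integral_congr fun t ht => ?_
    rw [Set.uIcc_of_le zero_le_one] at ht
    obtain ⟨s1, s2⟩ := side_path_mem_slitPlane σ t
    have harg : ∀ z : ℂ, z.re = 0 → |(Complex.log (1 + z)).im| < Real.pi / 2 := fun z hz => by
      rw [Complex.log_im]
      exact Complex.abs_arg_lt_pi_div_two_iff.2 (Or.inl (by simp [hz]))
    have hside : ∀ z : ℂ, z.re = 0 → 0 < σ * (ζ + Complex.log (1 + z)).im ∧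
        σ * (ζ + Complex.log (1 + z)).im < Real.pi := fun z hz => by
      have h := abs_lt.1 (harg z hz)
      have h2 : |σ * (Complex.log (1 + z)).im| < Real.pi / 2 := by
        rw [abs_mul, show |σ| = 1 by rcases hσ with rfl | rfl <;> simp, one_mul]
        exact harg z hz
      rw [abs_lt] at h2
      rw [Complex.add_im, mul_add, hσim]
      constructor <;> linarith
    have h1 := hside (-(2 * σ * Complex.I * t)) (by simp)
    have h2 := hside (2 * σ * Complex.I * t) (by simp)
    rw [hA _ (hp ζ hζ t ht).2 h1.1 h1.2, hB _ (hq ζ hζ t ht).2 h2.1 h2.2, Complex.exp_add,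
      Complex.exp_add ζ, Complex.exp_log (Complex.slitPlane_ne_zero s1),
      Complex.exp_log (Complex.slitPlane_ne_zero s2), hexp]
    have a1 : (σ : ℂ) * Complex.I * e * (1 + -(2 * σ * Complex.I * t)) =
        0 + t * (((2 * e : ℝ) : ℂ) - 0) + σ * Complex.I * e := by
      push_cast
      linear_combination (-2 * e * t * Complex.I ^ 2) * hσC - 2 * e * t * Complex.I_sq
    have a2 : (σ : ℂ) * Complex.I * e * (1 + 2 * σ * Complex.I * t) =
        σ * Complex.I * e - (0 + t * (((2 * e : ℝ) : ℂ) - 0)) := by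
      push_cast
      linear_combination (2 * e * t * Complex.I ^ 2) * hσC + 2 * e * t * Complex.I_sq
    rw [a1, a2]
    push_cast
    linear_combination (A (0 + t * (2 * e - 0) + σ * Complex.I * e) *
      B (σ * Complex.I * e - (0 + t * (2 * e - 0)))) * ((-2 * e * Complex.I ^ 2) * hσC -
        2 * e * Complex.I_sq)
  -- outer part
  have hout : pinchOuter σ b (Real.log b - 1) φ ψ ζ =
      conv A B ((2 * e : ℝ) : ℂ) b (Complex.exp ζ) := by
    have hst : ζ + pinchOffset σ = ((Real.log (2 * e) : ℝ) : ℂ) := by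
      rw [Real.log_mul two_ne_zero he.ne', hex, hζdef, pinchOffset]
      push_cast
      ring
    rw [pinchOuter_eq_segInt hζ, hst, segInt_ofReal, conv, segInt_ofReal]
    have h2e : Real.log (2 * e) ≤ Real.log b := Real.log_le_log (by positivity) hbe.le
    have hre1 : ∀ y ∈ Set.Icc (Real.log (2 * e)) (Real.log b), x < y := fun y hy => by
      have := hy.1
      rw [Real.log_mul two_ne_zero he.ne', hex] at this
      linarith [log_two_pos]
    -- The substitution `x = exp y`; the angles of `1 ± exp (ζ - y)` show that both coordinates are
    -- on the anchored sheet.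
    have key : ∀ y ∈ Set.uIcc (Real.log (2 * e)) (Real.log b), pinchKernel σ φ ψ ζ y =
        Real.exp y • (((fun x : ℝ => A (x + Complex.exp ζ) * B (Complex.exp ζ - x)) ∘
          Real.exp) y) := by
      intro y hy
      rw [Set.uIcc_of_le h2e] at hy
      have hxy := hre1 y hy
      have hlt : ζ.re < (y : ℂ).re := by rw [hζre, Complex.ofReal_re]; exact hxy
      have hlt' := norm_exp_sub_lt hlt
      have himx : (Complex.exp (ζ - y)).im = σ * Real.exp (x - y) := by
        rw [Complex.exp_sub, hexp, ← Complex.ofReal_exp, ← hee, Real.exp_sub]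
        rw [show (σ : ℂ) * Complex.I * (Real.exp x : ℝ) / (Real.exp y : ℝ) =
          ((σ * (Real.exp x / Real.exp y) : ℝ) : ℂ) * Complex.I by push_cast; ring,
          Complex.im_ofReal_mul, Complex.I_im, mul_one]
      have hs1 : 0 < σ * (1 + Complex.exp (ζ - y)).im := by
        rw [Complex.add_im, himx, Complex.one_im, zero_add, ← mul_assoc, hσσ, one_mul]
        exact Real.exp_pos _
      have hs2 : 0 < -σ * (1 + -Complex.exp (ζ - y)).im := by
        rw [Complex.add_im, Complex.neg_im, himx, Complex.one_im, zero_add, neg_mul_neg, ← mul_assoc,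
          hσσ, one_mul]
        exact Real.exp_pos _
      have hl1 := side_log hσ hs1
      have hl2 := side_log (σ := -σ) (by rcases hσ with rfl | rfl <;> simp) hs2
      have him1 : (outerCoord₁ ζ y).im = (Complex.log (1 + Complex.exp (ζ - y))).im := by
        rw [outerCoord₁, Complex.add_im, Complex.ofReal_im, zero_add]
      have him2 : σ * (outerCoord₂ σ ζ y).im =
          Real.pi + σ * (Complex.log (1 + -Complex.exp (ζ - y))).im := by
        have : ((σ : ℂ) * Real.pi * Complex.I).im = σ * Real.pi := by simp
        rw [outerCoord₂, Complex.add_im, Complex.add_im, Complex.ofReal_im, this, zero_add, mul_add,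
          ← mul_assoc, hσσ, one_mul]
      have hr1 := re_outerCoord₁_lt hlt
      have hr2 := re_outerCoord₂_lt (σ := σ) hlt
      rw [Complex.ofReal_re] at hr1 hr2
      have hyb := hy.2
      have hyexp : ((Real.exp y : ℝ) : ℂ) * Complex.exp (ζ - y) = Complex.exp ζ := by
        rw [Complex.ofReal_exp, ← Complex.exp_add]; congr 1; ring
      rw [pinchKernel, hA _ (by linarith) (by rw [him1]; exact hl1.1) (by rw [him1]; exact hl1.2),
        hB _ (by linarith) (by rw [him2]; linarith [hl2.2]) (by rw [him2]; linarith [hl2.1]),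
        exp_outerCoord₁ hlt, exp_outerCoord₂ hσ hlt, Complex.real_smul, mul_comm,
        Function.comp, ← Complex.ofReal_exp y]
      congr 3
      · rw [mul_add, hyexp, mul_one]
      · rw [mul_add, mul_neg, hyexp, mul_one]; ring
    rw [intervalIntegral.integral_congr key]
    rw [intervalIntegral.integral_deriv_smul_comp_of_deriv_nonneg
      Real.continuous_exp.continuousOn (fun y _ => Real.hasDerivAt_exp y)
      (fun y _ => (Real.exp_pos y).le), Real.exp_log (by positivity), Real.exp_log hb0]
  -- From `exp 2 ≥ 3`: points `x` of modulus below `2 * b`, shifted by `exp ζ` of modulus below `b`,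
  -- stay in the domain of the germs.
  have hbc : 3 * b ≤ Real.exp c := by
    have h1 := Real.add_one_le_exp 2
    have h2 : Real.exp (Real.log b + 2) ≤ Real.exp c := Real.exp_le_exp.2 hb
    rw [Real.exp_add, Real.exp_log hb0] at h2
    nlinarith
  have hen : ‖Complex.exp ζ‖ = e := by rw [Complex.norm_exp, hζre, hee]
  have heim : σ * (Complex.exp ζ).im = e := by
    rw [hexp, mul_comm, show (σ : ℂ) * Complex.I * e = ((σ * e : ℝ) : ℂ) * Complex.I by
      push_cast; ring, Complex.im_ofReal_mul, Complex.I_im]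
    linear_combination e * hσσ
  -- For `|x.im| < e` both `x + d` and `d - x` lie on the side `σ`.
  have hconv : Convex ℝ (({x : ℂ | -e < σ * x.im} ∩ {x : ℂ | σ * x.im < e}) ∩
      Metric.ball 0 (2 * b)) := by
    refine (Convex.inter ?_ ?_).inter (convex_ball _ _)
    · exact convex_halfSpace_gt (IsLinearMap.mk (by simp [mul_add]) (by simp [mul_left_comm])) _
    · exact convex_halfSpace_lt (IsLinearMap.mk (by simp [mul_add]) (by simp [mul_left_comm])) _
  rw [hin, hout]
  refine conv_add_of_convex hconv (fun x hx => ?_) (fun x hx => ?_) ?_ ?_ ?_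
  · have h1 : ‖x‖ < 2 * b := by simpa using hx.2
    have h2 : -e < σ * x.im := hx.1.1
    refine analyticAt_of_side hσ hφ hA ?_ ?_
    · linarith [norm_add_le x (Complex.exp ζ)]
    · rw [Complex.add_im, mul_add, heim]; linarith
  · have h1 : ‖x‖ < 2 * b := by simpa using hx.2
    have h2 : σ * x.im < e := hx.1.2
    refine analyticAt_of_side hσ hψ hB ?_ ?_
    · linarith [norm_sub_le (Complex.exp ζ) x]
    · rw [Complex.sub_im, mul_sub, heim]; linarith
  · simp [he, hb0]
  · have : |e| = e := abs_of_pos he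
    simp [he, this]
    linarith
  · have : |b| = b := abs_of_pos hb0
    simp [he, this]
    linarith

/-- The heart of the proof. The inner, outer and circle integrals over all `v ∈ V` and `w ∈ W` span
a finite-dimensional space, because they are bilinear. One turn sends inner to inner, outer to outer
plus circle, and fixes circle, so the span is stable. -/
theorem LocGerm.conv_half {K : Subfield ℂ} {σ : ℝ} (hσ : σ = 1 ∨ σ = -1) {A B : ℂ → ℂ}
    (hA : LocGerm K σ A) (hB : LocGerm K σ B) :
    ∃ ε > 0, ∀ b : ℝ, 0 < b → b < ε → LocGerm K σ (conv A B 0 b) := by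
  obtain ⟨c₁, V, φ, hV, hφ, hA⟩ := hA
  obtain ⟨c₂, W, ψ, hW, hψ, hB⟩ := hB
  set c := min c₁ c₂ with hc
  replace hV := hV.mono (min_le_left c₁ c₂)
  replace hW := hW.mono (min_le_right c₁ c₂)
  replace hA := fun w (hw : w.re < c) => hA w (lt_of_lt_of_le hw (min_le_left c₁ c₂))
  replace hB := fun w (hw : w.re < c) => hB w (lt_of_lt_of_le hw (min_le_right c₁ c₂))
  rw [← hc] at hV hW
  -- Makes `log b + 2 ≤ c`, the room needed by the path coordinates.
  refine ⟨Real.exp (c - 2), Real.exp_pos _, fun b hb0 hbε => ?_⟩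
  have hb : Real.log b + 2 ≤ c := by
    have := (Real.log_lt_iff_lt_exp hb0).2 hbε
    linarith
  set c' := Real.log b - 1 with hc'
  obtain ⟨hiq, hip⟩ := holPath_inner (c := c) (c' := c') hσ (by linarith)
  obtain ⟨hop, hoq⟩ := holPath_outer (σ := σ) hb
  obtain ⟨hcp, hcq⟩ := holPath_circle (σ := σ) hb
  have him := fun (ζ : ℂ) (_ : ζ.re < c') (t : ℝ) (_ : t ∈ Set.Icc (0 : ℝ) 1) =>
    differentiableAt_innerWeight σ (ζ, (t : ℂ))
  have hom := fun (ζ : ℂ) (_ : ζ.re < c') (t : ℝ) (_ : t ∈ Set.Icc (0 : ℝ) 1) =>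
    differentiableAt_outerWeight σ b (ζ, (t : ℂ))
  have hcm := fun (ζ : ℂ) (_ : ζ.re < c') (t : ℝ) (_ : t ∈ Set.Icc (0 : ℝ) 1) =>
    differentiableAt_circleWeight b (ζ, (t : ℂ))
  let s₁ : Set (ℂ → ℂ) := {f | ∃ v ∈ V, ∃ w ∈ W, f = pinchInner σ c' v w}
  let s₂ : Set (ℂ → ℂ) := {f | ∃ v ∈ V, ∃ w ∈ W, f = pinchOuter σ b c' v w}
  let s₃ : Set (ℂ → ℂ) := {f | ∃ v ∈ V, ∃ w ∈ W, f = pinchCircle σ b c' v w}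
  have hs1 : ∀ v ∈ V, ∀ w ∈ W, pinchInner σ c' v w ∈ Submodule.span K (s₁ ∪ s₂ ∪ s₃) :=
    fun v hv w hw => Submodule.subset_span (Or.inl (Or.inl ⟨v, hv, w, hw, rfl⟩))
  have hs2 : ∀ v ∈ V, ∀ w ∈ W, pinchOuter σ b c' v w ∈ Submodule.span K (s₁ ∪ s₂ ∪ s₃) :=
    fun v hv w hw => Submodule.subset_span (Or.inl (Or.inr ⟨v, hv, w, hw, rfl⟩))
  have hs3 : ∀ v ∈ V, ∀ w ∈ W, pinchCircle σ b c' v w ∈ Submodule.span K (s₁ ∪ s₂ ∪ s₃) :=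
    fun v hv w hw => Submodule.subset_span (Or.inr ⟨v, hv, w, hw, rfl⟩)
  refine ⟨c', _, pinchInner σ c' φ ψ + pinchOuter σ b c' φ ψ,
    LocalSpace.of_span (K := K) (s := s₁ ∪ s₂ ∪ s₃) ?_ ?_ ?_ ?_,
    Submodule.add_mem _ (hs1 φ hφ ψ hψ) (hs2 φ hφ ψ hψ), ?_⟩
  · rw [Submodule.span_union, Submodule.span_union]
    exact ((fg_span_bilinInt hV hW hip hiq him).sup (fg_span_bilinInt hV hW hop hoq hom)).sup
      (fg_span_bilinInt hV hW hcp hcq hcm)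
  · rintro f ((⟨v, hv, w, hw, rfl⟩ | ⟨v, hv, w, hw, rfl⟩) | ⟨v, hv, w, hw, rfl⟩)
    · exact bilinInt_differentiableOn hip hiq him (hV.diff v hv) (hW.diff w hw)
    · exact bilinInt_differentiableOn hop hoq hom (hV.diff v hv) (hW.diff w hw)
    · exact bilinInt_differentiableOn hcp hcq hcm (hV.diff v hv) (hW.diff w hw)
  · rintro f ((⟨v, hv, w, hw, rfl⟩ | ⟨v, hv, w, hw, rfl⟩) | ⟨v, hv, w, hw, rfl⟩)
    · exact pinchInner_small hσ (hV.small v hv) (hW.small w hw)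
    · exact pinchOuter_small hσ hb (hV.diff v hv) (hW.diff w hw) (hV.small v hv) (hW.small w hw)
    · exact pinchCircle_small hσ hb (hV.diff v hv) (hW.diff w hw) (hV.small v hv) (hW.small w hw)
  · rintro f ((⟨v, hv, w, hw, rfl⟩ | ⟨v, hv, w, hw, rfl⟩) | ⟨v, hv, w, hw, rfl⟩)
    · obtain ⟨v', hv', h1⟩ := hV.stable v hv
      obtain ⟨w', hw', h2⟩ := hW.stable w hw
      exact ⟨_, hs1 v' hv' w' hw', fun ζ hζ =>
        pinchInner_shift hσ (by linarith) h1 h2 hζ⟩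
    · obtain ⟨v', hv', h1⟩ := hV.stable v hv
      obtain ⟨w', hw', h2⟩ := hW.stable w hw
      exact ⟨_, Submodule.add_mem _ (hs2 v' hv' w' hw') (hs3 v hv w hw), fun ζ hζ =>
        pinchOuter_shift hb (hV.diff v hv) (hW.diff w hw) h1 h2 hζ⟩
    · exact ⟨_, hs3 v hv w hw, fun ζ hζ => pinchCircle_shift v w hζ⟩
  · have hbc : 3 * b ≤ Real.exp c := by
      have h1 := Real.add_one_le_exp 2
      have h2 : Real.exp (Real.log b + 2) ≤ Real.exp c := Real.exp_le_exp.2 hb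
      rw [Real.exp_add, Real.exp_log hb0] at h2
      nlinarith
    -- Both sides are holomorphic on this convex piece of the sheet and agree on its central
    -- horizontal line, hence everywhere on it.
    let U : Set ℂ := {w | w.re < c'} ∩ ({w | 0 < σ * w.im} ∩ {w | σ * w.im < Real.pi})
    have hUo : IsOpen U := (isOpen_re_lt c').inter
      ((isOpen_lt continuous_const (by fun_prop)).inter (isOpen_lt (by fun_prop) continuous_const))
    have hUc : Convex ℝ U := by
      refine Convex.inter ?_ (Convex.inter ?_ ?_)
      · exact convex_halfSpace_lt (IsLinearMap.mk (by simp) (by simp)) _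
      · exact convex_halfSpace_gt (IsLinearMap.mk (by simp [mul_add]) (by simp [mul_left_comm])) _
      · exact convex_halfSpace_lt (IsLinearMap.mk (by simp [mul_add]) (by simp [mul_left_comm])) _
    let D : Set ℂ := {d | 0 < σ * d.im} ∩ Metric.ball 0 b
    have hDo : IsOpen D := (isOpen_lt continuous_const (by fun_prop)).inter Metric.isOpen_ball
    have hconv : DifferentiableOn ℂ (conv A B 0 b) D := by
      have hx : ∀ x ∈ segment ℝ (0 : ℂ) b, ‖x‖ < 2 * b ∧ x.im = 0 := fun x hx =>
        ⟨norm_lt_of_mem_segment (by simpa using hb0) (by simp [abs_of_pos hb0, hb0]) hx,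
          im_eq_zero_of_mem_segment_ofReal (a := 0) (by simpa using hx)⟩
      refine conv_differentiableOn hDo (fun d hd x hx' => ?_) (fun d hd x hx' => ?_)
      · have h1 : ‖d‖ < b := by simpa using hd.2
        refine analyticAt_of_side hσ (hV.diff φ hφ) hA ?_ ?_
        · linarith [norm_add_le x d, (hx x hx').1]
        · rw [Complex.add_im, (hx x hx').2, zero_add]; exact hd.1
      · have h1 : ‖d‖ < b := by simpa using hd.2
        refine analyticAt_of_side hσ (hW.diff ψ hψ) hB ?_ ?_
        · linarith [norm_sub_le d x, (hx x hx').1]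
        · rw [Complex.sub_im, (hx x hx').2, sub_zero]; exact hd.1
    have hmaps : ∀ w ∈ U, Complex.exp w ∈ D := by
      rintro w ⟨h1, h2, h3⟩
      refine ⟨side_exp hσ h2 h3, ?_⟩
      rw [mem_ball_zero_iff, Complex.norm_exp]
      have h1' : w.re < Real.log b := by have : w.re < c' := h1; linarith
      exact (Real.lt_log_iff_exp_lt hb0).1 h1'
    have hR : DifferentiableOn ℂ (fun w => conv A B 0 b (Complex.exp w)) U :=
      hconv.comp Complex.differentiable_exp.differentiableOn hmaps
    have hLd : DifferentiableOn ℂ (pinchInner σ c' φ ψ + pinchOuter σ b c' φ ψ) U :=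
      ((bilinInt_differentiableOn hip hiq him (hV.diff φ hφ) (hW.diff ψ hψ)).add
        (bilinInt_differentiableOn hop hoq hom (hV.diff φ hφ) (hW.diff ψ hψ))).mono
        Set.inter_subset_left
    have hpi := Real.pi_pos
    have hσσ : σ * σ = 1 := by rcases hσ with rfl | rfl <;> norm_num
    have hmulI : (σ : ℂ) * (Real.pi / 2) * Complex.I =
        ((σ * (Real.pi / 2) : ℝ) : ℂ) * Complex.I := by push_cast; ring
    have heq := eqOn_of_eq_horizontal hUo hUc hLd hR
      (z₀ := ((c' - 1 : ℝ) : ℂ) + σ * (Real.pi / 2) * Complex.I) (by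
        rw [hmulI]
        simp only [U, Set.mem_inter_iff, Set.mem_ofPred_eq, Complex.add_re, Complex.add_im,
          Complex.re_ofReal_mul, Complex.im_ofReal_mul, Complex.ofReal_re, Complex.ofReal_im,
          Complex.I_re, Complex.I_im, zero_add, mul_one, mul_zero, add_zero, ← mul_assoc, hσσ,
          one_mul]
        refine ⟨by linarith, by linarith, by linarith⟩) (by
        filter_upwards [gt_mem_nhds (show (0 : ℝ) < 1 by norm_num)] with r hr
        have := conv_exp_line hσ hb0 hb (hV.diff φ hφ) (hW.diff ψ hψ) hA hB
          (x := c' - 1 + r) (by linarith)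
        rw [show ((c' - 1 : ℝ) : ℂ) + σ * (Real.pi / 2) * Complex.I + r =
          ((c' - 1 + r : ℝ) : ℂ) + σ * (Real.pi / 2) * Complex.I by push_cast; ring]
        exact this)
    exact fun w h1 h2 h3 => heq ⟨h1, h2, h3⟩

/-! ### Convolution along a horizontal segment -/

theorem LocGerm.eventually_analyticAt {K : Subfield ℂ} {σ : ℝ} (hσ : σ = 1 ∨ σ = -1) {A : ℂ → ℂ}
    (hA : LocGerm K σ A) : ∀ᶠ x in 𝓝 (0 : ℂ), 0 < σ * x.im → AnalyticAt ℂ A x := by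
  obtain ⟨c, V, φ, hV, hφ, h⟩ := hA
  filter_upwards [Metric.ball_mem_nhds (0 : ℂ) (Real.exp_pos c)] with x hx hs
  exact analyticAt_of_side hσ (hV.diff φ hφ) h (by simpa using hx) hs

theorem convex_side_strip (σ e : ℝ) :
    Convex ℝ ({x : ℂ | -e < σ * x.im} ∩ {x : ℂ | σ * x.im < e}) := by
  refine Convex.inter ?_ ?_
  · exact convex_halfSpace_gt (IsLinearMap.mk (by simp [mul_add]) (by simp [mul_left_comm])) _
  · exact convex_halfSpace_lt (IsLinearMap.mk (by simp [mul_add]) (by simp [mul_left_comm])) _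

theorem exists_side_thickening {σ X₀ X₁ : ℝ} {u : ℂ → ℂ}
    (hu : ∀ x ∈ Set.Icc X₀ X₁, ∀ᶠ y in 𝓝 (0 : ℂ), 0 < σ * y.im → AnalyticAt ℂ u (x + y)) :
    ∃ δ > 0, ∀ x ∈ Set.Icc X₀ X₁, ∀ y : ℂ, ‖y‖ < δ → 0 < σ * y.im → AnalyticAt ℂ u (x + y) := by
  have hK : IsCompact (Complex.ofReal '' Set.Icc X₀ X₁) :=
    isCompact_Icc.image Complex.continuous_ofReal
  obtain ⟨δ, hδ, h⟩ := hK.exists_thickening_subset_open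
    (t := interior {z : ℂ | 0 < σ * z.im → AnalyticAt ℂ u z}) isOpen_interior (by
      rintro _ ⟨x, hx, rfl⟩
      rw [mem_interior_iff_mem_nhds]
      have ht : Tendsto (fun z : ℂ => z - x) (𝓝 (x : ℂ)) (𝓝 0) := by
        simpa using (tendsto_id (x := 𝓝 (x : ℂ))).sub_const (x : ℂ)
      filter_upwards [ht.eventually (hu x hx)] with z hz hs
      simpa using hz (by simpa using hs))
  refine ⟨δ, hδ, fun x hx y hy hs => ?_⟩
  exact interior_subset (h (Metric.mem_thickening_iff.2 ⟨x, ⟨x, hx, rfl⟩, by simpa using hy⟩))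
    (by simpa using hs)

/-- For fixed `d` on the side `σ`, both factors are analytic on a convex neighbourhood of the
segment inside the strip `|x.im| < |d.im|`. Compactness makes the admissible size of `d` uniform in
the three points. -/
theorem eventually_conv_add {σ X₀ X₁ : ℝ} {u v : ℂ → ℂ}
    (hu : ∀ x ∈ Set.Icc X₀ X₁, ∀ᶠ y in 𝓝 (0 : ℂ), 0 < σ * y.im → AnalyticAt ℂ u (x + y))
    (hv : ∀ x ∈ Set.Icc X₀ X₁, ∀ᶠ y in 𝓝 (0 : ℂ), 0 < σ * y.im → AnalyticAt ℂ v (y - x)) :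
    ∀ᶠ d in 𝓝 (0 : ℂ), 0 < σ * d.im → ∀ a ∈ Set.Icc X₀ X₁, ∀ b ∈ Set.Icc X₀ X₁,
      ∀ c ∈ Set.Icc X₀ X₁, conv u v a b d + conv u v b c d = conv u v a c d := by
  obtain ⟨δ₁, hδ₁, h1⟩ := exists_side_thickening hu
  obtain ⟨δ₂, hδ₂, h2⟩ := exists_side_thickening (X₀ := -X₁) (X₁ := -X₀) (u := v)
    (fun x hx => by
      filter_upwards [hv (-x) ⟨by linarith [hx.2], by linarith [hx.1]⟩] with y hy hs
      have := hy hs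
      rwa [Complex.ofReal_neg, sub_neg_eq_add, add_comm] at this)
  have hδ : 0 < min δ₁ δ₂ / 2 := by positivity
  filter_upwards [Metric.ball_mem_nhds (0 : ℂ) hδ] with d hd hs a ha b hb c hc
  rw [mem_ball_zero_iff] at hd
  have hd1 : ‖d‖ < δ₁ / 2 := by linarith [min_le_left δ₁ δ₂]
  have hd2 : ‖d‖ < δ₂ / 2 := by linarith [min_le_right δ₁ δ₂]
  have hcv : Convex ℝ (Complex.ofReal '' Set.Icc X₀ X₁) :=
    (convex_Icc X₀ X₁).linear_image Complex.ofRealCLM.toLinearMap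
  have hU : Convex ℝ (({x : ℂ | -(σ * d.im) < σ * x.im} ∩ {x : ℂ | σ * x.im < σ * d.im}) ∩
      Metric.thickening (min δ₁ δ₂ / 2) (Complex.ofReal '' Set.Icc X₀ X₁)) :=
    (convex_side_strip σ _).inter (hcv.thickening _)
  have hmem : ∀ t ∈ Set.Icc X₀ X₁, (t : ℂ) ∈
      (({x : ℂ | -(σ * d.im) < σ * x.im} ∩ {x : ℂ | σ * x.im < σ * d.im}) ∩
      Metric.thickening (min δ₁ δ₂ / 2) (Complex.ofReal '' Set.Icc X₀ X₁)) := fun t ht =>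
    ⟨⟨by simpa using hs, by simpa using hs⟩,
      Metric.self_subset_thickening hδ _ ⟨t, ht, rfl⟩⟩
  refine conv_add_of_convex hU ?_ ?_ (hmem a ha) (hmem b hb) (hmem c hc)
  · rintro x ⟨⟨hx1, hx2⟩, hx3⟩
    obtain ⟨_, ⟨t, ht, rfl⟩, hxt⟩ := Metric.mem_thickening_iff.1 hx3
    rw [dist_eq_norm] at hxt
    have := h1 t ht (x - t + d) ((norm_add_le _ _).trans_lt
      (by linarith [min_le_left δ₁ δ₂])) (by
        simp only [Set.mem_ofPred_eq] at hx1
        simp only [Complex.add_im, Complex.sub_im, Complex.ofReal_im, sub_zero]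
        linarith)
    rwa [show (t : ℂ) + (x - t + d) = x + d by ring] at this
  · rintro x ⟨⟨hx1, hx2⟩, hx3⟩
    obtain ⟨_, ⟨t, ht, rfl⟩, hxt⟩ := Metric.mem_thickening_iff.1 hx3
    rw [dist_eq_norm] at hxt
    have := h2 (-t) ⟨by linarith [ht.2], by linarith [ht.1]⟩ (d - (x - t))
      ((norm_sub_le _ _).trans_lt (by linarith [min_le_right δ₁ δ₂])) (by
        simp only [Set.mem_ofPred_eq] at hx2
        simp only [Complex.sub_im, Complex.ofReal_im, sub_zero]
        linarith)
    rwa [show ((-t : ℝ) : ℂ) + (d - (x - t)) = d - x by push_cast; ring] at this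

theorem eventually_eventually_side {σ : ℝ} {p : ℂ → Prop}
    (h : ∀ᶠ x in 𝓝 (0 : ℂ), 0 < σ * x.im → p x) :
    ∃ ε > 0, ∀ a : ℝ, |a| < ε → ∀ᶠ y in 𝓝 (0 : ℂ), 0 < σ * y.im → p (a + y) := by
  obtain ⟨ε, hε, h'⟩ := Metric.eventually_nhds_iff.1 h.eventually_nhds
  refine ⟨ε, hε, fun a ha => ?_⟩
  have ht : Tendsto (fun y : ℂ => (a : ℂ) + y) (𝓝 0) (𝓝 (a : ℂ)) := by
    simpa using (tendsto_id (x := 𝓝 (0 : ℂ))).const_add (a : ℂ)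
  filter_upwards [ht.eventually (h' (y := (a : ℂ)) (by simpa using ha))] with y hy hs
  exact hy (by simpa using hs)

/-- The segment is split at the pinch; the left half is a right half after exchanging the factors.
-/
theorem LocGerm.conv_locGerm {K : Subfield ℂ} {σ : ℝ} (hσ : σ = 1 ∨ σ = -1) {A B : ℂ → ℂ}
    (hA : LocGerm K σ A) (hB : LocGerm K σ B) :
    ∃ ε > 0, ∀ a b : ℝ, a < 0 → 0 < b → |a| < ε → |b| < ε → LocGerm K σ (conv A B a b) := by
  obtain ⟨ε₁, hε₁, h1⟩ := hA.conv_half hσ hB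
  obtain ⟨ε₂, hε₂, h2⟩ := hB.conv_half hσ hA
  obtain ⟨ε₃, hε₃, h3⟩ := eventually_eventually_side (hA.eventually_analyticAt hσ)
  obtain ⟨ε₄, hε₄, h4⟩ := eventually_eventually_side (hB.eventually_analyticAt hσ)
  refine ⟨min (min ε₁ ε₂) (min ε₃ ε₄), by positivity, fun a b ha hb ha' hb' => ?_⟩
  simp only [lt_min_iff] at ha' hb'
  have e : conv A B a 0 = conv B A 0 ((-a : ℝ) : ℂ) :=
    funext fun d => by rw [conv_swap]; simp
  have g1 : LocGerm K σ (conv A B a 0) := by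
    rw [e]; exact h2 (-a) (by linarith) (by rw [abs_of_neg ha] at ha'; exact ha'.1.2)
  have g2 := h1 b hb (by rw [abs_of_pos hb] at hb'; exact hb'.1.1)
  refine (g1.add g2).congr hσ ?_
  rw [abs_of_neg ha] at ha'
  rw [abs_of_pos hb] at hb'
  have := eventually_conv_add (σ := σ) (X₀ := a) (X₁ := b) (u := A) (v := B)
    (fun x hx => h3 x (abs_lt.2 ⟨by linarith [hx.1], by linarith [hx.2]⟩))
    (fun x hx => by
      have := h4 (-x) (by rw [abs_neg]; exact abs_lt.2 ⟨by linarith [hx.1], by linarith [hx.2]⟩)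
      filter_upwards [this] with y hy hs
      have := hy hs
      rwa [Complex.ofReal_neg, neg_add_eq_sub] at this)
  filter_upwards [this] with d hd hs
  have := hd hs a ⟨le_rfl, by linarith⟩ 0 ⟨ha.le, hb.le⟩ b ⟨by linarith, le_rfl⟩
  rw [Complex.ofReal_zero] at this
  exact this.symm

/-- A germ that is regular, or, when `q` holds, at worst a local germ. -/
def GermIf (K : Subfield ℂ) (σ : ℝ) (q : Prop) (A : ℂ → ℂ) : Prop :=
  RegGerm σ A ∨ (q ∧ LocGerm K σ A)

theorem GermIf.add {K : Subfield ℂ} {σ : ℝ} (hσ : σ = 1 ∨ σ = -1) {q : Prop} {A B : ℂ → ℂ}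
    (hA : GermIf K σ q A) (hB : GermIf K σ q B) : GermIf K σ q (fun x => A x + B x) := by
  rcases hA with hA | ⟨h, hA⟩ <;> rcases hB with hB | ⟨h', hB⟩
  · exact Or.inl (hA.add hB)
  · exact Or.inr ⟨h', (hA.locGerm hσ K).add hB⟩
  · exact Or.inr ⟨h, hA.add (hB.locGerm hσ K)⟩
  · exact Or.inr ⟨h, hA.add hB⟩

theorem GermIf.congr {K : Subfield ℂ} {σ : ℝ} (hσ : σ = 1 ∨ σ = -1) {q : Prop} {A B : ℂ → ℂ}
    (hA : GermIf K σ q A) (h : ∀ᶠ x in 𝓝 (0 : ℂ), 0 < σ * x.im → B x = A x) :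
    GermIf K σ q B := by
  rcases hA with hA | ⟨h', hA⟩
  · exact Or.inl (hA.congr h)
  · exact Or.inr ⟨h', hA.congr hσ h⟩

theorem conv_add_base (u v : ℂ → ℂ) (x a b : ℂ) :
    conv u v (x + a) (x + b) = conv (fun y => u (x + y)) (fun y => v (y - x)) a b := by
  funext d
  rw [conv, conv, add_comm x a, add_comm x b, ← segInt_comp_add]
  congr 1
  funext y
  congr 2 <;> ring

/-- The statement is additive in the interval, so it suffices to treat short intervals around one
point. There at most one `x` is singular, and the proof splits according to which factors are
singular at it; only a genuine pinch, with `0` strictly inside the recentred interval, produces a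
local germ instead of a regular one. -/
theorem GermIf.conv_horizontal {K : Subfield ℂ} {σ : ℝ} (hσ : σ = 1 ∨ σ = -1) {q : Prop}
    {u v : ℂ → ℂ} {X₀ X₁ : ℝ} (h01 : X₀ < X₁) {SA SB : Set ℝ}
    (hu : ∀ x ∈ Set.Icc X₀ X₁, LocGerm K σ (fun y => u (x + y)) ∧
      (x ∉ SA → RegGerm σ (fun y => u (x + y))))
    (hv : ∀ x ∈ Set.Icc X₀ X₁, LocGerm K σ (fun y => v (y - x)) ∧
      (x ∉ SB → RegGerm σ (fun y => v (y - x))))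
    (hiso : ∀ x ∈ Set.Icc X₀ X₁, ∃ ε > 0, ∀ t ∈ SA ∪ SB, |t - x| < ε → t = x)
    (hq : ∀ x ∈ Set.Icc X₀ X₁, x ∈ SA → x ∈ SB → q) (h0 : X₀ ∉ SA ∪ SB) (h1 : X₁ ∉ SA ∪ SB) :
    GermIf K σ q (conv u v X₀ X₁) := by
  have hu' : ∀ x ∈ Set.Icc X₀ X₁, ∀ᶠ y in 𝓝 (0 : ℂ), 0 < σ * y.im → AnalyticAt ℂ u (x + y) := by
    intro x hx
    filter_upwards [(hu x hx).1.eventually_analyticAt hσ] with y hy hs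
    have := (hy hs).comp_of_eq (g := fun y => u (x + y)) (f := fun z : ℂ => z - x)
      (by fun_prop : AnalyticAt ℂ (fun z : ℂ => z - x) (x + y)) (by simp)
    simpa [Function.comp_def] using this
  have hv' : ∀ x ∈ Set.Icc X₀ X₁, ∀ᶠ y in 𝓝 (0 : ℂ), 0 < σ * y.im → AnalyticAt ℂ v (y - x) := by
    intro x hx
    filter_upwards [(hv x hx).1.eventually_analyticAt hσ] with y hy hs
    have := (hy hs).comp_of_eq (g := fun y => v (y - x)) (f := fun z : ℂ => z + x)
      (by fun_prop : AnalyticAt ℂ (fun z : ℂ => z + x) (y - x)) (by simp)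
    simpa [Function.comp_def] using this
  have hadd := eventually_conv_add hu' hv'
  refine interval_property_of_local (P := fun a b : ℝ => GermIf K σ q (conv u v a b)) h01 h0 h1
    ?_ ?_
  · intro x hx
    obtain ⟨ε₀, hε₀, hiso⟩ := hiso x hx
    suffices ∃ ε > 0, ∀ a b : ℝ, a < b → |a| < ε → |b| < ε → (x ∈ SA ∪ SB → a ≠ 0 ∧ b ≠ 0) →
        GermIf K σ q (conv (fun y => u (x + y)) (fun y => v (y - x)) a b) by
      obtain ⟨ε, hε, h⟩ := this
      refine ⟨min ε₀ ε, by positivity, fun t ht htx => hiso t ht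
        (lt_of_lt_of_le htx (min_le_left _ _)), fun a b ha hab hb haQ hbQ => ?_⟩
      have hm := min_le_right ε₀ ε
      have := h (a - x) (b - x) (by linarith) (abs_lt.2 ⟨by linarith, by linarith⟩)
        (abs_lt.2 ⟨by linarith, by linarith⟩) (fun hxQ =>
          ⟨fun h => haQ (by rwa [sub_eq_zero.1 h]), fun h => hbQ (by rwa [sub_eq_zero.1 h])⟩)
      rw [← conv_add_base] at this
      simpa using this
    obtain ⟨hu1, hu2⟩ := hu x hx
    obtain ⟨hv1, hv2⟩ := hv x hx
    by_cases hA : x ∈ SA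
    · by_cases hB : x ∈ SB
      · obtain ⟨ε₁, hε₁, g1⟩ := hu1.conv_of_same_sign hσ hv1
        obtain ⟨ε₂, hε₂, g2⟩ := hu1.conv_locGerm hσ hv1
        refine ⟨min ε₁ ε₂, by positivity, fun a b hab ha hb hne => ?_⟩
        obtain ⟨ha0, hb0⟩ := hne (Or.inl hA)
        rw [lt_min_iff] at ha hb
        by_cases hs : 0 < a * b
        · exact Or.inl (g1 a b hs ha.1 hb.1)
        · refine Or.inr ⟨hq x hx hA hB, g2 a b ?_ ?_ ha.2 hb.2⟩
          · by_contra hc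
            have : 0 < a := lt_of_le_of_ne (not_lt.1 hc) (Ne.symm ha0)
            exact hs (mul_pos this (this.trans hab))
          · by_contra hc
            have : b < 0 := lt_of_le_of_ne (not_lt.1 hc) hb0
            exact hs (mul_pos_of_neg_of_neg (hab.trans this) this)
      · obtain ⟨ε, hε, g⟩ := hu1.conv_regGerm hσ (hv2 hB)
        exact ⟨ε, hε, fun a b _ ha hb hne => Or.inl (g a b (hne (Or.inl hA)).1
          (hne (Or.inl hA)).2 ha hb)⟩
    · by_cases hB : x ∈ SB
      · obtain ⟨ε, hε, g⟩ := (hu2 hA).conv_locGerm hσ hv1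
        exact ⟨ε, hε, fun a b _ ha hb hne => Or.inl (g a b (hne (Or.inr hB)).1
          (hne (Or.inr hB)).2 ha hb)⟩
      · obtain ⟨ε, hε, g⟩ := (hu2 hA).conv_regGerm (hv2 hB)
        exact ⟨ε, hε, fun a b _ ha hb _ => Or.inl (g a b ha hb)⟩
  · intro a b c ha hab hbc hc h1 h2
    refine (h1.add hσ h2).congr hσ ?_
    filter_upwards [hadd] with d hd hs
    exact (hd hs a ⟨ha, by linarith⟩ b ⟨by linarith, by linarith⟩ c ⟨by linarith, hc⟩).symm

/-! ### Germs in logarithmic coordinates -/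

/-- The sign of a side: `1` on the left, `-1` on the right. -/
def RaySide.sign : RaySide → ℝ
  | .left => 1
  | .right => -1

theorem RaySide.sign_eq (s : RaySide) : s.sign = 1 ∨ s.sign = -1 := by
  cases s <;> simp [RaySide.sign]

theorem RaySide.mem_region_iff {s : RaySide} {p z : ℂ} :
    z ∈ s.region p ↔ 0 < s.sign * (z / p).im := by
  cases s <;> simp [RaySide.sign, RaySide.region]

theorem RaySide.mem_angles_iff {s : RaySide} {θ : ℝ} :
    θ ∈ s.angles ↔ 0 < s.sign * θ ∧ s.sign * θ < Real.pi := by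
  cases s
  · simp [RaySide.sign, RaySide.angles]
  · simp only [RaySide.sign, RaySide.angles, Set.mem_Ioo, neg_one_mul]
    constructor <;> rintro ⟨h1, h2⟩ <;> constructor <;> linarith

theorem eventually_side_exp {σ : ℝ} (hσ : σ = 1 ∨ σ = -1) :
    ∀ᶠ y in 𝓝 (0 : ℂ), 0 < σ * y.im → 0 < σ * (Complex.exp y).im := by
  filter_upwards [Metric.ball_mem_nhds (0 : ℂ) Real.pi_pos] with y hy hs
  refine side_exp hσ hs (lt_of_le_of_lt ?_ (mem_ball_zero_iff.1 hy))
  refine le_trans ?_ (Complex.abs_im_le_norm y)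
  rcases hσ with rfl | rfl
  · simpa using le_abs_self y.im
  · simpa using neg_le_abs y.im

theorem ExtendsAcross.regGerm {F : ℂ → ℂ} {p : ℂ} {s : RaySide} (hp : p ≠ 0)
    (h : ExtendsAcross F p s) : RegGerm s.sign (fun y => F (p * Complex.exp y)) := by
  obtain ⟨g, hg, h⟩ := h
  refine ⟨fun y => g (p * Complex.exp y), ?_, ?_⟩
  · exact hg.comp_of_eq (f := fun y => p * Complex.exp y) (by fun_prop) (by simp)
  · have ht : Tendsto (fun y => p * Complex.exp y) (𝓝 0) (𝓝 p) := by
      have : Continuous fun y => p * Complex.exp y := by fun_prop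
      simpa using this.tendsto 0
    filter_upwards [ht.eventually h, eventually_side_exp s.sign_eq] with y h1 h2 hs
    refine (h1 (RaySide.mem_region_iff.2 ?_)).symm
    rw [mul_div_cancel_left₀ _ hp]
    exact h2 hs

/-- An analytic function with simple zero at `0` and positive derivative there is
`x * exp (κ x)`. -/
theorem exists_analyticAt_exp_eq {q : ℂ → ℂ} (hq : AnalyticAt ℂ q 0) (h0 : q 0 = 0) {r : ℝ}
    (hr : 0 < r) (hd : deriv q 0 = r) :
    ∃ κ : ℂ → ℂ, AnalyticAt ℂ κ 0 ∧ (κ 0).im = 0 ∧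
      ∀ᶠ x in 𝓝 (0 : ℂ), x * Complex.exp (κ x) = q x := by
  obtain ⟨k, hk, hk'⟩ : ∃ k : ℂ → ℂ, AnalyticAt ℂ k 0 ∧ k = dslope q 0 := by
    refine ⟨_, ?_, rfl⟩
    obtain ⟨P, hP⟩ := hq
    exact hP.has_fpower_series_dslope_fslope.analyticAt
  have hk0 : k 0 = r := by rw [hk', dslope_same, hd]
  have hs : k 0 ∈ Complex.slitPlane := by rw [hk0]; exact Complex.ofReal_mem_slitPlane.2 hr
  refine ⟨fun x => Complex.log (k x), hk.clog hs, ?_, ?_⟩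
  · simp only
    rw [hk0, Complex.log_im, Complex.arg_ofReal_of_nonneg hr.le]
  · filter_upwards [hk.continuousAt.eventually_ne (Complex.slitPlane_ne_zero hs)] with x hx
    rw [Complex.exp_log hx, hk']
    have := sub_smul_dslope q 0 x
    rwa [sub_zero, h0, sub_zero, smul_eq_mul] at this

/-- The passage from `p + p * x` to `p * exp y` is the coordinate change `x = exp y - 1`, which has
derivative `1` at `0`. -/
theorem IsLocalContinuation.locGerm {K : Subfield ℂ} {F Φ : ℂ → ℂ} {p : ℂ} {s : RaySide} {c : ℝ}
    (hp : p ≠ 0) (h : IsLocalContinuation F p s c Φ) (hi : IsIntegrableAt p Φ)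
    (hr : IsRecurrentOver K c Φ) : LocGerm K s.sign (fun y => F (p * Complex.exp y)) := by
  have hsm : SectorSmall Φ := fun M => by
    have := (hi M).const_mul p⁻¹
    rw [mul_zero] at this
    refine this.congr fun w => ?_
    field_simp
  obtain ⟨V, hV, hΦ⟩ := exists_localSpace_of_isRecurrentOver h.differentiableOn hsm hr
  have hA : LocGerm K s.sign (fun x => F (p + p * x)) :=
    ⟨c, V, Φ, hV, hΦ, fun w h1 h2 h3 => h.eq_on_side w h1 (RaySide.mem_angles_iff.2 ⟨h2, h3⟩)⟩
  obtain ⟨κ, hκ, hκ0, hκe⟩ := exists_analyticAt_exp_eq (q := fun y => Complex.exp y - 1) (r := 1)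
    (by fun_prop) (by simp) one_pos (by simp)
  refine hA.comp s.sign_eq hκ hκ0 ?_
  filter_upwards [hκe, eventually_side_exp s.sign_eq] with x h1 h2 hs
  rw [h1]
  refine ⟨by simpa using h2 hs, ?_⟩
  congr 1
  ring

/-! ### Geometry of the principal star -/

/-- The set `S` avoids `0` and is locally finite. -/
structure IsSingularSet (S : Set ℂ) : Prop where
  zero_notMem : (0 : ℂ) ∉ S
  finite : ∀ R : ℝ, (S ∩ Metric.closedBall 0 R).Finite

theorem IsSingularSet.eventually_eq {S : Set ℂ} (hS : IsSingularSet S) (p : ℂ) :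
    ∀ᶠ z in 𝓝 p, z ∈ S → z = p := by
  have hfin := (hS.finite (‖p‖ + 1)).subset (Set.sdiff_subset (t := {p}))
  have h1 : ∀ᶠ z in 𝓝 p, z ∉ (S ∩ Metric.closedBall 0 (‖p‖ + 1)) \ {p} :=
    hfin.isClosed.isOpen_compl.mem_nhds (by simp)
  filter_upwards [h1, Metric.ball_mem_nhds p one_pos] with z h1 h2 hz
  by_contra hne
  refine h1 ⟨⟨hz, ?_⟩, hne⟩
  rw [mem_closedBall_zero_iff]
  rw [mem_ball_iff_norm] at h2
  have := norm_add_le (z - p) p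
  rw [sub_add_cancel] at this
  linarith

theorem IsSingularSet.isClosed {S : Set ℂ} (hS : IsSingularSet S) : IsClosed S := by
  rw [← isOpen_compl_iff, isOpen_iff_mem_nhds]
  intro p hp
  filter_upwards [hS.eventually_eq p] with z hz hzS
  exact hp (hz hzS ▸ hzS)

theorem IsSingularSet.isOpen_principalStar {S : Set ℂ} (hS : IsSingularSet S) :
    IsOpen (principalStar S) := by
  rw [isOpen_iff_mem_nhds]
  intro z hz
  have := (isCompact_Icc (a := (0 : ℝ)) (b := 1)).eventually_forall_of_forall_eventually
    (x₀ := z) (P := fun z t => (t : ℂ) * z ∉ S) (fun t ht => by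
      have hc : Continuous fun q : ℂ × ℝ => (q.2 : ℂ) * q.1 := by fun_prop
      exact (hS.isClosed.isOpen_compl.preimage hc).mem_nhds
        (show (z, t).2 * (z, t).1 ∉ S from hz t ht.1 ht.2))
  filter_upwards [this] with w hw t h0 h1
  exact hw t ⟨h0, h1⟩

theorem IsSingularSet.exists_ball {S : Set ℂ} (hS : IsSingularSet S) :
    ∃ r > 0, ∀ z : ℂ, ‖z‖ < r → z ∉ S := by
  obtain ⟨r, hr, h⟩ := Metric.eventually_nhds_iff.1
    (hS.isClosed.isOpen_compl.mem_nhds hS.zero_notMem)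
  exact ⟨r, hr, fun z hz => h (by simpa using hz)⟩

theorem mem_principalStar_of_norm_lt {S : Set ℂ} {r : ℝ} (h : ∀ z : ℂ, ‖z‖ < r → z ∉ S) {z : ℂ}
    (hz : ‖z‖ < r) : z ∈ principalStar S := fun t h0 h1 => h _ (by
  rw [norm_mul, Complex.norm_real, Real.norm_of_nonneg h0]
  nlinarith [norm_nonneg z])

/-- The principal star in logarithmic coordinates. -/
def logStar (S : Set ℂ) : Set ℂ := {x | Complex.exp x ∈ principalStar S}

theorem IsSingularSet.isOpen_logStar {S : Set ℂ} (hS : IsSingularSet S) : IsOpen (logStar S) :=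
  hS.isOpen_principalStar.preimage Complex.continuous_exp

/-- Star-shapedness in logarithmic form: horizontal motion to the left is radial contraction. This
is why only the positive part of `d.re` can obstruct a continuation. -/
theorem logStar_of_re_le {S : Set ℂ} {x y : ℂ} (hx : x ∈ logStar S) (hre : y.re ≤ x.re)
    (him : y.im = x.im) : y ∈ logStar S := fun t h0 h1 => by
  have h2 : Real.exp (y.re - x.re) ≤ 1 := Real.exp_le_one_iff.2 (by linarith)
  have := hx (t * Real.exp (y.re - x.re)) (by positivity)
    (by nlinarith [Real.exp_pos (y.re - x.re)])
  have e : Complex.exp y = Real.exp (y.re - x.re) * Complex.exp x := by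
    rw [Complex.ofReal_exp, ← Complex.exp_add]
    congr 1
    apply Complex.ext <;> simp [him]
  rw [e, ← mul_assoc]
  simpa using this

theorem eventually_exp_mul_I_ne (h : ℝ) (a : ℂ) :
    ∀ᶠ θ : ℝ in 𝓝[≠] h, Complex.exp (θ * Complex.I) ≠ a := by
  have hc : Continuous fun θ : ℝ => Complex.exp (θ * Complex.I) := by fun_prop
  by_cases ha : Complex.exp (h * Complex.I) = a
  · filter_upwards [self_mem_nhdsWithin, nhdsWithin_le_nhds (Metric.ball_mem_nhds h
      Real.two_pi_pos)] with θ hθ hb heq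
    rw [← ha, Complex.exp_eq_exp_iff_exists_int] at heq
    obtain ⟨n, hn⟩ := heq
    have h1 : θ - h = n * (2 * Real.pi) := by
      have := congrArg Complex.im hn
      simp at this
      linarith
    rw [Real.ball_eq_Ioo] at hb
    have h3 : (n : ℝ) < 1 := by
      by_contra hcon
      have : (2 * Real.pi) * 1 ≤ 2 * Real.pi * n :=
        mul_le_mul_of_nonneg_left (not_lt.1 hcon) Real.two_pi_pos.le
      linarith [hb.2]
    have h4 : (-1 : ℝ) < n := by
      by_contra hcon
      have : 2 * Real.pi * n ≤ (2 * Real.pi) * (-1) :=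
        mul_le_mul_of_nonneg_left (not_lt.1 hcon) Real.two_pi_pos.le
      linarith [hb.1]
    have h5 : n = 0 := by
      have h3' : n < 1 := by exact_mod_cast h3
      have h4' : -1 < n := by exact_mod_cast h4
      omega
    rw [h5] at h1
    exact hθ (by simpa [sub_eq_zero] using h1)
  · exact nhdsWithin_le_nhds (hc.continuousAt.eventually_ne ha)

/-- Within bounded modulus, the points close to but not on a given direction lie in the star. -/
theorem IsSingularSet.exists_sector {S : Set ℂ} (hS : IsSingularSet S) (h R : ℝ) :
    ∃ ε > 0, ∀ x : ℂ, x.re < R → x.im ≠ h → |x.im - h| < ε → x ∈ logStar S := by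
  have h1 : ∀ᶠ θ : ℝ in 𝓝[≠] h, ∀ α ∈ S ∩ Metric.closedBall 0 (Real.exp R),
      Complex.exp (θ * Complex.I) ≠ α / ‖α‖ :=
    (hS.finite _).eventually_all.2 fun α _ => eventually_exp_mul_I_ne h _
  rw [eventually_nhdsWithin_iff, Metric.eventually_nhds_iff] at h1
  obtain ⟨ε, hε, h1⟩ := h1
  refine ⟨ε, hε, fun x hR hne hx t h0 ht1 hmem => ?_⟩
  have ht0 : 0 < t := lt_of_le_of_ne h0 (by
    rintro rfl
    exact hS.zero_notMem (by simpa using hmem))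
  have hnorm : ‖(t : ℂ) * Complex.exp x‖ = t * Real.exp x.re := by
    rw [norm_mul, Complex.norm_real, Real.norm_of_nonneg h0, Complex.norm_exp]
  refine h1 (y := x.im) hx hne _ ⟨hmem, ?_⟩ ?_
  · rw [mem_closedBall_zero_iff, hnorm]
    have := Real.exp_le_exp.2 hR.le
    nlinarith [Real.exp_pos x.re]
  · rw [hnorm, eq_div_iff (by
      have := (mul_pos ht0 (Real.exp_pos x.re)).ne'
      exact_mod_cast this)]
    push_cast
    rw [mul_left_comm, ← Complex.exp_add]
    congr 2
    conv_rhs => rw [← Complex.re_add_im x]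
    ring

theorem IsSingularSet.exists_isolated {S : Set ℂ} (hS : IsSingularSet S) {e : ℝ → ℂ}
    (he : Continuous e) (hinj : Function.Injective e) (x : ℝ) :
    ∃ ε > 0, ∀ t : ℝ, e t ∈ S → |t - x| < ε → t = x := by
  obtain ⟨ε, hε, h⟩ := Metric.eventually_nhds_iff.1
    (he.continuousAt.eventually (hS.eventually_eq (e x)))
  exact ⟨ε, hε, fun t ht hx => hinj (h (y := t) hx ht)⟩

/-- In every interval there is a radius avoiding the moduli of the singular points. -/
theorem IsSingularSet.exists_exp_ne {S : Set ℂ} (hS : IsSingularSet S) {m M : ℝ} (h : m < M) :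
    ∃ x ∈ Set.Ioo m M, ∀ α ∈ S, ‖α‖ ≠ Real.exp x := by
  have hfin := (hS.finite (Real.exp M)).image fun α => Real.log ‖α‖
  obtain ⟨x, hx, hx'⟩ := ((Set.Ioo_infinite h).sdiff hfin).nonempty
  refine ⟨x, hx, fun α hα he => hx' ⟨α, ⟨hα, ?_⟩, ?_⟩⟩
  · rw [mem_closedBall_zero_iff, he]
    exact Real.exp_le_exp.2 hx.2.le
  · simp only [he, Real.log_exp]

/-- The set of products of elements of two singular sets is a singular set. -/
theorem IsSingularSet.image2_mul {S T : Set ℂ} (hS : IsSingularSet S) (hT : IsSingularSet T) :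
    IsSingularSet (Set.image2 (· * ·) S T) := by
  obtain ⟨r, hr, h1⟩ := hS.exists_ball
  obtain ⟨q, hq, h2⟩ := hT.exists_ball
  constructor
  · rintro ⟨a, ha, b, hb, hab⟩
    rcases mul_eq_zero.1 hab with rfl | rfl
    · exact hS.zero_notMem ha
    · exact hT.zero_notMem hb
  · intro R
    -- The moduli in `S` and `T` are bounded below by `r` and `q`, so a bounded product has both
    -- factors bounded.
    refine ((hS.finite (R / q)).image2 (· * ·) (hT.finite (R / r))).subset ?_
    rintro _ ⟨⟨a, ha, b, hb, rfl⟩, hab⟩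
    have ha' : r ≤ ‖a‖ := not_lt.1 fun h => h1 a h ha
    have hb' : q ≤ ‖b‖ := not_lt.1 fun h => h2 b h hb
    rw [mem_closedBall_zero_iff, norm_mul] at hab
    refine ⟨a, ⟨ha, ?_⟩, b, ⟨hb, ?_⟩, rfl⟩
    · rw [mem_closedBall_zero_iff, le_div_iff₀ hq]
      exact (mul_le_mul_of_nonneg_left hb' (norm_nonneg a)).trans hab
    · rw [mem_closedBall_zero_iff, le_div_iff₀ hr, mul_comm]
      exact (mul_le_mul_of_nonneg_right ha' (norm_nonneg b)).trans hab

/-! ### Continuation of the convolution along a full turn -/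

/-- The half strip `{d | d.re < η, |d.im| < η}`. -/
def halfStrip (η : ℝ) : Set ℂ := {d | d.re < η} ∩ ({d | -η < d.im} ∩ {d | d.im < η})

theorem mem_halfStrip {η : ℝ} {d : ℂ} :
    d ∈ halfStrip η ↔ d.re < η ∧ -η < d.im ∧ d.im < η := Iff.rfl

theorem isOpen_halfStrip (η : ℝ) : IsOpen (halfStrip η) :=
  (isOpen_lt Complex.continuous_re continuous_const).inter
    ((isOpen_lt continuous_const Complex.continuous_im).inter
      (isOpen_lt Complex.continuous_im continuous_const))

theorem convex_halfStrip (η : ℝ) : Convex ℝ (halfStrip η) :=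
  (convex_halfSpace_re_lt η).inter ((convex_halfSpace_im_gt (-η)).inter (convex_halfSpace_im_lt η))

theorem halfStrip_mono {η η' : ℝ} (h : η ≤ η') : halfStrip η ⊆ halfStrip η' :=
  fun _ hd => ⟨lt_of_lt_of_le hd.1 h, lt_of_le_of_lt (neg_le_neg h) hd.2.1,
    lt_of_lt_of_le hd.2.2 h⟩

theorem zero_mem_halfStrip {η : ℝ} (h : 0 < η) : (0 : ℂ) ∈ halfStrip η := by
  simp [mem_halfStrip, h]

/-- The convolution integral from `a` to `b`, defined for `d.re` very negative, continues to
the part of a half strip in `D`, with a continuation satisfying `R`. -/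
def ConvContinues (u v : ℂ → ℂ) (D : Set ℂ) (R : (ℂ → ℂ) → Prop) (a b : ℂ) : Prop :=
  ∃ η > 0, ∃ ℓ : ℝ, ∃ J : ℂ → ℂ, DifferentiableOn ℂ J (halfStrip η ∩ D) ∧
    (∀ d ∈ halfStrip η ∩ D, d.re < ℓ → J d = conv u v a b d) ∧ R J

/-- For `d` far left both factors are analytic on a whole vertical strip containing the three
points, so contours may be exchanged freely there. The identity is needed nowhere else: the separate
continuations are simply added. -/
theorem exists_conv_add {u v : ℂ → ℂ} {m : ℝ} (hu : ∀ x : ℂ, x.re < m → AnalyticAt ℂ u x)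
    (hv : ∀ x : ℂ, x.re < m → AnalyticAt ℂ v x) (a b c : ℂ) :
    ∃ ℓ : ℝ, ∀ d : ℂ, d.re < ℓ → conv u v a b d + conv u v b c d = conv u v a c d := by
  obtain ⟨M, ha, hb, hc⟩ : ∃ M : ℝ, |a.re| < M ∧ |b.re| < M ∧ |c.re| < M :=
    ⟨|a.re| + |b.re| + |c.re| + 1, by linarith [abs_nonneg b.re, abs_nonneg c.re],
      by linarith [abs_nonneg a.re, abs_nonneg c.re],
      by linarith [abs_nonneg a.re, abs_nonneg b.re]⟩
  refine ⟨m - M, fun d hd => conv_add_of_convex (U := {x : ℂ | -M < x.re} ∩ {x | x.re < M})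
    ((convex_halfSpace_re_gt _).inter (convex_halfSpace_re_lt _)) ?_ ?_ (abs_lt.1 ha) (abs_lt.1 hb)
    (abs_lt.1 hc)⟩
  · rintro x ⟨-, hx⟩
    refine hu _ ?_
    simp only [Set.mem_ofPred_eq] at hx
    rw [Complex.add_re]; linarith
  · rintro x ⟨hx, -⟩
    refine hv _ ?_
    simp only [Set.mem_ofPred_eq] at hx
    rw [Complex.sub_re]; linarith

theorem ConvContinues.add {u v : ℂ → ℂ} {m : ℝ} (hu : ∀ x : ℂ, x.re < m → AnalyticAt ℂ u x)
    (hv : ∀ x : ℂ, x.re < m → AnalyticAt ℂ v x) {D : Set ℂ} {R : (ℂ → ℂ) → Prop}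
    (hR : ∀ J J', R J → R J' → R (fun d => J d + J' d)) {a b c : ℂ}
    (h1 : ConvContinues u v D R a b) (h2 : ConvContinues u v D R b c) :
    ConvContinues u v D R a c := by
  obtain ⟨η, hη, ℓ, J, hJ, hJe, hJR⟩ := h1
  obtain ⟨η', hη', ℓ', J', hJ', hJe', hJR'⟩ := h2
  obtain ⟨ℓ'', h⟩ := exists_conv_add hu hv a b c
  have hs1 : halfStrip (min η η') ∩ D ⊆ halfStrip η ∩ D :=
    Set.inter_subset_inter_left _ (halfStrip_mono (min_le_left _ _))
  have hs2 : halfStrip (min η η') ∩ D ⊆ halfStrip η' ∩ D :=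
    Set.inter_subset_inter_left _ (halfStrip_mono (min_le_right _ _))
  refine ⟨min η η', lt_min hη hη', min (min ℓ ℓ') ℓ'', fun d => J d + J' d,
    (hJ.mono hs1).add (hJ'.mono hs2), fun d hd hl => ?_, hR _ _ hJR hJR'⟩
  simp only [lt_min_iff] at hl
  beta_reduce
  rw [hJe d (hs1 hd) hl.1.1, hJe' d (hs2 hd) hl.1.2, h d hl.2]

theorem ConvContinues.symm {u v : ℂ → ℂ} {D : Set ℂ} {R : (ℂ → ℂ) → Prop}
    (hR : ∀ J, R J → R (fun d => -1 * J d)) {a b : ℂ}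
    (h : ConvContinues u v D R a b) : ConvContinues u v D R b a := by
  obtain ⟨η, hη, ℓ, J, hJ, hJe, hJR⟩ := h
  refine ⟨η, hη, ℓ, fun d => -1 * J d, hJ.const_mul _, fun d hd hl => ?_, hR _ hJR⟩
  beta_reduce
  rw [hJe d hd hl, conv, segInt_symm, neg_one_mul, neg_neg, conv]

/-- A function with singular set `S` all of whose singularities, approached in the star, are
local germs. -/
structure HasLogGerms (K : Subfield ℂ) (S : Set ℂ) (F : ℂ → ℂ) : Prop where
  sing : IsSingularSet S
  analyticOnNhd : AnalyticOnNhd ℂ F (principalStar S)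
  regGerm : ∀ p : ℂ, p ≠ 0 → p ∉ S → ∀ σ : ℝ, σ = 1 ∨ σ = -1 →
    RegGerm σ (fun y => F (p * Complex.exp y))
  locGerm : ∀ p ∈ S, ∀ σ : ℝ, σ = 1 ∨ σ = -1 → LocGerm K σ (fun y => F (p * Complex.exp y))

theorem HasLogGerms.analyticAt {K : Subfield ℂ} {S : Set ℂ} {F : ℂ → ℂ} (hF : HasLogGerms K S F)
    {ξ x : ℂ} (hx : ξ + x ∈ logStar S) : AnalyticAt ℂ (fun x => F (Complex.exp (ξ + x))) x :=
  (hF.analyticOnNhd _ hx).comp_of_eq (f := fun x => Complex.exp (ξ + x)) (by fun_prop) rfl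

theorem re_mem_of_mem_segment {a b x : ℂ} (h : x ∈ segment ℝ a b) :
    x.re ∈ Set.uIcc a.re b.re := by
  rw [← segment_eq_uIcc]
  exact image_segment ℝ Complex.reLm.toAffineMap a b ▸ Set.mem_image_of_mem _ h

theorem im_mem_of_mem_segment {a b x : ℂ} (h : x ∈ segment ℝ a b) :
    x.im ∈ Set.uIcc a.im b.im := by
  rw [← segment_eq_uIcc]
  exact image_segment ℝ Complex.imLm.toAffineMap a b ▸ Set.mem_image_of_mem _ h

/-- Compactness of the segment handles small displacements, and leftward invariance of the star
handles arbitrarily negative `d.re`. -/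
theorem IsSingularSet.exists_halfStrip {S : Set ℂ} (hS : IsSingularSet S) {a b : ℂ}
    (h : ∀ x ∈ segment ℝ a b, x ∈ logStar S) :
    ∃ η > 0, ∀ x ∈ segment ℝ a b, ∀ d ∈ halfStrip η, x + d ∈ logStar S := by
  have hK : IsCompact (segment ℝ a b) := by
    rw [segment_eq_image']
    exact isCompact_Icc.image (by fun_prop)
  obtain ⟨δ, hδ, h⟩ := hK.exists_thickening_subset_open hS.isOpen_logStar h
  refine ⟨δ / 2, by positivity, fun x hx d hd => ?_⟩
  obtain ⟨h1, h2, h3⟩ := mem_halfStrip.1 hd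
  have hd' : ‖((max d.re 0 : ℝ) : ℂ) + d.im * Complex.I‖ < δ := by
    refine (norm_add_le _ _).trans_lt ?_
    rw [norm_mul, Complex.norm_real, Complex.norm_real, Complex.norm_I, mul_one,
      Real.norm_of_nonneg (le_max_right _ _), Real.norm_eq_abs]
    have : max d.re 0 < δ / 2 := max_lt h1 (by positivity)
    have := abs_lt.2 ⟨h2, h3⟩
    linarith
  refine logStar_of_re_le (x := x + (((max d.re 0 : ℝ) : ℂ) + d.im * Complex.I))
    (h (Metric.mem_thickening_iff.2 ⟨x, hx, by simpa using hd'⟩)) ?_ ?_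
  · simp
  · simp

/-! ### Pieces of the contour and their continuations -/

section Arc

variable {K : Subfield ℂ} {S T : Set ℂ} {F G : ℂ → ℂ}

theorem sub_mem_segment {a b x ξ : ℂ} (h : x ∈ segment ℝ a b) :
    ξ - x ∈ segment ℝ (ξ - a) (ξ - b) := by
  obtain ⟨t, ht, rfl⟩ := exists_of_mem_segment h
  have := mem_segment_param (a := ξ - a) (b := ξ - b) ht
  convert this using 1
  ring

theorem sub_mem_segment_iff {a b x ξ : ℂ} (h : x ∈ segment ℝ (ξ - a) (ξ - b)) :
    ξ - x ∈ segment ℝ a b := by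
  simpa using sub_mem_segment (ξ := ξ) h

theorem convContinues_of_segment (hF : HasLogGerms K S F) (hG : HasLogGerms K T G) {ξ a b : ℂ}
    (h : ∀ x ∈ segment ℝ a b, x ∈ logStar S ∧ ξ - x ∈ logStar T) {D : Set ℂ}
    {R : (ℂ → ℂ) → Prop} (hR : ∀ J, AnalyticAt ℂ J 0 → R J) :
    ConvContinues (fun x => F (Complex.exp (0 + x))) (fun x => G (Complex.exp (ξ + x))) D R a b := by
  obtain ⟨η₁, hη₁, h1⟩ := hF.sing.exists_halfStrip fun x hx => (h x hx).1
  obtain ⟨η₂, hη₂, h2⟩ := hG.sing.exists_halfStrip (a := ξ - a) (b := ξ - b) fun x hx => by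
    simpa using (h (ξ - x) (sub_mem_segment_iff hx)).2
  have hη : 0 < min η₁ η₂ := lt_min hη₁ hη₂
  have hd := conv_differentiableOn (isOpen_halfStrip (min η₁ η₂)) (a := a) (b := b)
    (u := fun x => F (Complex.exp (0 + x))) (v := fun x => G (Complex.exp (ξ + x)))
    (fun d hd x hx => hF.analyticAt
      (by rw [zero_add]; exact h1 x hx d (halfStrip_mono (min_le_left _ _) hd)))
    (fun d hd x hx => hG.analyticAt (by
      have := h2 _ (sub_mem_segment hx) d (halfStrip_mono (min_le_right _ _) hd)
      rwa [show ξ + (d - x) = ξ - x + d by ring]))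
  exact ⟨_, hη, 0, _, hd.mono Set.inter_subset_left, fun _ _ _ => rfl,
    hR _ (hd.analyticAt ((isOpen_halfStrip _).mem_nhds (zero_mem_halfStrip hη)))⟩

/-- Only finitely many directions of singular points matter within bounded modulus, so horizontal
segments at heights near `h`, but different from `h`, meet no cut of either factor. -/
theorem exists_horizontal_segments (hS : IsSingularSet S) (hT : IsSingularSet T) (ξ : ℂ)
    (h a b : ℝ) : ∃ ε > 0, ∀ e : ℝ, e ≠ h → |e - h| < ε → ∀ x : ℂ, x.re ∈ Set.uIcc a b → x.im = e →
      x ∈ logStar S ∧ ξ - x ∈ logStar T := by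
  obtain ⟨ε₁, hε₁, h1⟩ := hS.exists_sector h (max a b + 1)
  obtain ⟨ε₂, hε₂, h2⟩ := hT.exists_sector (ξ.im - h) (ξ.re - min a b + 1)
  refine ⟨min ε₁ ε₂, lt_min hε₁ hε₂, fun e hne he x hx hxe => ⟨h1 x ?_ (by rwa [hxe]) ?_,
    h2 _ ?_ ?_ ?_⟩⟩
  · linarith [hx.2]
  · rw [hxe]; exact lt_of_lt_of_le he (min_le_left _ _)
  · rw [Complex.sub_re]
    linarith [hx.1]
  · rw [Complex.sub_im, hxe]
    intro hc
    exact hne (by linarith)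
  · rw [Complex.sub_im, hxe, show ξ.im - e - (ξ.im - h) = -(e - h) by ring, abs_neg]
    exact lt_of_lt_of_le he (min_le_right _ _)

end Arc

theorem ConvContinues.swap {u v : ℂ → ℂ} {D : Set ℂ} {R : (ℂ → ℂ) → Prop} {a b : ℂ}
    (h : ConvContinues v u D R (-b) (-a)) : ConvContinues u v D R a b := by
  obtain ⟨η, hη, ℓ, J, hJ, hJe, hJR⟩ := h
  exact ⟨η, hη, ℓ, J, hJ, fun d hd hl => by rw [hJe d hd hl, ← conv_swap], hJR⟩

/-- Convolution along a segment on whose points the second factor is only regular from one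
side at the end point. -/
theorem RegGerm.conv_of_analyticAt {σ : ℝ} {A B : ℂ → ℂ} (hA : AnalyticAt ℂ A 0)
    (hB : RegGerm σ B) :
    ∃ ε > 0, ∀ a : ℂ, ‖a‖ < ε → σ * a.im ≤ 0 → RegGerm σ (conv A B a 0) := by
  obtain ⟨k, hk, h2⟩ := hB
  obtain ⟨ε, hε, h⟩ := Metric.eventually_nhds_iff.1
    (h2.and (hA.eventually_analyticAt.and hk.eventually_analyticAt))
  simp only [dist_zero_right] at h
  refine ⟨ε / 2, by positivity, fun a ha hs => ⟨conv A k a 0, ?_, ?_⟩⟩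
  · have hx : ∀ x ∈ segment ℝ a 0, ‖x‖ < ε := fun x hx =>
      (norm_lt_of_mem_segment ha (by simpa using half_pos hε) hx).trans (by linarith)
    exact conv_analyticAt_zero (fun x hx' => (h (hx x hx')).2.1)
      (fun x hx' => (h (y := -x) (by rw [norm_neg]; exact hx x hx')).2.2)
  · filter_upwards [Metric.ball_mem_nhds (0 : ℂ) (half_pos hε)] with d hd hds
    rw [mem_ball_zero_iff] at hd
    refine conv_congr (fun _ _ => rfl) fun x hx => (h ?_).1 ?_
    · have := norm_lt_of_mem_segment ha (by simpa using half_pos hε) hx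
      linarith [norm_sub_le d x]
    · have hx' : σ * x.im ≤ 0 := by
        have hc : Convex ℝ {z : ℂ | σ * z.im ≤ 0} :=
          convex_halfSpace_le (IsLinearMap.mk (by simp [mul_add]) (by simp [mul_left_comm])) _
        exact hc.segment_subset hs (by simp) hx
      rw [Complex.sub_im, mul_sub]
      linarith

section Arc

variable {K : Subfield ℂ} {S T : Set ℂ} {F G : ℂ → ℂ}

theorem abs_im_lt_of_side {σ t ε : ℝ} (hσ : σ = 1 ∨ σ = -1) (h0 : 0 < σ * t) (h : σ * t < ε) :
    t ≠ 0 ∧ |t| < ε := by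
  refine ⟨fun h => by simp [h] at h0, ?_⟩
  rcases hσ with rfl | rfl
  · rw [one_mul] at *
    rwa [abs_of_pos h0]
  · rw [neg_one_mul] at *
    rwa [abs_of_neg (by linarith)]

theorem side_le_abs {σ : ℝ} (hσ : σ = 1 ∨ σ = -1) (t : ℝ) : σ * t ≤ |t| := by
  rcases hσ with rfl | rfl
  · simpa using le_abs_self t
  · simpa using neg_le_abs t

theorem side_lt_of_mem_halfStrip {σ η : ℝ} (hσ : σ = 1 ∨ σ = -1) {d : ℂ} (hd : d ∈ halfStrip η) :
    σ * d.im < η :=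
  (side_le_abs hσ _).trans_lt (abs_lt.2 (mem_halfStrip.1 hd).2)

/-- As `x.im` runs from `s` to `h`, the difference `h - x.im` has the sign of `σ` or vanishes, and
so does not cancel `d.im`: the argument of `G` stays off the critical direction, on the side `σ`. At
`d = 0` only the end point meets this direction, and there `G` is regular. The two base points `ζ`
and `ξ` allow an application with the factors exchanged. -/
theorem exists_convContinues_vertical (hF : HasLogGerms K S F) (hG : HasLogGerms K T G)
    {σ : ℝ} (hσ : σ = 1 ∨ σ = -1) {ζ ξ : ℂ} {x₀ h : ℝ}
    (hx₀ : ∀ x : ℂ, x.re ≤ ζ.re + x₀ + 1 → x ∈ logStar S)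
    (hreg : RegGerm σ (fun y => G (Complex.exp (ξ + (y - (x₀ + h * Complex.I))))))
    {R : (ℂ → ℂ) → Prop} (hR : ∀ J, RegGerm σ J → R J) :
    ∃ ε > 0, ∀ s : ℝ, σ * (s - h) < 0 → |s - h| < ε →
      ConvContinues (fun x => F (Complex.exp (ζ + x))) (fun x => G (Complex.exp (ξ + x)))
        {d | 0 < σ * d.im} R (x₀ + s * Complex.I) (x₀ + h * Complex.I) := by
  obtain ⟨ε₁, hε₁, h1⟩ := hG.sing.exists_sector (ξ.im - h) (ξ.re - x₀ + 1)
  have hA : AnalyticAt ℂ (fun y => F (Complex.exp (ζ + (x₀ + h * Complex.I + y)))) 0 := by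
    refine (hF.analyticAt (ξ := ζ + (x₀ + h * Complex.I)) (x := 0)
      (hx₀ _ (by simp))).congr (Eventually.of_forall fun y => ?_)
    simp only [add_assoc]
  obtain ⟨ε₂, hε₂, h2⟩ := RegGerm.conv_of_analyticAt hA hreg
  refine ⟨min (ε₁ / 2) ε₂, by positivity, fun s hs hsε => ?_⟩
  rw [lt_min_iff] at hsε
  refine ⟨min 1 (ε₁ / 2), by positivity, 0, _, ?_, fun _ _ _ => rfl, hR _ ?_⟩
  · refine conv_differentiableOn ((isOpen_halfStrip _).inter
      (isOpen_lt continuous_const (by fun_prop))) ?_ ?_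
    · rintro d ⟨hd, -⟩ x hx
      have hre := re_mem_of_mem_segment hx
      simp only [Complex.add_re, Complex.ofReal_re, Complex.re_ofReal_mul, Complex.I_re, mul_zero,
        add_zero, Set.uIcc_self, Set.mem_singleton_iff] at hre
      have := lt_of_lt_of_le (mem_halfStrip.1 hd).1 (min_le_left _ _)
      exact hF.analyticAt (hx₀ _ (by simp only [Complex.add_re, hre]; linarith))
    · rintro d ⟨hd, hds⟩ x hx
      have hre := re_mem_of_mem_segment hx
      simp only [Complex.add_re, Complex.ofReal_re, Complex.re_ofReal_mul, Complex.I_re, mul_zero,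
        add_zero, Set.uIcc_self, Set.mem_singleton_iff] at hre
      have hd1 := lt_of_lt_of_le (mem_halfStrip.1 hd).1 (min_le_left _ _)
      have hd2 := lt_of_lt_of_le (side_lt_of_mem_halfStrip hσ hd) (min_le_right _ _)
      have hds' : 0 < σ * d.im := hds
      have him : 0 ≤ σ * (h - x.im) ∧ σ * (h - x.im) < ε₁ / 2 := by
        have hc : Convex ℝ {z : ℂ | σ * z.im ≤ σ * h} :=
          convex_halfSpace_le (IsLinearMap.mk (by simp [mul_add]) (by simp [mul_left_comm])) _
        have hc' : Convex ℝ {z : ℂ | σ * h - ε₁ / 2 < σ * z.im} :=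
          convex_halfSpace_gt (IsLinearMap.mk (by simp [mul_add]) (by simp [mul_left_comm])) _
        have e1 := hc.segment_subset (x := x₀ + s * Complex.I) (y := x₀ + h * Complex.I)
          (by simp; linarith) (by simp) hx
        have e2 := hc'.segment_subset (x := x₀ + s * Complex.I) (y := x₀ + h * Complex.I)
          (by
            have := side_le_abs hσ (-(s - h))
            rw [abs_neg] at this
            simp
            linarith) (by simp; positivity) hx
        simp only [Set.mem_ofPred_eq] at e1 e2
        rw [mul_sub]
        constructor <;> linarith
      obtain ⟨hne, hlt⟩ := abs_im_lt_of_side (t := d.im + (h - x.im)) (ε := ε₁) hσ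
        (by rw [mul_add]; linarith) (by rw [mul_add]; linarith)
      refine hG.analyticAt (h1 _ ?_ ?_ ?_)
      · simp only [Complex.add_re, Complex.sub_re, hre]; linarith
      · simp only [Complex.add_im, Complex.sub_im]
        intro hc
        exact hne (by linarith)
      · simp only [Complex.add_im, Complex.sub_im]
        rwa [show ξ.im + (d.im - x.im) - (ξ.im - h) = d.im + (h - x.im) by ring]
  · have e := conv_add_base (fun x => F (Complex.exp (ζ + x))) (fun x => G (Complex.exp (ξ + x)))
      (x₀ + h * Complex.I) ((s - h) * Complex.I) 0
    rw [add_zero, show (x₀ : ℂ) + h * Complex.I + (s - h) * Complex.I = x₀ + s * Complex.I by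
      ring] at e
    rw [e]
    have hmul : ((s : ℂ) - h) * Complex.I = ((s - h : ℝ) : ℂ) * Complex.I := by push_cast; ring
    refine h2 _ ?_ ?_
    · rw [hmul, norm_mul, Complex.norm_real, Complex.norm_I, mul_one]
      exact hsε.2
    · rw [hmul, Complex.im_ofReal_mul, Complex.I_im, mul_one]
      exact hs.le

end Arc

section Arc

variable {K : Subfield ℂ} {S T : Set ℂ} {F G : ℂ → ℂ}

theorem HasLogGerms.regGerm_exp (hF : HasLogGerms K S F) {p : ℂ} (hp : Complex.exp p ∉ S) {σ : ℝ}
    (hσ : σ = 1 ∨ σ = -1) : RegGerm σ (fun y => F (Complex.exp (p + y))) := by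
  simp only [Complex.exp_add]
  exact hF.regGerm _ (Complex.exp_ne_zero p) hp σ hσ

theorem HasLogGerms.locGerm_exp (hF : HasLogGerms K S F) (p : ℂ) {σ : ℝ}
    (hσ : σ = 1 ∨ σ = -1) : LocGerm K σ (fun y => F (Complex.exp (p + y))) := by
  by_cases hp : Complex.exp p ∈ S
  · simp only [Complex.exp_add]
    exact hF.locGerm _ hp σ hσ
  · exact (hF.regGerm_exp hp hσ).locGerm hσ K

/-- On the line at height `h`, the displacement `d` moves `x + d` and `ξ + d - x` off their rays by
the same `d.im`, so neither factor meets a cut while `0 < σ * d.im`. A common singular abscissa of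
the two factors gives `α * β = exp ξ`. -/
theorem convContinues_horizontal (hF : HasLogGerms K S F) (hG : HasLogGerms K T G)
    {σ : ℝ} (hσ : σ = 1 ∨ σ = -1) {ξ : ℂ} {x₀ x₁ h : ℝ} (h01 : x₀ < x₁)
    (hS₀ : Complex.exp (x₀ + h * Complex.I) ∉ S) (hS₁ : Complex.exp (x₁ + h * Complex.I) ∉ S)
    (hT₀ : Complex.exp (ξ - (x₀ + h * Complex.I)) ∉ T)
    (hT₁ : Complex.exp (ξ - (x₁ + h * Complex.I)) ∉ T) :
    ConvContinues (fun x => F (Complex.exp (0 + x))) (fun x => G (Complex.exp (ξ + x)))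
      {d | 0 < σ * d.im} (GermIf K σ (Complex.exp ξ ∈ Set.image2 (· * ·) S T))
      (x₀ + h * Complex.I) (x₁ + h * Complex.I) := by
  obtain ⟨ε₁, hε₁, h1⟩ := hF.sing.exists_sector h (x₁ + 1)
  obtain ⟨ε₂, hε₂, h2⟩ := hG.sing.exists_sector (ξ.im - h) (ξ.re - x₀ + 1)
  refine ⟨min 1 (min ε₁ ε₂), by positivity, 0, _, ?_, fun _ _ _ => rfl, ?_⟩
  · have hseg : ∀ x ∈ segment ℝ (x₀ + h * Complex.I : ℂ) (x₁ + h * Complex.I),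
        x₀ ≤ x.re ∧ x.re ≤ x₁ ∧ x.im = h := fun x hx => by
      have hre := re_mem_of_mem_segment hx
      have him := im_mem_of_mem_segment hx
      simp only [Complex.add_re, Complex.ofReal_re, Complex.re_ofReal_mul, Complex.I_re, mul_zero,
        add_zero, Set.uIcc_of_le h01.le] at hre
      simp only [Complex.add_im, Complex.ofReal_im, Complex.im_ofReal_mul, Complex.I_im, mul_one,
        zero_add, Set.uIcc_self, Set.mem_singleton_iff] at him
      exact ⟨hre.1, hre.2, him⟩
    refine conv_differentiableOn ((isOpen_halfStrip _).inter
      (isOpen_lt continuous_const (by fun_prop))) ?_ ?_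
    · rintro d ⟨hd, hds⟩ x hx
      obtain ⟨-, hx2, hx3⟩ := hseg x hx
      have hd1 := lt_of_lt_of_le (mem_halfStrip.1 hd).1 (min_le_left _ _)
      obtain ⟨hne, hlt⟩ := abs_im_lt_of_side hσ hds (side_lt_of_mem_halfStrip hσ hd)
      simp only [lt_min_iff] at hlt
      refine hF.analyticAt (h1 _ ?_ ?_ ?_)
      · simp only [Complex.add_re, Complex.zero_re]; linarith
      · simp only [Complex.add_im, Complex.zero_im, hx3]
        intro hc
        exact hne (by linarith)
      · simp only [Complex.add_im, Complex.zero_im, hx3]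
        rw [show 0 + (h + d.im) - h = d.im by ring]
        exact hlt.2.1
    · rintro d ⟨hd, hds⟩ x hx
      obtain ⟨hx1, -, hx3⟩ := hseg x hx
      have hd1 := lt_of_lt_of_le (mem_halfStrip.1 hd).1 (min_le_left _ _)
      obtain ⟨hne, hlt⟩ := abs_im_lt_of_side hσ hds (side_lt_of_mem_halfStrip hσ hd)
      simp only [lt_min_iff] at hlt
      refine hG.analyticAt (h2 _ ?_ ?_ ?_)
      · simp only [Complex.add_re, Complex.sub_re]; linarith
      · simp only [Complex.add_im, Complex.sub_im, hx3]
        intro hc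
        exact hne (by linarith)
      · simp only [Complex.add_im, Complex.sub_im, hx3]
        rw [show ξ.im + (d.im - h) - (ξ.im - h) = d.im by ring]
        exact hlt.2.2
  · rw [add_comm (x₀ : ℂ), add_comm (x₁ : ℂ), conv_add_base]
    have inj1 : Function.Injective fun x : ℝ => Complex.exp (x + h * Complex.I) := fun a b hab => by
      have := congrArg norm hab
      simpa [Complex.norm_exp] using this
    have inj2 : Function.Injective fun x : ℝ => Complex.exp (ξ - (x + h * Complex.I)) :=
      fun a b hab => by
      have := congrArg norm hab
      simpa [Complex.norm_exp] using this
    refine GermIf.conv_horizontal hσ h01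
      (SA := {x : ℝ | Complex.exp (x + h * Complex.I) ∈ S})
      (SB := {x : ℝ | Complex.exp (ξ - (x + h * Complex.I)) ∈ T}) ?_ ?_ ?_ ?_ ?_ ?_
    · intro x _
      have e : (fun y : ℂ => F (Complex.exp (0 + (h * Complex.I + (x + y))))) =
          fun y => F (Complex.exp (x + h * Complex.I + y)) := by
        funext y
        congr 2
        ring
      rw [e]
      exact ⟨hF.locGerm_exp _ hσ, fun hx => hF.regGerm_exp hx hσ⟩
    · intro x _
      have e : (fun y : ℂ => G (Complex.exp (ξ + (y - x - h * Complex.I)))) =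
          fun y => G (Complex.exp (ξ - (x + h * Complex.I) + y)) := by
        funext y
        congr 2
        ring
      rw [e]
      exact ⟨hG.locGerm_exp _ hσ, fun hx => hG.regGerm_exp hx hσ⟩
    · intro x _
      obtain ⟨δ₁, hδ₁, g1⟩ := hF.sing.exists_isolated
        (e := fun x : ℝ => Complex.exp (x + h * Complex.I)) (by fun_prop) inj1 x
      obtain ⟨δ₂, hδ₂, g2⟩ := hG.sing.exists_isolated
        (e := fun x : ℝ => Complex.exp (ξ - (x + h * Complex.I))) (by fun_prop) inj2 x
      refine ⟨min δ₁ δ₂, lt_min hδ₁ hδ₂, fun t ht htx => ?_⟩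
      rw [lt_min_iff] at htx
      exact ht.elim (fun ht => g1 t ht htx.1) (fun ht => g2 t ht htx.2)
    · intro x _ hA hB
      refine ⟨_, hA, _, hB, ?_⟩
      simp only
      rw [← Complex.exp_add]
      congr 1
      ring
    · exact fun hc => hc.elim hS₀ hT₀
    · exact fun hc => hc.elim hS₁ hT₁

theorem GermIf.const_mul {σ : ℝ} {q : Prop} {A : ℂ → ℂ} (hA : GermIf K σ q A) (a : ℂ) :
    GermIf K σ q (fun x => a * A x) :=
  hA.imp (fun h => h.const_mul a) (fun h => ⟨h.1, h.2.const_mul a⟩)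

/-- Both factors of the convolution are analytic far to the left. -/
theorem HasLogGerms.exists_re_lt (hF : HasLogGerms K S F) (ξ : ℂ) :
    ∃ m : ℝ, ∀ x : ℂ, x.re < m → ξ + x ∈ logStar S := by
  obtain ⟨r, hr, h⟩ := hF.sing.exists_ball
  refine ⟨Real.log r - ξ.re, fun x hx => mem_principalStar_of_norm_lt h ?_⟩
  rw [Complex.norm_exp, Complex.add_re]
  exact (Real.lt_log_iff_exp_lt hr).1 (by linarith)

theorem convContinues_add (hF : HasLogGerms K S F) (hG : HasLogGerms K T G) {ξ : ℂ}
    {D : Set ℂ} {R : (ℂ → ℂ) → Prop}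
    (hR : ∀ J J', R J → R J' → R (fun d => J d + J' d)) {a b c : ℂ}
    (h1 : ConvContinues (fun x => F (Complex.exp (0 + x))) (fun x => G (Complex.exp (ξ + x))) D R a b)
    (h2 : ConvContinues (fun x => F (Complex.exp (0 + x))) (fun x => G (Complex.exp (ξ + x)))
      D R b c) :
    ConvContinues (fun x => F (Complex.exp (0 + x))) (fun x => G (Complex.exp (ξ + x))) D R a c := by
  obtain ⟨m₁, hm₁⟩ := hF.exists_re_lt 0
  obtain ⟨m₂, hm₂⟩ := hG.exists_re_lt ξ
  exact h1.add (m := min m₁ m₂) (fun x hx => hF.analyticAt (hm₁ x (lt_of_lt_of_le hx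
    (min_le_left _ _)))) (fun x hx => hG.analyticAt (hm₂ x (lt_of_lt_of_le hx
    (min_le_right _ _)))) hR h2

/-- The crossing of height `h` is a detour: up to the level at `x₀`, along it to a far right `x₁`,
off the level on the other side at `x₁`, and back to `x₀`. The vertical pieces are harmless because
`F` is analytic at abscissa `x₀` and `G` at the reflected abscissa `x₁`; so all possible singularity
comes from the horizontal piece at height `h`. -/
theorem exists_convContinues_level_side (hF : HasLogGerms K S F) (hG : HasLogGerms K T G)
    {σ : ℝ} (hσ : σ = 1 ∨ σ = -1) {ξ : ℂ} {x₀ : ℝ}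
    (hx₀ : ∀ x : ℂ, x.re ≤ x₀ + 1 → x ∈ logStar S)
    (hT₀ : ∀ β ∈ T, ‖β‖ ≠ Real.exp (ξ.re - x₀)) (h : ℝ) :
    ∃ ε > 0, ∀ s e : ℝ, σ * (s - h) < 0 → 0 < σ * (e - h) → |s - h| < ε → |e - h| < ε →
      ConvContinues (fun x => F (Complex.exp (0 + x))) (fun x => G (Complex.exp (ξ + x)))
        {d | 0 < σ * d.im} (GermIf K σ (Complex.exp ξ ∈ Set.image2 (· * ·) S T))
        (x₀ + s * Complex.I) (x₀ + e * Complex.I) := by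
  obtain ⟨m, hm⟩ := hG.exists_re_lt ξ
  -- Being beyond `1 - m` makes `ξ - x` fall where `G` is analytic, and avoiding the moduli of `S`
  -- makes `F` regular at the corner.
  obtain ⟨x₁, hx₁, hS₁⟩ := hF.sing.exists_exp_ne (lt_add_one (max x₀ (1 - m)))
  have h01 : x₀ < x₁ := lt_of_le_of_lt (le_max_left _ _) hx₁.1
  have hm1 : 1 - m < x₁ := lt_of_le_of_lt (le_max_right _ _) hx₁.1
  have hT₀' : Complex.exp (ξ - (x₀ + h * Complex.I)) ∉ T := fun hc =>
    hT₀ _ hc (by simp [Complex.norm_exp])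
  have hS₁' : Complex.exp (x₁ + h * Complex.I) ∉ S := fun hc =>
    hS₁ _ hc (by simp [Complex.norm_exp])
  have not_of_logStar : ∀ {S : Set ℂ} {x : ℂ}, x ∈ logStar S → Complex.exp x ∉ S :=
    fun hx hc => hx 1 zero_le_one le_rfl (by simpa using hc)
  have hS₀' : Complex.exp (x₀ + h * Complex.I) ∉ S := not_of_logStar (hx₀ _ (by simp))
  have hsmall : ∀ x : ℂ, x.re < m → ξ + x ∈ logStar T := hm
  have hT₁' : Complex.exp (ξ - (x₁ + h * Complex.I)) ∉ T := by
    rw [sub_eq_add_neg]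
    exact not_of_logStar (hm _ (by simp; linarith))
  obtain ⟨ε₁, hε₁, c1⟩ := exists_convContinues_vertical hF hG hσ (ζ := 0) (ξ := ξ) (x₀ := x₀)
    (h := h) (by simpa using hx₀) (by
      have := hG.regGerm_exp hT₀' hσ
      convert this using 4
      ring) (R := GermIf K σ (Complex.exp ξ ∈ Set.image2 (· * ·) S T)) (fun J hJ => Or.inl hJ)
  obtain ⟨ε₂, hε₂, c3⟩ := exists_convContinues_vertical hG hF hσ (ζ := ξ) (ξ := 0) (x₀ := -x₁)
    (h := -h) (fun x hx => by
      have := hm (x - ξ) (by rw [Complex.sub_re]; linarith)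
      rwa [add_sub_cancel] at this) (by
      have := hF.regGerm_exp hS₁' hσ
      convert this using 4
      push_cast
      ring) (R := GermIf K σ (Complex.exp ξ ∈ Set.image2 (· * ·) S T)) (fun J hJ => Or.inl hJ)
  obtain ⟨ε₃, hε₃, c4⟩ := exists_horizontal_segments hF.sing hG.sing ξ h x₁ x₀
  have c2 := convContinues_horizontal hF hG hσ h01 hS₀' hS₁' hT₀' hT₁'
  refine ⟨min ε₁ (min ε₂ ε₃), by positivity, fun s e hs he hsε heε => ?_⟩
  simp only [lt_min_iff] at hsε heε
  have hadd : ∀ J J', GermIf K σ (Complex.exp ξ ∈ Set.image2 (· * ·) S T) J →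
      GermIf K σ (Complex.exp ξ ∈ Set.image2 (· * ·) S T) J' →
      GermIf K σ (Complex.exp ξ ∈ Set.image2 (· * ·) S T) (fun d => J d + J' d) :=
    fun _ _ hJ hJ' => hJ.add hσ hJ'
  have d1 := c1 s hs hsε.1
  have d3 : ConvContinues (fun x => F (Complex.exp (0 + x))) (fun x => G (Complex.exp (ξ + x)))
      {d | 0 < σ * d.im} (GermIf K σ (Complex.exp ξ ∈ Set.image2 (· * ·) S T))
      (x₁ + h * Complex.I) (x₁ + e * Complex.I) := by
    have := c3 (-e) (by rw [show -e - -h = -(e - h) by ring, mul_neg]; linarith)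
      (by rw [show -e - -h = -(e - h) by ring, abs_neg]; exact heε.2.1)
    refine ConvContinues.swap ?_
    convert this using 1 <;> push_cast <;> ring
  have d4 : ConvContinues (fun x => F (Complex.exp (0 + x))) (fun x => G (Complex.exp (ξ + x)))
      {d | 0 < σ * d.im} (GermIf K σ (Complex.exp ξ ∈ Set.image2 (· * ·) S T))
      (x₁ + e * Complex.I) (x₀ + e * Complex.I) := by
    refine convContinues_of_segment hF hG (fun x hx => c4 e ?_ heε.2.2 x ?_ ?_) fun J hJ =>
      Or.inl ⟨J, hJ, Eventually.of_forall fun _ _ => rfl⟩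
    · rintro rfl
      simp at he
    · simpa using re_mem_of_mem_segment hx
    · simpa using im_mem_of_mem_segment hx
  exact convContinues_add hF hG hadd (convContinues_add hF hG hadd
    (convContinues_add hF hG hadd d1 c2) d3) d4

/-- At an abscissa `x₁` that is on no cut of `F` and on no reflected cut of `G`, the contour can
cross the height `h` directly, and `d = 0` is then an interior point of the continuation. -/
theorem exists_convContinues_level_star (hF : HasLogGerms K S F) (hG : HasLogGerms K T G)
    {ξ : ℂ} (hξ : ξ ∈ logStar (Set.image2 (· * ·) S T)) {x₀ : ℝ}
    (hx₀ : ∀ x : ℂ, x.re ≤ x₀ + 1 → x ∈ logStar S) (h : ℝ) :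
    ∃ ε > 0, ∀ s e : ℝ, s ≠ h → e ≠ h → |s - h| < ε → |e - h| < ε →
      ConvContinues (fun x => F (Complex.exp (0 + x))) (fun x => G (Complex.exp (ξ + x)))
        Set.univ (fun _ => True) (x₀ + s * Complex.I) (x₀ + e * Complex.I) := by
  obtain ⟨m, hm⟩ := hG.exists_re_lt ξ
  have hcS : Continuous fun x : ℝ => (x : ℂ) + h * Complex.I := by fun_prop
  have hcT : Continuous fun x : ℝ => ξ - ((x : ℂ) + h * Complex.I) := by fun_prop
  obtain ⟨x₁, -, hx₁S, hx₁T⟩ := isPreconnected_univ (α := ℝ)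
    {x : ℝ | (x : ℂ) + h * Complex.I ∈ logStar S}
    {x : ℝ | ξ - ((x : ℂ) + h * Complex.I) ∈ logStar T}
    (hF.sing.isOpen_logStar.preimage hcS) (hG.sing.isOpen_logStar.preimage hcT)
    -- The two open conditions cover the line: if both failed at one `x`, points of `S` and `T` on
    -- the two radial segments would multiply to a point of the product set on the segment from `0`
    -- to `exp ξ`. Connectedness then yields an abscissa satisfying both.
    (fun x _ => by
      by_contra hc
      simp only [Set.mem_union, Set.mem_ofPred_eq, not_or, logStar, principalStar, not_forall,
        not_not] at hc
      obtain ⟨⟨t, h0, h1, hS⟩, t', h0', h1', hT⟩ := hc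
      refine hξ (t * t') (by positivity) (mul_le_one₀ h1 h0' h1') ⟨_, hS, _, hT, ?_⟩
      simp only
      rw [mul_mul_mul_comm, ← Complex.exp_add]
      push_cast
      congr 2
      ring)
    ⟨x₀, trivial, hx₀ _ (by simp)⟩
    ⟨1 - m, trivial, by
      have := hm (-(((1 - m : ℝ) : ℂ) + h * Complex.I)) (by simp)
      rwa [← sub_eq_add_neg] at this⟩
  have hev : ∀ᶠ x : ℂ in 𝓝 ((x₁ : ℂ) + h * Complex.I), x ∈ logStar S ∧ ξ - x ∈ logStar T :=
    Filter.Eventually.and (hF.sing.isOpen_logStar.mem_nhds hx₁S)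
      ((hG.sing.isOpen_logStar.preimage (f := fun x : ℂ => ξ - x) (by fun_prop)).mem_nhds hx₁T)
  obtain ⟨ε₁, hε₁, g1⟩ := Metric.eventually_nhds_iff_ball.1 hev
  obtain ⟨ε₂, hε₂, g2⟩ := exists_horizontal_segments hF.sing hG.sing ξ h x₀ x₁
  have hhor : ∀ e : ℝ, e ≠ h → |e - h| < ε₂ →
      ConvContinues (fun x => F (Complex.exp (0 + x))) (fun x => G (Complex.exp (ξ + x)))
        Set.univ (fun _ => True) (x₀ + e * Complex.I) (x₁ + e * Complex.I) := fun e he heε =>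
    convContinues_of_segment hF hG (fun x hx => g2 e he heε x
      (by simpa using re_mem_of_mem_segment hx)
      (by simpa using im_mem_of_mem_segment hx)) fun _ _ => trivial
  refine ⟨min ε₁ ε₂, lt_min hε₁ hε₂, fun s e hs he hsε heε => ?_⟩
  rw [lt_min_iff] at hsε heε
  have hver : ConvContinues (fun x => F (Complex.exp (0 + x))) (fun x => G (Complex.exp (ξ + x)))
      Set.univ (fun _ => True) (x₁ + s * Complex.I) (x₁ + e * Complex.I) := by
    refine convContinues_of_segment hF hG (fun x hx => g1 x ?_) fun _ _ => trivial
    have hmem : ∀ r : ℝ, |r - h| < ε₁ →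
        (x₁ : ℂ) + r * Complex.I ∈ Metric.ball ((x₁ : ℂ) + h * Complex.I) ε₁ := fun r hr => by
      rw [mem_ball_iff_norm, show (x₁ : ℂ) + r * Complex.I - (x₁ + h * Complex.I) =
        ((r - h : ℝ) : ℂ) * Complex.I by push_cast; ring, norm_mul, Complex.norm_real,
        Complex.norm_I, mul_one]
      exact hr
    exact (convex_ball _ _).segment_subset (hmem s hsε.1) (hmem e heε.1) hx
  exact convContinues_add hF hG (fun _ _ _ _ => trivial) (convContinues_add hF hG
    (fun _ _ _ _ => trivial) (hhor s hs hsε.2) hver) ((hhor e he heε.2).symm fun _ _ => trivial)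

/-- From local continuability near each height to a full turn. -/
theorem convContinues_full_turn (hF : HasLogGerms K S F) (hG : HasLogGerms K T G)
    {ξ : ℂ} {x₀ : ℝ} (hx₀ : ∀ x : ℂ, x.re ≤ x₀ + 1 → x ∈ logStar S) {D : Set ℂ}
    {R : (ℂ → ℂ) → Prop} (hR : ∀ J, AnalyticAt ℂ J 0 → R J)
    (hadd : ∀ J J', R J → R J' → R (fun d => J d + J' d))
    (hlev : ∀ h : ℝ, ∃ ε > 0, ∀ a b : ℝ, a < h → h < b → |a - h| < ε → |b - h| < ε →
      ConvContinues (fun x => F (Complex.exp (0 + x))) (fun x => G (Complex.exp (ξ + x)))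
        D R (x₀ + a * Complex.I) (x₀ + b * Complex.I)) :
    ∃ τ : ℝ, ConvContinues (fun x => F (Complex.exp (0 + x))) (fun x => G (Complex.exp (ξ + x)))
        D R (x₀ + τ * Complex.I) (x₀ + (τ + 2 * Real.pi : ℝ) * Complex.I) := by
  -- The heights at which the vertical line through `x₀` meets a reflected cut of `G`; `F` is always
  -- analytic there.
  let Q : Set ℝ := {y | ξ - ((x₀ : ℂ) + y * Complex.I) ∉ logStar T}
  have hiso : ∀ h : ℝ, ∃ ε > 0, ∀ t, t ∈ Q → |t - h| < ε → t = h := fun h => by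
    obtain ⟨ε, hε, g⟩ := hG.sing.exists_sector (ξ.im - h) (ξ.re - x₀ + 1)
    refine ⟨ε, hε, fun t ht hth => ?_⟩
    by_contra hne
    refine ht (g _ (by simp) (by simpa using hne) ?_)
    have : (ξ - ((x₀ : ℂ) + t * Complex.I)).im - (ξ.im - h) = -(t - h) := by
      simp
    rwa [this, abs_neg]
  -- A height just above `0` avoids `Q`, and so does its translate by `2π`, by periodicity.
  obtain ⟨ε₀, hε₀, g0⟩ := hiso 0
  have hτ : ε₀ / 2 ∉ Q := fun hc => by
    have := g0 _ hc (by rw [sub_zero, abs_of_pos (by positivity)]; linarith)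
    linarith
  have hτ' : ε₀ / 2 + 2 * Real.pi ∉ Q := by
    intro hc
    refine hτ fun hmem => hc ?_
    rw [logStar, Set.mem_ofPred_eq] at hmem ⊢
    convert hmem using 1
    rw [← Complex.exp_periodic.sub_eq (ξ - ((x₀ : ℂ) + ((ε₀ / 2 : ℝ) : ℂ) * Complex.I))]
    congr 1
    push_cast
    ring
  refine ⟨ε₀ / 2, interval_property_of_local (P := fun a b : ℝ =>
    ConvContinues (fun x => F (Complex.exp (0 + x))) (fun x => G (Complex.exp (ξ + x)))
      D R (x₀ + a * Complex.I) (x₀ + b * Complex.I)) (Q := Q)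
      (by linarith [Real.pi_pos]) hτ hτ' ?_ ?_⟩
  · intro h _
    obtain ⟨ε₁, hε₁, g1⟩ := hiso h
    obtain ⟨ε₂, hε₂, g2⟩ := hlev h
    have hm1 := min_le_left ε₁ ε₂
    have hm2 := min_le_right ε₁ ε₂
    refine ⟨min ε₁ ε₂, lt_min hε₁ hε₂, fun t ht hth => g1 t ht (lt_of_lt_of_le hth hm1),
      fun a b ha hab hb haQ hbQ => ?_⟩
    by_cases hstr : a < h ∧ h < b
    · exact g2 a b hstr.1 hstr.2 (abs_lt.2 ⟨by linarith, by linarith [hstr.1]⟩)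
        (abs_lt.2 ⟨by linarith [hstr.2], by linarith⟩)
    · refine convContinues_of_segment hF hG (fun x hx => ?_) hR
      have hre : x.re = x₀ := by simpa using re_mem_of_mem_segment hx
      have him : x.im ∈ Set.Icc a b := by
        have := im_mem_of_mem_segment hx
        rw [← Set.uIcc_of_le hab.le]
        simpa using this
      refine ⟨hx₀ x (by linarith), ?_⟩
      have hxe : x = x₀ + x.im * Complex.I := by rw [← hre, Complex.re_add_im]
      by_contra hcon
      have hxQ : x.im ∈ Q := by
        show ξ - ((x₀ : ℂ) + x.im * Complex.I) ∉ logStar T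
        rwa [← hxe]
      have hxh := g1 _ hxQ (abs_lt.2 ⟨by linarith [him.1], by linarith [him.2]⟩)
      rw [hxh] at hxQ him
      refine hstr ⟨lt_of_le_of_ne him.1 ?_, lt_of_le_of_ne him.2 ?_⟩
      · rintro rfl; exact haQ hxQ
      · rintro rfl; exact hbQ hxQ
  · intro a b c _ _ _ _ h1 h2
    exact convContinues_add hF hG hadd h1 h2

/-- The abscissa is taken to the left of all of `S`, with the corresponding circle for `G` avoiding
the moduli of `T`; so on the vertical line `G` is regular from either side at every height. -/
theorem HasLogGerms.exists_base (hF : HasLogGerms K S F) (hG : HasLogGerms K T G) (ξ : ℂ) :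
    ∃ x₀ : ℝ, (∀ x : ℂ, x.re ≤ x₀ + 1 → x ∈ logStar S) ∧
      ∀ β ∈ T, ‖β‖ ≠ Real.exp (ξ.re - x₀) := by
  obtain ⟨m, hm⟩ := hF.exists_re_lt 0
  obtain ⟨y, hy, hT⟩ := hG.sing.exists_exp_ne (lt_add_one (ξ.re - m + 1))
  refine ⟨ξ.re - y, fun x hx => ?_, fun β hβ => ?_⟩
  · have := hm x (by linarith [hy.1])
    rwa [zero_add] at this
  · rw [sub_sub_cancel]
    exact hT β hβ

theorem exists_convContinues_side (hF : HasLogGerms K S F) (hG : HasLogGerms K T G)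
    {σ : ℝ} (hσ : σ = 1 ∨ σ = -1) (ξ : ℂ) :
    ∃ x₀ τ : ℝ, ConvContinues (fun x => F (Complex.exp (0 + x))) (fun x => G (Complex.exp (ξ + x)))
      {d | 0 < σ * d.im} (GermIf K σ (Complex.exp ξ ∈ Set.image2 (· * ·) S T))
      (x₀ + τ * Complex.I) (x₀ + (τ + 2 * Real.pi : ℝ) * Complex.I) := by
  obtain ⟨x₀, hx₀, hT₀⟩ := hF.exists_base hG ξ
  refine ⟨x₀, convContinues_full_turn hF hG hx₀
    (fun J hJ => Or.inl ⟨J, hJ, Eventually.of_forall fun _ _ => rfl⟩)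
    (fun _ _ hJ hJ' => hJ.add hσ hJ') fun h => ?_⟩
  obtain ⟨ε, hε, g⟩ := exists_convContinues_level_side hF hG hσ hx₀ hT₀ h
  refine ⟨ε, hε, fun a b ha hb haε hbε => ?_⟩
  rcases hσ with rfl | rfl
  · exact g a b (by linarith) (by linarith) haε hbε
  -- For `σ = -1` the detour runs downwards, so it is traversed backwards.
  · exact (g b a (by linarith) (by linarith) hbε haε).symm fun J hJ => hJ.const_mul (-1)

theorem exists_convContinues_star (hF : HasLogGerms K S F) (hG : HasLogGerms K T G)
    {ξ : ℂ} (hξ : ξ ∈ logStar (Set.image2 (· * ·) S T)) :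
    ∃ x₀ τ : ℝ, ConvContinues (fun x => F (Complex.exp (0 + x))) (fun x => G (Complex.exp (ξ + x)))
      Set.univ (fun _ => True)
      (x₀ + τ * Complex.I) (x₀ + (τ + 2 * Real.pi : ℝ) * Complex.I) := by
  obtain ⟨x₀, hx₀, -⟩ := hF.exists_base hG ξ
  refine ⟨x₀, convContinues_full_turn hF hG hx₀ (fun _ _ => trivial) (fun _ _ _ _ => trivial)
    fun h => ?_⟩
  obtain ⟨ε, hε, g⟩ := exists_convContinues_level_star hF hG hξ hx₀ h
  exact ⟨ε, hε, fun a b ha hb haε hbε => g a b ha.ne hb.ne' haε hbε⟩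

end Arc

/-! ### The Hadamard product as a convolution -/

theorem exists_radius {A : ℕ → ℂ} {F : ℂ → ℂ}
    (h : ∀ᶠ z in 𝓝 (0 : ℂ), HasSum (fun n => A n * z ^ n) (F z)) :
    ∃ r > 0, ∀ z : ℂ, ‖z‖ < r → HasSum (fun n => A n * z ^ n) (F z) := by
  obtain ⟨r, hr, h⟩ := Metric.eventually_nhds_iff.1 h
  exact ⟨r, hr, fun z hz => h (by simpa using hz)⟩

theorem integral_exp_int_mul (k : ℤ) :
    ∫ t in (0 : ℝ)..1, Complex.exp (k * (2 * Real.pi * Complex.I) * t) = if k = 0 then 1 else 0 := by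
  split_ifs with hk
  · simp [hk]
  · rw [integral_exp_mul_complex (mul_ne_zero (by exact_mod_cast hk) Complex.two_pi_I_ne_zero)]
    have h1 : Complex.exp (k * (2 * Real.pi * Complex.I)) = 1 := Complex.exp_int_mul_two_pi_mul_I k
    simp [h1]

theorem hasSum_mul_prod {f g : ℕ → ℂ} {s t : ℂ} (hf : HasSum f s) (hg : HasSum g t) :
    HasSum (fun i : ℕ × ℕ => f i.1 * g i.2) (s * t) := by
  have h1 := hf.summable.norm
  have h2 := hg.summable.norm
  exact hf.mul hg (summable_mul_of_summable_norm h1 h2)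

/-- Parseval's formula for two absolutely convergent power series. -/
theorem hasSum_integral_mul {A B : ℕ → ℂ} {F G : ℂ → ℂ} {a b : ℂ}
    (hF : ∀ z : ℂ, ‖z‖ = ‖a‖ → HasSum (fun n => A n * z ^ n) (F z))
    (hG : ∀ z : ℂ, ‖z‖ = ‖b‖ → HasSum (fun n => B n * z ^ n) (G z)) :
    HasSum (fun n => A n * B n * (a * b) ^ n)
      (∫ t in (0 : ℝ)..1, F (a * Complex.exp (2 * Real.pi * Complex.I * t)) *
        G (b * Complex.exp (-(2 * Real.pi * Complex.I * t)))) := by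
  have hn1 : ∀ t : ℝ, ‖Complex.exp (2 * Real.pi * Complex.I * t)‖ = 1 := fun t => by
    rw [Complex.norm_exp]; simp
  have hn2 : ∀ t : ℝ, ‖Complex.exp (-(2 * Real.pi * Complex.I * t))‖ = 1 := fun t => by
    rw [Complex.norm_exp]; simp
  have hA := (hF a rfl).summable.norm
  have hB := (hG b rfl).summable.norm
  have hAB := Summable.mul_norm hA hB
  have hint : ∀ m n : ℕ, (∫ t in (0 : ℝ)..1,
      A m * (a * Complex.exp (2 * Real.pi * Complex.I * t)) ^ m *
        (B n * (b * Complex.exp (-(2 * Real.pi * Complex.I * t))) ^ n)) =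
      A m * a ^ m * (B n * b ^ n) * if (m : ℤ) - n = 0 then 1 else 0 := by
    intro m n
    rw [← integral_exp_int_mul, ← intervalIntegral.integral_const_mul]
    refine intervalIntegral.integral_congr fun t _ => ?_
    rw [mul_pow, mul_pow, ← Complex.exp_nat_mul, ← Complex.exp_nat_mul,
      show (((m : ℤ) - (n : ℤ) : ℤ) : ℂ) * (2 * Real.pi * Complex.I) * t =
        m * (2 * Real.pi * Complex.I * t) + n * -(2 * Real.pi * Complex.I * t) by
        push_cast; ring, Complex.exp_add]
    ring
  have key : HasSum (fun i : ℕ × ℕ => ∫ t in (0 : ℝ)..1,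
      A i.1 * (a * Complex.exp (2 * Real.pi * Complex.I * t)) ^ i.1 *
        (B i.2 * (b * Complex.exp (-(2 * Real.pi * Complex.I * t))) ^ i.2))
      (∫ t in (0 : ℝ)..1, F (a * Complex.exp (2 * Real.pi * Complex.I * t)) *
        G (b * Complex.exp (-(2 * Real.pi * Complex.I * t)))) := by
    refine intervalIntegral.hasSum_integral_of_dominated_convergence
      (fun i _ => ‖A i.1 * a ^ i.1 * (B i.2 * b ^ i.2)‖) (fun i => ?_) (fun i => ?_) ?_ ?_ ?_
    · exact (by fun_prop : Continuous fun t : ℝ =>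
        A i.1 * (a * Complex.exp (2 * Real.pi * Complex.I * t)) ^ i.1 *
        (B i.2 * (b * Complex.exp (-(2 * Real.pi * Complex.I * t))) ^ i.2)).aestronglyMeasurable
    · refine Eventually.of_forall fun t _ => le_of_eq ?_
      simp only [norm_mul, norm_pow, hn1, hn2, mul_one]
    · exact Eventually.of_forall fun _ _ => hAB
    · exact intervalIntegrable_const
    · refine Eventually.of_forall fun t _ => ?_
      have h1 := hF (a * Complex.exp (2 * Real.pi * Complex.I * t)) (by
        rw [norm_mul, hn1, mul_one])
      have h2 := hG (b * Complex.exp (-(2 * Real.pi * Complex.I * t))) (by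
        rw [norm_mul, hn2, mul_one])
      have h3 := hasSum_mul_prod h1 h2
      beta_reduce at h3 ⊢
      exact h3
  have hinj : Function.Injective fun n : ℕ => (n, n) := fun m n h => (Prod.ext_iff.1 h).1
  rw [← hinj.hasSum_iff] at key
  · convert key using 2 with n
    rw [Function.comp, hint, sub_self, if_pos rfl, mul_pow]
    ring
  · rintro ⟨m, n⟩ hmn
    rw [hint, if_neg, mul_zero]
    intro h
    refine hmn ⟨m, ?_⟩
    simp only [Prod.mk.injEq, true_and]
    have : (m : ℤ) = n := by linarith
    exact_mod_cast this

/-- The sum of the power series with the coefficients `A n * B n`. -/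
noncomputable def hadamardSum (A B : ℕ → ℂ) (z : ℂ) : ℂ := ∑' n, A n * B n * z ^ n

/-- Parseval's formula on small circles; the symmetric parameter doubles in the product of the two
arguments, whence `ξ + 2 * d`. -/
theorem conv_full_turn_eq {A B : ℕ → ℂ} {F G : ℂ → ℂ}
    (hF : ∀ᶠ z in 𝓝 (0 : ℂ), HasSum (fun n => A n * z ^ n) (F z))
    (hG : ∀ᶠ z in 𝓝 (0 : ℂ), HasSum (fun n => B n * z ^ n) (G z)) (ξ : ℂ) (x₀ τ : ℝ) :
    ∃ ℓ : ℝ, ∀ d : ℂ, d.re < ℓ →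
      conv (fun x => F (Complex.exp (0 + x))) (fun x => G (Complex.exp (ξ + x)))
        (x₀ + τ * Complex.I) (x₀ + (τ + 2 * Real.pi : ℝ) * Complex.I) d =
      2 * Real.pi * Complex.I * hadamardSum A B (Complex.exp (ξ + 2 * d)) := by
  obtain ⟨r, hr, hF⟩ := exists_radius hF
  obtain ⟨q, hq, hG⟩ := exists_radius hG
  refine ⟨min (Real.log r - x₀) (Real.log q - ξ.re + x₀), fun d hd => ?_⟩
  rw [lt_min_iff] at hd
  have h := hasSum_integral_mul (A := A) (B := B) (F := F) (G := G)
    (a := Complex.exp (x₀ + τ * Complex.I + d)) (b := Complex.exp (ξ + d - (x₀ + τ * Complex.I)))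
    (fun z hz => hF z (by
      rw [hz, Complex.norm_exp, ← Real.lt_log_iff_exp_lt hr]
      simp; linarith))
    (fun z hz => hG z (by
      rw [hz, Complex.norm_exp, ← Real.lt_log_iff_exp_lt hq]
      simp; linarith))
  rw [← Complex.exp_add, show (x₀ : ℂ) + τ * Complex.I + d + (ξ + d - (x₀ + τ * Complex.I)) =
    ξ + 2 * d by ring] at h
  rw [hadamardSum, h.tsum_eq, conv, segInt]
  have e : (x₀ : ℂ) + (τ + 2 * Real.pi : ℝ) * Complex.I - (x₀ + τ * Complex.I) =
      2 * Real.pi * Complex.I := by push_cast; ring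
  rw [e]
  congr 1
  refine intervalIntegral.integral_congr fun t _ => ?_
  simp only [← Complex.exp_add]
  congr 3 <;> ring

theorem exists_hasSum_hadamardSum {A B : ℕ → ℂ} {F G : ℂ → ℂ}
    (hF : ∀ᶠ z in 𝓝 (0 : ℂ), HasSum (fun n => A n * z ^ n) (F z))
    (hG : ∀ᶠ z in 𝓝 (0 : ℂ), HasSum (fun n => B n * z ^ n) (G z)) :
    ∃ r > 0, (∀ z : ℂ, ‖z‖ < r → HasSum (fun n => A n * B n * z ^ n) (hadamardSum A B z)) ∧
      DifferentiableOn ℂ (hadamardSum A B) (Metric.ball 0 r) := by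
  obtain ⟨r, hr, hF⟩ := exists_radius hF
  obtain ⟨q, hq, hG⟩ := exists_radius hG
  have hA := (hF ((r / 2 : ℝ) : ℂ) (by
    rw [Complex.norm_real, Real.norm_of_nonneg (by positivity)]; linarith)).summable.norm
  have hB := (hG ((q / 2 : ℝ) : ℂ) (by
    rw [Complex.norm_real, Real.norm_of_nonneg (by positivity)]; linarith)).summable.norm
  have hinj : Function.Injective fun n : ℕ => (n, n) := fun m n h => (Prod.ext_iff.1 h).1
  have hu := (Summable.mul_norm hA hB).comp_injective hinj
  have hle : ∀ (n : ℕ) (z : ℂ), z ∈ Metric.ball (0 : ℂ) (r / 2 * (q / 2)) →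
      ‖A n * B n * z ^ n‖ ≤ ‖A n * ((r / 2 : ℝ) : ℂ) ^ n * (B n * ((q / 2 : ℝ) : ℂ) ^ n)‖ := by
    intro n z hz
    rw [mem_ball_zero_iff] at hz
    rw [mul_mul_mul_comm, ← mul_pow, norm_mul, norm_mul _ ((_ : ℂ) ^ n), norm_pow, norm_pow,
      norm_mul ((r / 2 : ℝ) : ℂ), Complex.norm_real, Complex.norm_real,
      Real.norm_of_nonneg (by positivity), Real.norm_of_nonneg (by positivity)]
    gcongr
  refine ⟨r / 2 * (q / 2), by positivity, fun z hz => ?_, ?_⟩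
  · exact (Summable.of_norm_bounded hu (fun n => hle n z (by simpa using hz))).hasSum
  · exact Complex.differentiableOn_tsum_of_summable_norm hu (fun n => by fun_prop)
      Metric.isOpen_ball hle

/-! ### The continuation of a germ through logarithmic charts -/

/-- `J` continues `d ↦ P (exp (ξ + 2 * d))` from far left to a half strip. -/
def IsLogContinuation (P : ℂ → ℂ) (ξ : ℂ) (J : ℂ → ℂ) : Prop :=
  ∃ η > 0, DifferentiableOn ℂ J (halfStrip η) ∧
    ∃ ℓ : ℝ, ∀ d ∈ halfStrip η, d.re < ℓ → J d = P (Complex.exp (ξ + 2 * d))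

open scoped Classical in
/-- The value at `z` of the radial continuation of the germ of `P` at `0`. -/
noncomputable def logContinuation (P : ℂ → ℂ) (z : ℂ) : ℂ :=
  if z = 0 then P 0
  else if h : ∃ J, IsLogContinuation P (Complex.log z) J then h.choose 0 else 0

/-- Leftward invariance brings every point of `U` into the region of agreement, so the identity
theorem applies. -/
theorem eqOn_of_eq_left {J J' : ℂ → ℂ} {U : Set ℂ} {ℓ : ℝ} (hU : IsOpen U) (hU' : Convex ℝ U)
    (hl : ∀ d ∈ U, ∀ t : ℝ, 0 ≤ t → d - t ∈ U) (hJ : DifferentiableOn ℂ J U)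
    (hJ' : DifferentiableOn ℂ J' U) (h : ∀ d ∈ U, d.re < ℓ → J d = J' d) : Set.EqOn J J' U := by
  intro d hd
  have hd' : d - (|d.re - ℓ| + 1 : ℝ) ∈ U := hl d hd _ (by positivity)
  refine (hJ.analyticOnNhd hU).eqOn_of_preconnected_of_eventuallyEq (hJ'.analyticOnNhd hU)
    hU'.isPreconnected hd' ?_ hd
  have hre : (d - (|d.re - ℓ| + 1 : ℝ)).re < ℓ := by
    rw [Complex.sub_re, Complex.ofReal_re]
    linarith [le_abs_self (d.re - ℓ)]
  filter_upwards [hU.mem_nhds hd', (isOpen_re_lt ℓ).mem_nhds hre] with x h1 h2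
  exact h x h1 h2

theorem halfStrip_sub {η : ℝ} {d : ℂ} (hd : d ∈ halfStrip η) {t : ℝ} (ht : 0 ≤ t) :
    d - t ∈ halfStrip η := by
  obtain ⟨h1, h2, h3⟩ := mem_halfStrip.1 hd
  exact mem_halfStrip.2 ⟨by simp; linarith, by simpa using h2, by simpa using h3⟩

/-- Translating `J` to the point `d` gives a continuation in the chart centred at the principal
logarithm, since only exponentials enter. By uniqueness it agrees with the chosen one, so the
pointwise definition glues to a single function. -/
theorem eq_logContinuation {P : ℂ → ℂ} {ξ : ℂ} {J : ℂ → ℂ} {U : Set ℂ} {ℓ : ℝ} (hU : IsOpen U)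
    (hl : ∀ d ∈ U, ∀ t : ℝ, 0 ≤ t → d - t ∈ U) (hJ : DifferentiableOn ℂ J U)
    (h : ∀ d ∈ U, d.re < ℓ → J d = P (Complex.exp (ξ + 2 * d))) {d : ℂ} (hd : d ∈ U) :
    J d = logContinuation P (Complex.exp (ξ + 2 * d)) := by
  have hexp : ∀ δ : ℂ, Complex.exp (Complex.log (Complex.exp (ξ + 2 * d)) + 2 * δ) =
      Complex.exp (ξ + 2 * (d + δ)) := fun δ => by
    rw [Complex.exp_add, Complex.exp_log (Complex.exp_ne_zero _), ← Complex.exp_add]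
    congr 1
    ring
  obtain ⟨r, hr, hrU⟩ := Metric.isOpen_iff.1 hU d hd
  have hsub : ∀ δ ∈ halfStrip (r / 2), d + δ ∈ U := by
    intro δ hδ
    obtain ⟨h1, h2, h3⟩ := mem_halfStrip.1 hδ
    have hm : d + (((max δ.re 0 : ℝ) : ℂ) + δ.im * Complex.I) ∈ U := by
      refine hrU ?_
      rw [mem_ball_iff_norm, add_sub_cancel_left]
      refine (norm_add_le _ _).trans_lt ?_
      rw [norm_mul, Complex.norm_real, Complex.norm_real, Complex.norm_I, mul_one,
        Real.norm_of_nonneg (le_max_right _ _), Real.norm_eq_abs]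
      have : max δ.re 0 < r / 2 := max_lt h1 (by positivity)
      have := abs_lt.2 ⟨h2, h3⟩
      linarith
    have := hl _ hm (max δ.re 0 - δ.re) (by linarith [le_max_left δ.re 0])
    convert this using 1
    conv_lhs => rw [← Complex.re_add_im δ]
    push_cast
    ring
  have hJd : DifferentiableOn ℂ (fun δ => J (d + δ)) (halfStrip (r / 2)) :=
    hJ.comp (by fun_prop) hsub
  have hJP : ∀ δ ∈ halfStrip (r / 2), δ.re < ℓ - d.re →
      J (d + δ) = P (Complex.exp (Complex.log (Complex.exp (ξ + 2 * d)) + 2 * δ)) := by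
    intro δ hδ hδl
    rw [hexp, h _ (hsub δ hδ) (by rw [Complex.add_re]; linarith)]
  have hex : ∃ J', IsLogContinuation P (Complex.log (Complex.exp (ξ + 2 * d))) J' :=
    ⟨_, r / 2, half_pos hr, hJd, _, hJP⟩
  rw [logContinuation, if_neg (Complex.exp_ne_zero _), dif_pos hex]
  obtain ⟨η', hη', hJ', ℓ', h'⟩ := hex.choose_spec
  have hη : 0 < min (r / 2) η' := lt_min (half_pos hr) hη'
  have hm1 := halfStrip_mono (min_le_left (r / 2) η')
  have hm2 := halfStrip_mono (min_le_right (r / 2) η')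
  have := eqOn_of_eq_left (ℓ := min (ℓ - d.re) ℓ') (isOpen_halfStrip _) (convex_halfStrip _)
    (fun d hd t ht => halfStrip_sub hd ht) (hJd.mono hm1) (hJ'.mono hm2) (fun δ hδ hδl => by
      rw [lt_min_iff] at hδl
      rw [hJP δ (hm1 hδ) hδl.1, h' δ (hm2 hδ) hδl.2]) (zero_mem_halfStrip hη)
  simpa using this

theorem eventually_logContinuation_eq {P : ℂ → ℂ} {r : ℝ} (hr : 0 < r)
    (hP : DifferentiableOn ℂ P (Metric.ball 0 r)) :
    ∀ᶠ z in 𝓝 (0 : ℂ), logContinuation P z = P z := by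
  filter_upwards [Metric.ball_mem_nhds (0 : ℂ) hr] with z hz
  rw [mem_ball_zero_iff] at hz
  by_cases h0 : z = 0
  · rw [logContinuation, if_pos h0, h0]
  · have hmem : ∀ d ∈ {d : ℂ | d.re < (Real.log r - Real.log ‖z‖) / 2},
        Complex.exp (Complex.log z + 2 * d) ∈ Metric.ball (0 : ℂ) r := fun d hd => by
      rw [mem_ball_zero_iff, Complex.norm_exp, ← Real.lt_log_iff_exp_lt hr]
      simp only [Set.mem_ofPred_eq] at hd
      simp [Complex.log_re]
      linarith
    have := eq_logContinuation (P := P) (ξ := Complex.log z) (ℓ := 0)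
      (J := fun d => P (Complex.exp (Complex.log z + 2 * d))) (isOpen_re_lt _)
      (fun d hd t ht => by
        simp only [Set.mem_ofPred_eq] at hd ⊢
        simp; linarith)
      (hP.comp (by fun_prop) hmem) (fun _ _ _ => rfl) (d := 0) (by
        have := Real.log_lt_log (norm_pos_iff.2 h0) hz
        simp only [Set.mem_ofPred_eq, Complex.zero_re]
        linarith)
    simpa [Complex.exp_log h0] using this.symm

theorem KRecurrentIntegrableClass.exists_hasLogGerms {K : Subfield ℂ} {f : PowerSeries ℂ}
    (hf : f ∈ KRecurrentIntegrableClass K) : ∃ (S : Set ℂ) (F : ℂ → ℂ), HasLogGerms K S F ∧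
      ∀ᶠ z in 𝓝 (0 : ℂ), HasSum (fun n : ℕ => PowerSeries.coeff n f * z ^ n) (F z) := by
  obtain ⟨S, F, h0, hfin, hpr, hreg, hloc⟩ := hf
  have hside : ∀ σ : ℝ, σ = 1 ∨ σ = -1 → ∃ s : RaySide, s.sign = σ := by
    rintro σ (rfl | rfl)
    · exact ⟨.left, rfl⟩
    · exact ⟨.right, rfl⟩
  refine ⟨S, F, ⟨⟨h0, hfin⟩, hpr.analyticOnNhd, fun p hp hpS σ hσ => ?_, fun p hp σ hσ => ?_⟩,
    hpr.hasSum_near_zero⟩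
  · obtain ⟨s, rfl⟩ := hside σ hσ
    exact (hreg p hp hpS s).regGerm hp
  · obtain ⟨s, rfl⟩ := hside σ hσ
    obtain ⟨c, Φ, h1, h2, h3⟩ := hloc p hp s
    exact h1.locGerm (by rintro rfl; exact h0 hp) h2 h3

/-- The half logarithm of `1 + x`, as a local coordinate. -/
theorem analyticAt_half_log : AnalyticAt ℂ (fun x => Complex.log (1 + x) / 2) 0 := by
  refine AnalyticAt.div_const (AnalyticAt.clog (by fun_prop) ?_)
  simp

/-- Near `1` the argument is an arcsine, which has the sign of the imaginary part; so the coordinate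
`log (1 + x) / 2` preserves sides. -/
theorem eventually_side_half_log (σ : ℝ) :
    ∀ᶠ x in 𝓝 (0 : ℂ), 0 < σ * x.im →
      0 < σ * (Complex.log (1 + x) / 2).im := by
  have hre : ∀ᶠ x in 𝓝 (0 : ℂ), 0 < (1 + x).re :=
    (by fun_prop : Continuous fun x : ℂ => (1 + x).re).continuousAt.eventually
      (lt_mem_nhds (by simp))
  filter_upwards [hre] with x hx hs
  have e : (Complex.log (1 + x) / 2).im = Real.arcsin ((1 + x).im / ‖1 + x‖) / 2 := by
    rw [show (2 : ℂ) = ((2 : ℝ) : ℂ) by norm_num, Complex.div_ofReal_im, Complex.log_im,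
      Complex.arg_of_re_nonneg hx.le]
  have hn : 0 < ‖1 + x‖ := norm_pos_iff.2 (by rintro h; simp [h] at hx)
  rw [e, Complex.add_im, Complex.one_im, zero_add]
  rcases lt_trichotomy x.im 0 with h | h | h
  · have h1 : Real.arcsin (x.im / ‖1 + x‖) < 0 := Real.arcsin_lt_zero.2 (div_neg_of_neg_of_pos h hn)
    have : σ < 0 := by
      by_contra hc
      exact absurd hs (not_lt.2 (mul_nonpos_of_nonneg_of_nonpos (not_lt.1 hc) h.le))
    exact mul_pos_of_neg_of_neg this (by linarith)
  · simp [h] at hs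
  · have h1 : 0 < Real.arcsin (x.im / ‖1 + x‖) := Real.arcsin_pos.2 (div_pos h hn)
    exact mul_pos ((pos_iff_pos_of_mul_pos hs).2 h) (by linarith)

/-! ### The Hadamard product on the star and at its boundary -/

section Product

variable {K : Subfield ℂ} {S T : Set ℂ} {F G : ℂ → ℂ} {A B : ℕ → ℂ}

theorem exists_continuation
    (hFA : ∀ᶠ z in 𝓝 (0 : ℂ), HasSum (fun n => A n * z ^ n) (F z))
    (hGB : ∀ᶠ z in 𝓝 (0 : ℂ), HasSum (fun n => B n * z ^ n) (G z)) {ξ : ℂ} {x₀ τ : ℝ}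
    {D : Set ℂ} (hD : IsOpen D) (hDl : ∀ d ∈ D, ∀ t : ℝ, d - t ∈ D) {R : (ℂ → ℂ) → Prop}
    (h : ConvContinues (fun x => F (Complex.exp (0 + x))) (fun x => G (Complex.exp (ξ + x)))
      D R (x₀ + τ * Complex.I) (x₀ + (τ + 2 * Real.pi : ℝ) * Complex.I)) :
    ∃ η > 0, ∃ J : ℂ → ℂ, DifferentiableOn ℂ J (halfStrip η ∩ D) ∧ R J ∧
      ∀ d ∈ halfStrip η ∩ D, logContinuation (hadamardSum A B) (Complex.exp (ξ + 2 * d)) =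
        (2 * Real.pi * Complex.I)⁻¹ * J d := by
  obtain ⟨η, hη, ℓ, J, hJ, hJe, hJR⟩ := h
  obtain ⟨ℓ', hℓ'⟩ := conv_full_turn_eq hFA hGB ξ x₀ τ
  refine ⟨η, hη, J, hJ, hJR, fun d hd => ?_⟩
  refine (eq_logContinuation (J := fun d => (2 * Real.pi * Complex.I)⁻¹ * J d) (ℓ := min ℓ ℓ')
    ((isOpen_halfStrip η).inter hD) (fun d hd t ht => ⟨halfStrip_sub hd.1 ht, hDl d hd.2 t⟩)
    (hJ.const_mul _) (fun d hd hl => ?_) hd).symm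
  rw [lt_min_iff] at hl
  rw [hJe d hd hl.1, hℓ' d hl.2, inv_mul_cancel_left₀ Complex.two_pi_I_ne_zero]

/-- Away from `0`, the value near `z` is `J` evaluated at `log (y / z) / 2`, and `J` is analytic at
`0` because the star case allows a full neighbourhood of `d = 0`. -/
theorem analyticAt_logContinuation (hF : HasLogGerms K S F) (hG : HasLogGerms K T G)
    (hFA : ∀ᶠ z in 𝓝 (0 : ℂ), HasSum (fun n => A n * z ^ n) (F z))
    (hGB : ∀ᶠ z in 𝓝 (0 : ℂ), HasSum (fun n => B n * z ^ n) (G z)) {z : ℂ}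
    (hz : z ∈ principalStar (Set.image2 (· * ·) S T)) :
    AnalyticAt ℂ (logContinuation (hadamardSum A B)) z := by
  by_cases h0 : z = 0
  · obtain ⟨r, hr, -, hd⟩ := exists_hasSum_hadamardSum hFA hGB
    rw [h0]
    exact (hd.analyticAt (Metric.ball_mem_nhds 0 hr)).congr
      ((eventually_logContinuation_eq hr hd).mono fun _ h => h.symm)
  · obtain ⟨x₀, τ, h⟩ := exists_convContinues_star hF hG (ξ := Complex.log z) (by
      rw [logStar, Set.mem_ofPred_eq, Complex.exp_log h0]; exact hz)
    obtain ⟨η, hη, J, hJ, -, hJe⟩ := exists_continuation hFA hGB isOpen_univ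
      (fun _ _ _ => trivial) h
    rw [Set.inter_univ] at hJ hJe
    have hq : AnalyticAt ℂ (fun y => Complex.log (1 + (y / z - 1)) / 2) z :=
      analyticAt_half_log.comp_of_eq (f := fun y => y / z - 1) (by fun_prop) (by simp [h0])
    have hq0 : Complex.log (1 + (z / z - 1)) / 2 = 0 := by simp [h0]
    have hJ0 : AnalyticAt ℂ (fun d => (2 * Real.pi * Complex.I)⁻¹ * J d) 0 :=
      analyticAt_const.mul
        (hJ.analyticAt ((isOpen_halfStrip η).mem_nhds (zero_mem_halfStrip hη)))
    refine (hJ0.comp_of_eq hq hq0).congr ?_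
    have hmem : ∀ᶠ y in 𝓝 z, Complex.log (1 + (y / z - 1)) / 2 ∈ halfStrip η :=
      hq.continuousAt.eventually ((isOpen_halfStrip η).mem_nhds (by
        beta_reduce; rw [hq0]; exact zero_mem_halfStrip hη))
    filter_upwards [hmem, isOpen_ne.mem_nhds h0] with y hy hy0
    simp only [Function.comp]
    rw [← hJe _ hy, mul_div_cancel₀ _ (two_ne_zero' ℂ), add_sub_cancel, Complex.exp_add,
      Complex.exp_log h0, Complex.exp_log (div_ne_zero hy0 h0), mul_div_cancel₀ _ h0]

/-- The germ in `d` given by the one-sided contour is carried to `z = p * (1 + x)` by `d = log (1 +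
x) / 2`. -/
theorem germIf_logContinuation (hF : HasLogGerms K S F) (hG : HasLogGerms K T G)
    (hFA : ∀ᶠ z in 𝓝 (0 : ℂ), HasSum (fun n => A n * z ^ n) (F z))
    (hGB : ∀ᶠ z in 𝓝 (0 : ℂ), HasSum (fun n => B n * z ^ n) (G z)) {p : ℂ} (hp : p ≠ 0)
    {σ : ℝ} (hσ : σ = 1 ∨ σ = -1) :
    GermIf K σ (p ∈ Set.image2 (· * ·) S T)
      (fun x => logContinuation (hadamardSum A B) (p + p * x)) := by
  obtain ⟨x₀, τ, h⟩ := exists_convContinues_side hF hG hσ (Complex.log p)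
  obtain ⟨η, hη, J, hJ, hR, hJe⟩ := exists_continuation hFA hGB
    (isOpen_lt continuous_const (by fun_prop)) (fun d hd t => by simpa using hd) h
  rw [Complex.exp_log hp] at hR
  have hq0 : Complex.log (1 + 0) / 2 = 0 := by simp
  have hmem : ∀ᶠ x in 𝓝 (0 : ℂ), Complex.log (1 + x) / 2 ∈ halfStrip η :=
    analyticAt_half_log.continuousAt.eventually ((isOpen_halfStrip η).mem_nhds (by
      beta_reduce; rw [hq0]; exact zero_mem_halfStrip hη))
  have hne : ∀ᶠ x in 𝓝 (0 : ℂ), 1 + x ≠ 0 :=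
    (by fun_prop : Continuous fun x : ℂ => 1 + x).continuousAt.eventually_ne (by simp)
  have hval : ∀ᶠ x in 𝓝 (0 : ℂ), 0 < σ * x.im → 0 < σ * (Complex.log (1 + x) / 2).im ∧
      logContinuation (hadamardSum A B) (p + p * x) =
        (2 * Real.pi * Complex.I)⁻¹ * J (Complex.log (1 + x) / 2) := by
    filter_upwards [hmem, hne, eventually_side_half_log σ] with x h1 h2 h3 hs
    refine ⟨h3 hs, ?_⟩
    rw [← hJe _ ⟨h1, h3 hs⟩, mul_div_cancel₀ _ (two_ne_zero' ℂ), Complex.exp_add,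
      Complex.exp_log hp, Complex.exp_log h2]
    congr 1
    ring
  rcases hR.const_mul (2 * Real.pi * Complex.I)⁻¹ with ⟨g, hg, hgJ⟩ | ⟨hpST, hloc⟩
  · refine Or.inl ⟨fun x => g (Complex.log (1 + x) / 2), ?_, ?_⟩
    · exact hg.comp_of_eq analyticAt_half_log hq0
    · have ht : Tendsto (fun x => Complex.log (1 + x) / 2) (𝓝 0) (𝓝 0) := by
        have := analyticAt_half_log.continuousAt.tendsto
        rwa [hq0] at this
      filter_upwards [hval, ht.eventually hgJ] with x h1 h2 hs
      rw [(h1 hs).2, ← h2 (h1 hs).1]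
  -- The derivative `1 / 2` is positive, which makes `κ 0` real, as a change of coordinate of local
  -- germs requires.
  · obtain ⟨κ, hκ, hκ0, hκe⟩ := exists_analyticAt_exp_eq (r := 1 / 2) analyticAt_half_log hq0
      (by norm_num) (by
        have h1 : HasDerivAt (fun x : ℂ => 1 + x) 1 0 := (hasDerivAt_id (0 : ℂ)).const_add 1
        have := (h1.clog (by simp)).div_const 2
        rw [this.deriv]
        norm_num)
    refine Or.inr ⟨hpST, hloc.comp hσ hκ hκ0 ?_⟩
    filter_upwards [hκe, hval] with x h1 h2 hs
    rw [h1]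
    exact h2 hs

end Product

/-! ### Return to the branches of the statement -/

theorem GermIf.extendsAcross {K : Subfield ℂ} {H : ℂ → ℂ} {p : ℂ} (hp : p ≠ 0) {q : Prop}
    (hq : ¬q) {s : RaySide} (h : GermIf K s.sign q (fun x => H (p + p * x))) :
    ExtendsAcross H p s := by
  obtain ⟨g, hg, h⟩ := h.resolve_right fun h => hq h.1
  refine ⟨fun z => g (z / p - 1), hg.comp_of_eq (f := fun z => z / p - 1) (by fun_prop)
    (by simp [hp]), ?_⟩
  have ht : Tendsto (fun z : ℂ => z / p - 1) (𝓝 p) (𝓝 0) := by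
    have : Continuous fun z : ℂ => z / p - 1 := by fun_prop
    simpa [hp] using this.tendsto p
  filter_upwards [ht.eventually h] with z hz hs
  have := hz (by simpa using RaySide.mem_region_iff.1 hs)
  rw [← this]
  congr 1
  field_simp
  ring

theorem LocGerm.exists_isLocalContinuation {K : Subfield ℂ} {H : ℂ → ℂ} {p : ℂ} {s : RaySide}
    (h : LocGerm K s.sign (fun x => H (p + p * x))) :
    ∃ (c : ℝ) (Φ : ℂ → ℂ),
      IsLocalContinuation H p s c Φ ∧ IsIntegrableAt p Φ ∧ IsRecurrentOver K c Φ := by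
  obtain ⟨c, V, φ, hV, hφ, h⟩ := h
  refine ⟨c, φ, ⟨hV.diff φ hφ, fun w h1 h2 => ?_⟩, fun M => ?_, hV.isRecurrentOver hφ⟩
  · rw [RaySide.mem_angles_iff] at h2
    exact h w h1 h2.1 h2.2
  · have := (hV.small φ hφ M).const_mul p
    rw [mul_zero] at this
    exact this.congr fun w => (mul_assoc _ _ _).symm

theorem mainTheorem10 (K : Subfield ℂ) (f g : PowerSeries ℂ)
    (hf : f ∈ KRecurrentIntegrableClass K) (hg : g ∈ KRecurrentIntegrableClass K) :
    hadamardProduct f g ∈ KRecurrentIntegrableClass K := by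
  obtain ⟨S, F, hF, hFA⟩ := KRecurrentIntegrableClass.exists_hasLogGerms hf
  obtain ⟨T, G, hG, hGB⟩ := KRecurrentIntegrableClass.exists_hasLogGerms hg
  have hST := hF.sing.image2_mul hG.sing
  obtain ⟨r, hr, hsum, hd⟩ := exists_hasSum_hadamardSum hFA hGB
  refine ⟨Set.image2 (· * ·) S T, logContinuation (hadamardSum _ _), hST.zero_notMem, hST.finite,
    ⟨?_, fun z hz => analyticAt_logContinuation hF hG hFA hGB hz⟩, fun p hp hpST s => ?_,
    fun p hp s => ?_⟩
  · filter_upwards [eventually_logContinuation_eq hr hd, Metric.ball_mem_nhds (0 : ℂ) hr]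
      with z h1 h2
    rw [h1]
    simpa [hadamardProduct] using hsum z (by simpa using h2)
  · exact (germIf_logContinuation hF hG hFA hGB hp s.sign_eq).extendsAcross hp hpST
  · have hp0 : p ≠ 0 := by
      rintro rfl
      exact hST.zero_notMem hp
    refine LocGerm.exists_isLocalContinuation (K := K) ?_
    -- A product `α * β` need not be singular for `F ⊙ G`; a regular germ also satisfies the
    -- conditions imposed at singular points.
    rcases germIf_logContinuation hF hG hFA hGB hp0 s.sign_eq with h | ⟨-, h⟩
    · exact h.locGerm s.sign_eq K
    · exact h
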